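/- Let $R=\mathbb{C}[z]$, $\sigma^{1/2}(z)=z-\tfrac12$, $\sigma(z)=z-1$. For $0\ne t\in R$ let $A(t)$ be the rank one generalized Weyl algebra: it is generated over $R$ by $X^{\pm}$ with relations $X^{\pm}p=\sigma^{\pm1}(p)X^{\pm}$ ($p\in R$) and $X^{\pm}X^{\mp}=\sigma^{\pm1/2}(t)$. If $M$ is an $A(s)$-module and $N$ an $A(t)$-module, then $M\otimes N:=M\otimes_{\mathbb{C}[z]}N$ is an $A(st)$-module via $p(v\otimes w)=pv\otimes w$, $X^{\pm}(v\otimes w)=X^{\pm}v\otimes X^{\pm}w$. Let $A(t)\text{-wmod}_{\mathcal O}$ be the category of $A(t)$-modules that are the direct sum of their weight spaces $M_\lambda=\{v: zv=\lambda v\}$, with all $M_\lambda$ finite-dimensional and $M_\lambda=0$ unless $\lambda\in\mathbb{Z}$; the support of $M$ is $\{\lambda: M_\lambda\neq0\}$. A directed subset of $\mathbb{R}$ is a function $S:\mathbb{R}\to\{0,1,\rightarrow,\leftarrow\}$; its underlying set is $\mathring S=\{x:S(x)\neq0\}$, and $S$ is connected if $\mathring S$ is nonempty and connected. Let $t=\prod_{i=1}^r(z-k_i)^{m_i}$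 with $r\ge0$, $k_i\in\mathbb{Z}+\frac12$, $k_1<\dots<k_r$, $m_i\geq1$. $S$ is $t$-admissible if $\mathring S$ is an intersection of intervals of the form $(k_i,\infty)$ and $(-\infty,k_i)$ (the empty intersection being $\mathbb{R}$), and $S(x)\in\{\rightarrow,\leftarrow\}$ exactly for $x\in\mathring S\cap\{k_1,\dots,k_r\}$. For connected $t$-admissible $S$ let $M_S^t$ be the $A(t)$-module with basis $v_n$ ($n\in\mathring S\cap\mathbb{Z}$) and action $p\,v_n=p(n)v_n$, $X^+v_n=\alpha_nv_{n+1}$, $X^-v_{n+1}=\beta_nv_n$ (with $v_n=0$ for $n\notin\mathring S$), where $(\alpha_n,\beta_n)$ is $(0,0)$, $(1,t(n+\frac12))$, $(1,0)$, $(0,1)$ according as $S(n+\frac12)$ is $0,1,\rightarrow,\leftarrow$. For $k\in\mathbb{Z}+\frac12$ let $\mathbb{R}_k^{+}$ (resp. $\mathbb{R}_k^-$) be the directed subset with value $\rightarrow$ (resp. $\leftarrow$) at $k$ and $1$ elsewhere; an interval is also regarded as a directed subset with values in $\{0,1\}$. **(1)** For every connected $t$-admissible $S$, $M_S^t$ is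 an indecomposable object of $A(t)\text{-wmod}_{\mathcal O}$ with support $\mathring S\cap\mathbb{Z}$; for a nonzero $v\in M_S^t$ of weight $k_a-\frac12$ one has $X^+v\neq0$ iff $S(k_a)=\rightarrow$, and for a nonzero $v$ of weight $k_a+\frac12$ one has $X^-v\ne0$ iff $S(k_a)=\leftarrow$. Every indecomposable object $M$ of $A(t)\text{-wmod}_{\mathcal O}$ is isomorphic to $M_S^t$ for a unique connected $t$-admissible $S$. **(2)** Let $M\cong M_S^t$ be such an object. There are $0\le i<j\le r+1$ with $\mathring S=(k_i,k_j)$, where $k_0=-\infty$, $k_{r+1}=\infty$, and $$M\cong M_1^{\otimes m_1}\otimes M_2^{\otimes m_2}\otimes\cdots\otimes M_r^{\otimes m_r}$$ as $A(t)$-modules, where $M_a$ is the following indecomposable object of $A(z-k_a)\text{-wmod}_{\mathcal O}$: $$M_a=\begin{cases}M^{z-k_a}_{(k_a,\infty)}&1\le a\le i,\\ M^{z-k_a}_{\mathbb{R}^+_{k_a}}& i<a<j,\ S(k_a)=\rightarrow,\\ M^{z-k_a}_{\mathbb{R}^-_{k_a}}& i<a<j,\ S(k_a)=\leftarrow,\\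 M^{z-k_a}_{(-\infty,k_a)}&j\le a\le r.\end{cases}$$ (For $r=0$ the empty tensor product is the module $M^1_{\mathbb{R}}$ over $A(1)$.) Moreover, $M_a$ is unique up to isomorphism for $i<a<j$, and also for $a=i$ and $a=j$ (when $1\le a\le r$): if $M\cong N_1^{\otimes m_1}\otimes\cdots\otimes N_r^{\otimes m_r}$ with each $N_a$ an indecomposable object of $A(z-k_a)\text{-wmod}_{\mathcal O}$, then $N_a\cong M_a$ for $i\le a\le j$. For $1\le a<i$ and for $j<a\le r$, each $M_a$ may independently be replaced by $M^{z-k_a}_{\mathbb{R}^{+}_{k_a}}$ or $M^{z-k_a}_{\mathbb{R}^{-}_{k_a}}$ and the isomorphism still holds. **(3)** For each $k\in\mathbb{C}$, $A(z-k)$ is isomorphic to the Weyl algebra $A_1(\mathbb{C})=\mathbb{C}\langle x,\partial\rangle/(\partial x-x\partial-1)$ via $X^+\mapsto x$, $X^-\mapsto\partial$, $z\mapsto\frac12(x\partial+\partial x)+k$. **(4)** For $k,l\in\mathbb{C}$ regard $A((z-k)(z-l))$-modules as $\mathfrak{sl}_2(\mathbb{C})$-modules via $e\mapsto\sqrt{-1}X^+$,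 $f\mapsto\sqrt{-1}X^-$, $h\mapsto 2z-(k+l)$. If $V$ is a finite-dimensional simple $\mathfrak{sl}_2$-module and $k,l\in\mathbb{Z}+\frac12$ satisfy $k-l=\dim V$, then $V\cong M^{z-k}_{(-\infty,k)}\otimes M^{z-l}_{(l,\infty)}$. For $k,l\in\mathbb{Z}+\frac12$, the Verma module of highest weight $k-l-1$ is isomorphic to $M^{z-k}_{(-\infty,k)}\otimes M^{z-l}_{\mathbb{R}_l^-}$ if $l<k$, and to $M^{z-k}_{(-\infty,k)}\otimes M^{z-l}_{(-\infty,l)}$ if $k\le l$. For every $c\in\mathbb{C}$ there are $k,l\in\mathbb{C}$ with $k-l=c+1$ and indecomposable objects $M$ of $A(z-k)\text{-wmod}_{\mathcal O}$ and $N$ of $A(z-l)\text{-wmod}_{\mathcal O}$ such that the Verma module of highest weight $c$ is isomorphic to $M\otimes N$. -/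

import Mathlib

open Polynomial
open scoped TensorProduct

universe u v

noncomputable section

namespace RankOne

/-! ### The rank one generalized Weyl algebra over `ℂ[z]` -/

/-- The automorphism `z ↦ z - a` of `ℂ[z]`.  In particular `σ = shift 1`, `σ^{1/2} = shift (1/2)`. -/
def shift (a : ℂ) : ℂ[X] →ₐ[ℂ] ℂ[X] := aeval (X - C a)

/-- The three generators. -/
inductive Gen
  | z
  | xp
  | xm

/-- The element `p(z)` of the free algebra on `z, X⁺, X⁻`. -/
def freePoly (p : ℂ[X]) : FreeAlgebra ℂ Gen := aeval (FreeAlgebra.ι ℂ Gen.z) p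

/-- The defining relations `X^± r = σ^{±1}(r) X^±` and `X^± X^∓ = σ^{±1/2}(t)`. -/
inductive GWARel (t : ℂ[X]) : FreeAlgebra ℂ Gen → FreeAlgebra ℂ Gen → Prop
  | xp_comm (p : ℂ[X]) : GWARel t (FreeAlgebra.ι ℂ Gen.xp * freePoly p)
      (freePoly (shift 1 p) * FreeAlgebra.ι ℂ Gen.xp)
  | xm_comm (p : ℂ[X]) : GWARel t (FreeAlgebra.ι ℂ Gen.xm * freePoly p)
      (freePoly (shift (-1) p) * FreeAlgebra.ι ℂ Gen.xm)
  | xp_xm : GWARel t (FreeAlgebra.ι ℂ Gen.xp * FreeAlgebra.ι ℂ Gen.xm)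
      (freePoly (shift (1 / 2) t))
  | xm_xp : GWARel t (FreeAlgebra.ι ℂ Gen.xm * FreeAlgebra.ι ℂ Gen.xp)
      (freePoly (shift (-1 / 2) t))

/-- The rank one generalized Weyl algebra `A(t)` over `ℂ[z]` with `σ(z) = z - 1`. -/
abbrev GWA (t : ℂ[X]) : Type := RingQuot (GWARel t)

namespace GWA

/-- The image of a generator in `A(t)`. -/
def gen (t : ℂ[X]) (g : Gen) : GWA t := RingQuot.mkAlgHom ℂ (GWARel t) (FreeAlgebra.ι ℂ g)

/-- The generator `z` of `A(t)`. -/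
def z (t : ℂ[X]) : GWA t := gen t Gen.z

/-- The generator `X⁺` of `A(t)`. -/
def xp (t : ℂ[X]) : GWA t := gen t Gen.xp

/-- The generator `X⁻` of `A(t)`. -/
def xm (t : ℂ[X]) : GWA t := gen t Gen.xm

/-- The structure map `ℂ[z] → A(t)`. -/
def poly (t : ℂ[X]) : ℂ[X] →ₐ[ℂ] GWA t := aeval (z t)

theorem mk_freePoly (t p : ℂ[X]) :
    RingQuot.mkAlgHom ℂ (GWARel t) (freePoly p) = poly t p := by
  unfold freePoly poly z gen
  exact (Polynomial.aeval_algHom_apply _ _ p).symm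

theorem xp_mul_poly (t p : ℂ[X]) : xp t * poly t p = poly t (shift 1 p) * xp t := by
  have h := RingQuot.mkAlgHom_rel ℂ (GWARel.xp_comm (t := t) p)
  rwa [map_mul, map_mul, mk_freePoly, mk_freePoly] at h

theorem xm_mul_poly (t p : ℂ[X]) : xm t * poly t p = poly t (shift (-1) p) * xm t := by
  have h := RingQuot.mkAlgHom_rel ℂ (GWARel.xm_comm (t := t) p)
  rwa [map_mul, map_mul, mk_freePoly, mk_freePoly] at h

theorem xp_mul_xm (t : ℂ[X]) : xp t * xm t = poly t (shift (1 / 2) t) := by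
  have h := RingQuot.mkAlgHom_rel ℂ (GWARel.xp_xm (t := t))
  rwa [map_mul, mk_freePoly] at h

theorem xm_mul_xp (t : ℂ[X]) : xm t * xp t = poly t (shift (-1 / 2) t) := by
  have h := RingQuot.mkAlgHom_rel ℂ (GWARel.xm_xp (t := t))
  rwa [map_mul, mk_freePoly] at h

end GWA

/-! ### The first Weyl algebra -/

/-- The relation `∂ x = x ∂ + 1`, where `x` is the generator `false` and `∂` the generator
`true`. -/
inductive WeylRel : FreeAlgebra ℂ Bool → FreeAlgebra ℂ Bool → Prop
  | comm : WeylRel (FreeAlgebra.ι ℂ true * FreeAlgebra.ι ℂ false)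
      (FreeAlgebra.ι ℂ false * FreeAlgebra.ι ℂ true + 1)

/-- The first Weyl algebra `A₁(ℂ) = ℂ⟨x, ∂⟩ / (∂ x - x ∂ - 1)`. -/
abbrev WeylAlgebra : Type := RingQuot WeylRel

/-- The generator `x` of the Weyl algebra. -/
def weylX : WeylAlgebra := RingQuot.mkAlgHom ℂ WeylRel (FreeAlgebra.ι ℂ false)

/-- The generator `∂` of the Weyl algebra. -/
def weylD : WeylAlgebra := RingQuot.mkAlgHom ℂ WeylRel (FreeAlgebra.ι ℂ true)

/-! ### Constructing modules over `A(t)` -/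

/-- Operators `X^±` on a `ℂ[z]`-module satisfying the defining relations of `A(t)`. -/
structure GWAAction (t : ℂ[X]) (V : Type u) [AddCommGroup V] [Module ℂ[X] V] where
  xp : V →+ V
  xm : V →+ V
  xp_smul : ∀ (p : ℂ[X]) (w : V), xp (p • w) = shift 1 p • xp w
  xm_smul : ∀ (p : ℂ[X]) (w : V), xm (p • w) = shift (-1) p • xm w
  xp_xm : ∀ w : V, xp (xm w) = shift (1 / 2) t • w
  xm_xp : ∀ w : V, xm (xp w) = shift (-1 / 2) t • w

namespace GWAAction

variable {t : ℂ[X]} {V : Type u} [AddCommGroup V] [Module ℂ[X] V]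

theorem shift_C (a c : ℂ) : shift a (C c) = C c := by
  simp [shift]

/-- The `ℂ`-module structure underlying a `ℂ[z]`-module. -/
abbrev complexModule (V : Type u) [AddCommGroup V] [Module ℂ[X] V] : Module ℂ V :=
  Module.compHom V (C : ℂ →+* ℂ[X])

/-- The algebra homomorphism `A(t) → End_ℂ(V)` given by such operators. -/
def toEnd (a : GWAAction t V) :
    letI := complexModule V
    GWA t →ₐ[ℂ] Module.End ℂ V :=
  letI := complexModule V
  let gens : Gen → Module.End ℂ V := fun g => match g with
    | Gen.z =>
      { toFun := fun w => (X : ℂ[X]) • w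
        map_add' := fun w w' => smul_add _ w w'
        map_smul' := fun c w => smul_comm (X : ℂ[X]) (C c) w }
    | Gen.xp =>
      { toFun := a.xp
        map_add' := map_add a.xp
        map_smul' := fun c w => by
          change a.xp (C c • w) = C c • a.xp w
          rw [a.xp_smul, shift_C] }
    | Gen.xm =>
      { toFun := a.xm
        map_add' := map_add a.xm
        map_smul' := fun c w => by
          change a.xm (C c • w) = C c • a.xm w
          rw [a.xm_smul, shift_C] }
  have hp : ∀ (p : ℂ[X]) (w : V), FreeAlgebra.lift ℂ gens (freePoly p) w = p • w := by
    intro p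
    induction p using Polynomial.induction_on' with
    | add p q hp hq =>
      intro w
      have : freePoly (p + q) = freePoly p + freePoly q := map_add _ p q
      rw [this, map_add, LinearMap.add_apply, hp, hq, add_smul]
    | monomial n c =>
      intro w
      have : freePoly (monomial n c)
          = c • (FreeAlgebra.ι ℂ Gen.z) ^ n := by
        simp [freePoly, aeval_monomial, Algebra.smul_def]
      rw [this, map_smul, map_pow, FreeAlgebra.lift_ι_apply, LinearMap.smul_apply]
      have hz : ∀ n : ℕ, ((gens Gen.z) ^ n) w = (X ^ n : ℂ[X]) • w := by
        intro n
        induction n with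
        | zero => simp
        | succ n ih =>
          rw [pow_succ', Module.End.mul_apply, ih]
          change (X : ℂ[X]) • (X ^ n : ℂ[X]) • w = _
          rw [smul_smul, pow_succ']
      rw [hz]
      change C c • (X ^ n : ℂ[X]) • w = _
      rw [smul_smul, C_mul_X_pow_eq_monomial]
  RingQuot.liftAlgHom ℂ ⟨FreeAlgebra.lift ℂ gens, by
    intro x y h
    apply LinearMap.ext
    intro w
    cases h with
    | xp_comm p =>
      rw [map_mul, map_mul, Module.End.mul_apply, Module.End.mul_apply, hp, hp,
        FreeAlgebra.lift_ι_apply]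
      exact a.xp_smul p w
    | xm_comm p =>
      rw [map_mul, map_mul, Module.End.mul_apply, Module.End.mul_apply, hp, hp,
        FreeAlgebra.lift_ι_apply]
      exact a.xm_smul p w
    | xp_xm =>
      rw [map_mul, Module.End.mul_apply, hp, FreeAlgebra.lift_ι_apply, FreeAlgebra.lift_ι_apply]
      exact a.xp_xm w
    | xm_xp =>
      rw [map_mul, Module.End.mul_apply, hp, FreeAlgebra.lift_ι_apply, FreeAlgebra.lift_ι_apply]
      exact a.xm_xp w⟩

/-- The `A(t)`-module given by such operators. -/
abbrev toModule (a : GWAAction t V) : Module (GWA t) V :=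
  letI := complexModule V
  Module.compHom V a.toEnd.toRingHom

/-- The bundled `A(t)`-module given by such operators. -/
def toModuleCat (a : GWAAction t V) : ModuleCat.{u} (GWA t) :=
  letI := a.toModule
  ModuleCat.of (GWA t) V

end GWAAction

/-- Every `A(t)`-module is a `ℂ[z]`-module along `ℂ[z] → A(t)`. -/
instance polyModule {t : ℂ[X]} (M : ModuleCat.{u} (GWA t)) : Module ℂ[X] M :=
  Module.compHom M (GWA.poly t).toRingHom

theorem poly_smul_def {t : ℂ[X]} (M : ModuleCat.{u} (GWA t)) (p : ℂ[X]) (w : M) :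
    p • w = GWA.poly t p • w := rfl

theorem xp_smul_smul {t : ℂ[X]} (M : ModuleCat.{u} (GWA t)) (p : ℂ[X]) (w : M) :
    GWA.xp t • (p • w) = shift 1 p • (GWA.xp t • w) := by
  rw [poly_smul_def, poly_smul_def, smul_smul, smul_smul, GWA.xp_mul_poly]

theorem xm_smul_smul {t : ℂ[X]} (M : ModuleCat.{u} (GWA t)) (p : ℂ[X]) (w : M) :
    GWA.xm t • (p • w) = shift (-1) p • (GWA.xm t • w) := by
  rw [poly_smul_def, poly_smul_def, smul_smul, smul_smul, GWA.xm_mul_poly]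

theorem xp_smul_xm {t : ℂ[X]} (M : ModuleCat.{u} (GWA t)) (w : M) :
    GWA.xp t • (GWA.xm t • w) = shift (1 / 2) t • w := by
  rw [poly_smul_def, smul_smul, GWA.xp_mul_xm]

theorem xm_smul_xp {t : ℂ[X]} (M : ModuleCat.{u} (GWA t)) (w : M) :
    GWA.xm t • (GWA.xp t • w) = shift (-1 / 2) t • w := by
  rw [poly_smul_def, smul_smul, GWA.xm_mul_xp]

/-! ### Weight modules -/

/-- The weight space `M_{(z-c)} = {w | (z - c) w = 0}`. -/
def weightSpace {t : ℂ[X]} (M : ModuleCat.{u} (GWA t)) (c : ℂ) : Submodule ℂ[X] M :=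
  Submodule.torsionBy ℂ[X] M (X - C c)

/-- The support, the maximal ideal `(z - c)` being identified with `c`. -/
def support {t : ℂ[X]} (M : ModuleCat.{u} (GWA t)) : Set ℂ := {c | weightSpace M c ≠ ⊥}

open Classical in
/-- `M` is an object of `A(t)-wmod_𝒪`, where `𝒪 = {(z - n) | n ∈ ℤ}`: it is the direct sum of its
weight spaces, these are finite-dimensional, and the support is contained in `ℤ`.  (As `ℂ[z]` acts
on a weight space through `ℂ[z]/(z - c) = ℂ`, finiteness over `ℂ[z]` is finite dimension.) -/
structure IsWeightModule {t : ℂ[X]} (M : ModuleCat.{u} (GWA t)) : Prop where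
  isInternal : DirectSum.IsInternal (weightSpace M)
  finite : ∀ c : ℂ, Module.Finite ℂ[X] (weightSpace M c)
  integral : support M ⊆ Set.range (fun n : ℤ => (n : ℂ))

/-! ### Directed subsets of `ℝ` -/

/-- The four possible values of a directed subset at a point: not a member, an undirected member,
a right-directed member, a left-directed member. -/
inductive Membership
  | zero
  | one
  | right
  | left

/-- A directed subset of `ℝ`. -/
abbrev DirectedSubset : Type := ℝ → Membership

namespace DirectedSubset

/-- The underlying set of a directed subset. -/
def underlying (S : DirectedSubset) : Set ℝ := {x | S x ≠ Membership.zero}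

/-- `x` is a directed element of `S`. -/
def IsDirectedAt (S : DirectedSubset) (x : ℝ) : Prop :=
  S x = Membership.right ∨ S x = Membership.left

/-- A directed subset is connected if its underlying set is (nonempty and) connected. -/
def Connected (S : DirectedSubset) : Prop := IsConnected S.underlying

open Classical in
/-- A subset of `ℝ` as a directed subset without directed elements. -/
def ofSet (A : Set ℝ) : DirectedSubset :=
  fun x => if x ∈ A then Membership.one else Membership.zero

open Classical in
/-- `ℝ_k^+`: all of `ℝ`, with `k` right-directed and all other elements undirected. -/
def linePlus (k : ℝ) : DirectedSubset :=
  fun x => if x = k then Membership.right else Membership.one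

open Classical in
/-- `ℝ_k^-`: all of `ℝ`, with `k` left-directed and all other elements undirected. -/
def lineMinus (k : ℝ) : DirectedSubset :=
  fun x => if x = k then Membership.left else Membership.one

end DirectedSubset

/-- `x` is a half-integer, i.e. an element of `ℤ + 1/2`. -/
def IsHalfInt (x : ℝ) : Prop := ∃ n : ℤ, x = n + 1 / 2

/-- `S` is `t`-admissible, for a monic polynomial `t` with zeros in `ℤ + 1/2`: the underlying set
is an intersection of intervals `(k, ∞)` and `(-∞, k)` with `k` a zero of `t`, and the directed
elements are exactly the zeros of `t` in the underlying set. -/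
structure IsAdmissible (t : ℂ[X]) (S : DirectedSubset) : Prop where
  monic : t.Monic
  halfInt : ∀ c : ℂ, t.IsRoot c → ∃ k : ℝ, IsHalfInt k ∧ c = k
  interval : ∃ A B : Set ℝ, (∀ k ∈ A, t.IsRoot (k : ℂ)) ∧ (∀ k ∈ B, t.IsRoot (k : ℂ)) ∧
    S.underlying = (⋂ k ∈ A, Set.Ioi k) ∩ ⋂ k ∈ B, Set.Iio k
  directed : ∀ x : ℝ, S.IsDirectedAt x ↔ x ∈ S.underlying ∧ t.IsRoot (x : ℂ)

/-! ### The modules `M_S^t` -/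

section ModuleOf

variable (t : ℂ[X]) (S : DirectedSubset)

/-- The integers in `S`. -/
abbrev Weights : Type := {n : ℤ // (n : ℝ) ∈ S.underlying}

/-- The vector space with basis `v_n`, `n ∈ S ∩ ℤ`. -/
def WeightSum : Type := Weights S →₀ ℂ

instance : AddCommGroup (WeightSum S) := inferInstanceAs (AddCommGroup (Weights S →₀ ℂ))

instance : Module ℂ (WeightSum S) := inferInstanceAs (Module ℂ (Weights S →₀ ℂ))

/-- The basis vector `v_n`. -/
def basisVec (n : Weights S) : WeightSum S := Finsupp.single n (1 : ℂ)

open Classical in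
/-- `v_n` if `n ∈ S`, and `0` otherwise. -/
def vec (n : ℤ) : WeightSum S :=
  if h : (n : ℝ) ∈ S.underlying then basisVec S ⟨n, h⟩ else 0

/-- The linear map with prescribed values on the basis. -/
def extend (f : Weights S → WeightSum S) : WeightSum S →ₗ[ℂ] WeightSum S :=
  Finsupp.lsum ℂ (fun n => LinearMap.toSpanSingleton ℂ (WeightSum S) (f n))

theorem extend_basisVec (f : Weights S → WeightSum S) (n : Weights S) :
    extend S f (basisVec S n) = f n := by
  have h := Finsupp.lsum_single ℂ
    (fun n => LinearMap.toSpanSingleton ℂ (WeightSum S) (f n)) n (1 : ℂ)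
  exact h.trans (one_smul ℂ (f n))

variable {S} in
theorem hom_ext {f g : WeightSum S →ₗ[ℂ] WeightSum S}
    (h : ∀ n, f (basisVec S n) = g (basisVec S n)) : f = g := by
  apply Finsupp.lhom_ext'
  intro n
  apply LinearMap.ext_ring
  exact h n

/-- The polynomial `p(z)` acts on `v_n` by the scalar `p(n)`. -/
instance weightSumPoly : Module ℂ[X] (WeightSum S) :=
  Module.compHom (WeightSum S)
    (aeval (R := ℂ) (extend S fun n => ((n : ℤ) : ℂ) • basisVec S n)).toRingHom

theorem poly_smul_basisVec (p : ℂ[X]) (n : Weights S) :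
    p • basisVec S n = p.eval ((n : ℤ) : ℂ) • basisVec S n := by
  change (aeval (R := ℂ) (extend S fun n => ((n : ℤ) : ℂ) • basisVec S n)) p (basisVec S n) = _
  induction p using Polynomial.induction_on' with
  | add p q hp hq => rw [map_add, LinearMap.add_apply, hp, hq, eval_add, add_smul]
  | monomial k c =>
    rw [aeval_monomial, eval_monomial, Module.End.mul_apply]
    have : ∀ k : ℕ, ((extend S fun n => ((n : ℤ) : ℂ) • basisVec S n) ^ k) (basisVec S n)
        = (((n : ℤ) : ℂ) ^ k) • basisVec S n := by
      intro k
      induction k with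
      | zero => simp
      | succ k ih =>
        rw [pow_succ', Module.End.mul_apply, ih, map_smul, extend_basisVec, smul_smul, pow_succ]
    rw [this, Module.algebraMap_end_apply, smul_smul]

theorem poly_smul_eq (p : ℂ[X]) (w : WeightSum S) :
    p • w = (aeval (R := ℂ) (extend S fun n => ((n : ℤ) : ℂ) • basisVec S n)) p w := rfl

/-- The coefficient of `X⁺ v_n` at `v_{n+1}`, according to the value of `S` at `n + 1/2`. -/
def upCoeff (n : ℤ) : ℂ :=
  match S ((n : ℝ) + 1 / 2) with
  | Membership.zero => 0
  | Membership.one => 1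
  | Membership.right => 1
  | Membership.left => 0

/-- The coefficient of `X⁻ v_{n+1}` at `v_n`, according to the value of `S` at `n + 1/2`. -/
def downCoeff (n : ℤ) : ℂ :=
  match S ((n : ℝ) + 1 / 2) with
  | Membership.zero => 0
  | Membership.one => t.eval ((n : ℂ) + 1 / 2)
  | Membership.right => 0
  | Membership.left => 1

/-- The operator `X⁺`. -/
def raise : WeightSum S →ₗ[ℂ] WeightSum S :=
  extend S fun n => upCoeff S n • vec S ((n : ℤ) + 1)

/-- The operator `X⁻`. -/
def lower : WeightSum S →ₗ[ℂ] WeightSum S :=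
  extend S fun n => downCoeff t S ((n : ℤ) - 1) • vec S ((n : ℤ) - 1)

variable {t S}

theorem IsHalfInt.eq_of_between {k : ℝ} (hk : IsHalfInt k) {n : ℤ} (h1 : (n : ℝ) ≤ k)
    (h2 : k ≤ (n : ℝ) + 1) : k = n + 1 / 2 := by
  obtain ⟨m, rfl⟩ := hk
  have h3 : m < n + 1 := by
    have : (m : ℝ) < (n + 1 : ℤ) := by push_cast; linarith
    exact_mod_cast this
  have h4 : n < m + 1 := by
    have : (n : ℝ) < (m + 1 : ℤ) := by push_cast; linarith
    exact_mod_cast this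
  have : m = n := by omega
  rw [this]

namespace IsAdmissible

theorem isHalfInt (hS : IsAdmissible t S) {k : ℝ} (hk : t.IsRoot (k : ℂ)) : IsHalfInt k := by
  obtain ⟨k', h, h'⟩ := hS.halfInt _ hk
  have : k = k' := by exact_mod_cast h'
  rwa [this]

theorem mem_mid (hS : IsAdmissible t S) {n : ℤ} (h1 : (n : ℝ) ∈ S.underlying)
    (h2 : ((n + 1 : ℤ) : ℝ) ∈ S.underlying) : (n : ℝ) + 1 / 2 ∈ S.underlying := by
  obtain ⟨A, B, -, -, h⟩ := hS.interval
  rw [h] at h1 h2 ⊢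
  simp only [Set.mem_inter_iff, Set.mem_iInter, Set.mem_Ioi, Set.mem_Iio] at h1 h2 ⊢
  push_cast at h2
  exact ⟨fun k hk => by linarith [h1.1 k hk], fun k hk => by linarith [h2.2 k hk]⟩

theorem root_of_boundary (hS : IsAdmissible t S) {n : ℤ}
    (h : ¬ ((n : ℝ) ∈ S.underlying ↔ ((n + 1 : ℤ) : ℝ) ∈ S.underlying)) :
    t.eval ((n : ℂ) + 1 / 2) = 0 := by
  have key : ∀ k : ℝ, t.IsRoot (k : ℂ) → (n : ℝ) ≤ k → k ≤ (n : ℝ) + 1 →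
      t.eval ((n : ℂ) + 1 / 2) = 0 := by
    intro k hk h1 h2
    have h3 := (hS.isHalfInt hk).eq_of_between h1 h2
    rw [h3] at hk
    have h4 : t.eval (((n : ℝ) + 1 / 2 : ℝ) : ℂ) = 0 := hk
    push_cast at h4
    exact h4
  obtain ⟨A, B, hA, hB, hu⟩ := hS.interval
  by_contra hne
  apply h
  rw [hu]
  simp only [Set.mem_inter_iff, Set.mem_iInter, Set.mem_Ioi, Set.mem_Iio]
  push_cast
  constructor
  · rintro ⟨h1, h2⟩
    refine ⟨fun k hk => by linarith [h1 k hk], fun k hk => ?_⟩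
    by_contra hc
    exact hne (key k (hB k hk) (h2 k hk).le (not_lt.mp hc))
  · rintro ⟨h1, h2⟩
    refine ⟨fun k hk => ?_, fun k hk => by linarith [h2 k hk]⟩
    by_contra hc
    exact hne (key k (hA k hk) (not_lt.mp hc) (h1 k hk).le)

theorem coeff_mul (hS : IsAdmissible t S) {n : ℤ} (h1 : (n : ℝ) ∈ S.underlying)
    (h2 : ((n + 1 : ℤ) : ℝ) ∈ S.underlying) :
    downCoeff t S n * upCoeff S n = t.eval ((n : ℂ) + 1 / 2) := by
  have hm := hS.mem_mid h1 h2
  have hd := hS.directed ((n : ℝ) + 1 / 2)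
  have hr : t.IsRoot (((n : ℝ) + 1 / 2 : ℝ) : ℂ) ↔ t.eval ((n : ℂ) + 1 / 2) = 0 := by
    rw [IsRoot.def]; push_cast; rfl
  rw [hr] at hd
  unfold downCoeff upCoeff
  unfold DirectedSubset.IsDirectedAt at hd
  unfold DirectedSubset.underlying at hm hd
  simp only [Set.mem_ofPred_eq] at hm hd
  generalize S ((n : ℝ) + 1 / 2) = s at *
  cases s <;> simp_all

end IsAdmissible

theorem vec_of_mem {n : ℤ} (h : (n : ℝ) ∈ S.underlying) : vec S n = basisVec S ⟨n, h⟩ := by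
  simp [vec, h]

theorem vec_of_notMem {n : ℤ} (h : (n : ℝ) ∉ S.underlying) : vec S n = 0 := by
  simp [vec, h]

theorem poly_smul_vec (p : ℂ[X]) (n : ℤ) : p • vec S n = p.eval (n : ℂ) • vec S n := by
  by_cases h : (n : ℝ) ∈ S.underlying
  · rw [vec_of_mem h, poly_smul_basisVec]
  · rw [vec_of_notMem h, smul_zero, smul_zero]

theorem raise_vec {n : ℤ} (h : (n : ℝ) ∈ S.underlying) :
    raise S (vec S n) = upCoeff S n • vec S (n + 1) := by
  rw [vec_of_mem h, raise, extend_basisVec]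

theorem lower_vec {n : ℤ} (h : (n : ℝ) ∈ S.underlying) :
    lower t S (vec S n) = downCoeff t S (n - 1) • vec S (n - 1) := by
  rw [vec_of_mem h, lower, extend_basisVec]

theorem eval_shift (a c : ℂ) (p : ℂ[X]) : (shift a p).eval c = p.eval (c - a) := by
  rw [shift, ← comp_eq_aeval, eval_comp]
  simp

/-- Two `ℂ`-linear maps agree if they agree on all the `v_n`. -/
theorem hom_ext_vec {f g : WeightSum S →ₗ[ℂ] WeightSum S}
    (h : ∀ n : ℤ, (n : ℝ) ∈ S.underlying → f (vec S n) = g (vec S n)) : f = g := by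
  apply hom_ext
  rintro ⟨n, hn⟩
  rw [← vec_of_mem hn]
  exact h n hn

/-- The action of `p(z)` as a `ℂ`-linear map. -/
def polyEnd (S : DirectedSubset) (p : ℂ[X]) : WeightSum S →ₗ[ℂ] WeightSum S :=
  aeval (R := ℂ) (extend S fun n => ((n : ℤ) : ℂ) • basisVec S n) p

theorem polyEnd_vec (p : ℂ[X]) (n : ℤ) : polyEnd S p (vec S n) = p.eval (n : ℂ) • vec S n :=
  poly_smul_vec p n

/-- The operators `X^±` on the space with basis `v_n`, `n ∈ S ∩ ℤ`. -/
def moduleAction (hS : IsAdmissible t S) : GWAAction t (WeightSum S) where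
  xp := (raise S).toAddMonoidHom
  xm := (lower t S).toAddMonoidHom
  xp_smul := by
    intro p w
    have : raise S ∘ₗ polyEnd S p = polyEnd S (shift 1 p) ∘ₗ raise S := by
      apply hom_ext_vec
      intro n hn
      rw [LinearMap.comp_apply, LinearMap.comp_apply, polyEnd_vec, map_smul, raise_vec hn,
        map_smul, polyEnd_vec, eval_shift, smul_comm]
      push_cast
      rw [add_sub_cancel_right]
    exact LinearMap.congr_fun this w
  xm_smul := by
    intro p w
    have : lower t S ∘ₗ polyEnd S p = polyEnd S (shift (-1) p) ∘ₗ lower t S := by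
      apply hom_ext_vec
      intro n hn
      rw [LinearMap.comp_apply, LinearMap.comp_apply, polyEnd_vec, map_smul, lower_vec hn,
        map_smul, polyEnd_vec, eval_shift, smul_comm]
      push_cast
      rw [sub_neg_eq_add, sub_add_cancel]
    exact LinearMap.congr_fun this w
  xp_xm := by
    intro w
    have : raise S ∘ₗ lower t S = polyEnd S (shift (1 / 2) t) := by
      apply hom_ext_vec
      intro n hn
      rw [LinearMap.comp_apply, polyEnd_vec, lower_vec hn, map_smul, eval_shift]
      have he : (n : ℂ) - 1 / 2 = ((n - 1 : ℤ) : ℂ) + 1 / 2 := by push_cast; ring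
      rw [he]
      by_cases h : ((n - 1 : ℤ) : ℝ) ∈ S.underlying
      · have hn' : ((n - 1 + 1 : ℤ) : ℝ) ∈ S.underlying := by rwa [sub_add_cancel]
        rw [raise_vec h, smul_smul, hS.coeff_mul h hn', sub_add_cancel]
      · rw [vec_of_notMem h, map_zero, smul_zero, hS.root_of_boundary, zero_smul]
        rw [sub_add_cancel]
        tauto
    exact LinearMap.congr_fun this w
  xm_xp := by
    intro w
    have : lower t S ∘ₗ raise S = polyEnd S (shift (-1 / 2) t) := by
      apply hom_ext_vec
      intro n hn
      rw [LinearMap.comp_apply, polyEnd_vec, raise_vec hn, map_smul, eval_shift]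
      have he : (n : ℂ) - -1 / 2 = (n : ℂ) + 1 / 2 := by ring
      rw [he]
      by_cases h : ((n + 1 : ℤ) : ℝ) ∈ S.underlying
      · rw [lower_vec h, smul_smul, add_sub_cancel_right, mul_comm, hS.coeff_mul hn h]
      · rw [vec_of_notMem h, map_zero, smul_zero, hS.root_of_boundary, zero_smul]
        tauto
    exact LinearMap.congr_fun this w

end ModuleOf

/-- The module `M_S^t`: it has basis `v_n`, `n ∈ S ∩ ℤ`, with `p(z) v_n = p(n) v_n`,
`X⁺ v_n = upCoeff S n • v_{n+1}` and `X⁻ v_{n+1} = downCoeff t S n • v_n` (where `v_n = 0` for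
`n ∉ S`). -/
def moduleOf {t : ℂ[X]} {S : DirectedSubset} (hS : IsAdmissible t S) : ModuleCat.{0} (GWA t) :=
  (moduleAction hS).toModuleCat

/-! ### The admissible sets used for the linear factors -/

section Linear

open DirectedSubset

variable {k : ℝ}

theorem isRoot_linear (c : ℂ) : (X - C (k : ℂ) : ℂ[X]).IsRoot c ↔ c = k := by
  rw [root_X_sub_C, eq_comm]

theorem underlying_ofSet (A : Set ℝ) : (ofSet A).underlying = A := by
  ext x
  simp [underlying, ofSet]

theorem not_isDirectedAt_ofSet (A : Set ℝ) (x : ℝ) : ¬ (ofSet A).IsDirectedAt x := by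
  unfold IsDirectedAt ofSet
  split_ifs <;> simp

theorem underlying_linePlus : (linePlus k).underlying = Set.univ := by
  ext x
  simp only [underlying, linePlus, Set.mem_ofPred_eq, Set.mem_univ, iff_true]
  split_ifs <;> simp

theorem underlying_lineMinus : (lineMinus k).underlying = Set.univ := by
  ext x
  simp only [underlying, lineMinus, Set.mem_ofPred_eq, Set.mem_univ, iff_true]
  split_ifs <;> simp

theorem admissible_Ioi (hk : IsHalfInt k) : IsAdmissible (X - C (k : ℂ)) (ofSet (Set.Ioi k)) where
  monic := monic_X_sub_C _
  halfInt := fun c hc => ⟨k, hk, (isRoot_linear c).1 hc⟩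
  interval := ⟨{k}, ∅, by simp, by simp, by simp [underlying_ofSet]⟩
  directed := fun x => by
    rw [underlying_ofSet, isRoot_linear]
    refine ⟨fun h => absurd h (not_isDirectedAt_ofSet _ _), fun ⟨h, h'⟩ => ?_⟩
    rw [Complex.ofReal_inj] at h'
    exact absurd h'.symm (ne_of_lt h)

theorem admissible_Iio (hk : IsHalfInt k) : IsAdmissible (X - C (k : ℂ)) (ofSet (Set.Iio k)) where
  monic := monic_X_sub_C _
  halfInt := fun c hc => ⟨k, hk, (isRoot_linear c).1 hc⟩
  interval := ⟨∅, {k}, by simp, by simp, by simp [underlying_ofSet]⟩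
  directed := fun x => by
    rw [underlying_ofSet, isRoot_linear]
    refine ⟨fun h => absurd h (not_isDirectedAt_ofSet _ _), fun ⟨h, h'⟩ => ?_⟩
    rw [Complex.ofReal_inj] at h'
    exact absurd h' (ne_of_lt h)

theorem admissible_linePlus (hk : IsHalfInt k) : IsAdmissible (X - C (k : ℂ)) (linePlus k) where
  monic := monic_X_sub_C _
  halfInt := fun c hc => ⟨k, hk, (isRoot_linear c).1 hc⟩
  interval := ⟨∅, ∅, by simp, by simp, by simp [underlying_linePlus]⟩
  directed := fun x => by
    rw [underlying_linePlus, isRoot_linear, Complex.ofReal_inj]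
    unfold IsDirectedAt linePlus
    split_ifs <;> simp_all

theorem admissible_lineMinus (hk : IsHalfInt k) : IsAdmissible (X - C (k : ℂ)) (lineMinus k) where
  monic := monic_X_sub_C _
  halfInt := fun c hc => ⟨k, hk, (isRoot_linear c).1 hc⟩
  interval := ⟨∅, ∅, by simp, by simp, by simp [underlying_lineMinus]⟩
  directed := fun x => by
    rw [underlying_lineMinus, isRoot_linear, Complex.ofReal_inj]
    unfold IsDirectedAt lineMinus
    split_ifs <;> simp_all

theorem admissible_one : IsAdmissible 1 (ofSet Set.univ) where
  monic := monic_one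
  halfInt := fun c hc => by simp [IsRoot.def] at hc
  interval := ⟨∅, ∅, by simp, by simp, by simp [underlying_ofSet]⟩
  directed := fun x => by
    refine ⟨fun h => absurd h (not_isDirectedAt_ofSet _ _), fun h => ?_⟩
    simp [IsRoot.def] at h

end Linear

/-- The simple module `M_{(k,∞)}^{z-k}`. -/
def modIoi {k : ℝ} (hk : IsHalfInt k) : ModuleCat.{0} (GWA (X - C (k : ℂ))) :=
  moduleOf (admissible_Ioi hk)

/-- The simple module `M_{(-∞,k)}^{z-k}`. -/
def modIio {k : ℝ} (hk : IsHalfInt k) : ModuleCat.{0} (GWA (X - C (k : ℂ))) :=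
  moduleOf (admissible_Iio hk)

/-- The module `M_{ℝ_k^+}^{z-k}`. -/
def modPlus {k : ℝ} (hk : IsHalfInt k) : ModuleCat.{0} (GWA (X - C (k : ℂ))) :=
  moduleOf (admissible_linePlus hk)

/-- The module `M_{ℝ_k^-}^{z-k}`. -/
def modMinus {k : ℝ} (hk : IsHalfInt k) : ModuleCat.{0} (GWA (X - C (k : ℂ))) :=
  moduleOf (admissible_lineMinus hk)

/-! ### Tensor products -/

/-- The operators `X^± ⊗ X^±` on `M ⊗_{ℂ[z]} N`, where `M` is an `A(s)`-module and `N` an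
`A(t)`-module. -/
def tensorAction {s t : ℂ[X]} (M : ModuleCat.{u} (GWA s)) (N : ModuleCat.{u} (GWA t)) :
    GWAAction (s * t) (M ⊗[ℂ[X]] N) :=
  let diag (f : M →+ M) (g : N →+ N) (a : ℂ) (hf : ∀ (p : ℂ[X]) w, f (p • w) = shift a p • f w)
      (hg : ∀ (p : ℂ[X]) w, g (p • w) = shift a p • g w) : M ⊗[ℂ[X]] N →+ M ⊗[ℂ[X]] N :=
    TensorProduct.liftAddHom
      (AddMonoidHom.mk' (fun m => AddMonoidHom.mk' (fun n => f m ⊗ₜ[ℂ[X]] g n)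
          (fun n n' => by rw [map_add, TensorProduct.tmul_add]))
        (fun m m' => by
          ext n
          simp [TensorProduct.add_tmul]))
      (fun r m n => by
        change f (r • m) ⊗ₜ[ℂ[X]] g n = f m ⊗ₜ[ℂ[X]] g (r • n)
        rw [hf, hg, TensorProduct.smul_tmul])
  { xp := diag (DistribSMul.toAddMonoidHom M (GWA.xp s)) (DistribSMul.toAddMonoidHom N (GWA.xp t))
      1 (xp_smul_smul M) (xp_smul_smul N)
    xm := diag (DistribSMul.toAddMonoidHom M (GWA.xm s)) (DistribSMul.toAddMonoidHom N (GWA.xm t))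
      (-1) (xm_smul_smul M) (xm_smul_smul N)
    xp_smul := by
      intro p w
      induction w with
      | zero => simp
      | add x y hx hy => rw [smul_add, map_add, hx, hy, map_add, smul_add]
      | tmul m n =>
        change (GWA.xp s • (p • m)) ⊗ₜ[ℂ[X]] (GWA.xp t • n) =
          shift 1 p • ((GWA.xp s • m) ⊗ₜ[ℂ[X]] (GWA.xp t • n))
        rw [xp_smul_smul, TensorProduct.smul_tmul']
    xm_smul := by
      intro p w
      induction w with
      | zero => simp
      | add x y hx hy => rw [smul_add, map_add, hx, hy, map_add, smul_add]
      | tmul m n =>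
        change (GWA.xm s • (p • m)) ⊗ₜ[ℂ[X]] (GWA.xm t • n) =
          shift (-1) p • ((GWA.xm s • m) ⊗ₜ[ℂ[X]] (GWA.xm t • n))
        rw [xm_smul_smul, TensorProduct.smul_tmul']
    xp_xm := by
      intro w
      induction w with
      | zero => simp
      | add x y hx hy => rw [smul_add, map_add, map_add, hx, hy]
      | tmul m n =>
        change (GWA.xp s • (GWA.xm s • m)) ⊗ₜ[ℂ[X]] (GWA.xp t • (GWA.xm t • n)) = _
        rw [xp_smul_xm, xp_smul_xm, TensorProduct.smul_tmul_smul, map_mul]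
    xm_xp := by
      intro w
      induction w with
      | zero => simp
      | add x y hx hy => rw [smul_add, map_add, map_add, hx, hy]
      | tmul m n =>
        change (GWA.xm s • (GWA.xp s • m)) ⊗ₜ[ℂ[X]] (GWA.xm t • (GWA.xp t • n)) = _
        rw [xm_smul_xp, xm_smul_xp, TensorProduct.smul_tmul_smul, map_mul] }

/-- The `A(s t)`-module `M ⊗_{ℂ[z]} N`, for an `A(s)`-module `M` and an `A(t)`-module `N`:
`r (m ⊗ n) = r m ⊗ n` and `X^± (m ⊗ n) = X^± m ⊗ X^± n`. -/
def tensor {s t : ℂ[X]} (M : ModuleCat.{u} (GWA s)) (N : ModuleCat.{u} (GWA t)) :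
    ModuleCat.{u} (GWA (s * t)) :=
  (tensorAction M N).toModuleCat

/-- A module over some `A(t)`, together with `t`. -/
structure SomeModule where
  param : ℂ[X]
  module : ModuleCat.{u} (GWA param)

/-- The pair `(t, M)`. -/
def withParam {t : ℂ[X]} (M : ModuleCat.{u} (GWA t)) : SomeModule.{u} := ⟨t, M⟩

/-- The `A(t)`-module `M` is isomorphic to `N`, which is required to be a module over the same
algebra `A(t)`. -/
def IsoTo {t : ℂ[X]} (M : ModuleCat.{u} (GWA t)) (N : SomeModule.{v}) : Prop :=
  ∃ (h : t = N.param) (f : M ≃+ N.module), ∀ (a : GWA t) (w : M), f (a • w) = (h ▸ a) • f w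

/-- The unit object `M^1` over `A(1)`, with weights `ℤ`, as the empty tensor product. -/
def unitModule : ModuleCat.{u} (GWA 1) := ModuleCat.of (GWA 1) (ULift.{u} (moduleOf admissible_one))

/-- The tensor product `M₁ ⊗ (M₂ ⊗ (⋯ ⊗ M_n))` over `ℂ[z]`. -/
def tensorList : List SomeModule.{u} → SomeModule.{u}
  | [] => withParam unitModule
  | [M] => M
  | M :: N :: L => withParam (tensor M.module (tensorList (N :: L)).module)

/-- The tensor power `M^{⊗ m}`. -/
def tensorPower (M : SomeModule.{u}) (m : ℕ) : SomeModule.{u} := tensorList (List.replicate m M)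

/-- `M₁^{⊗ m₁} ⊗ ⋯ ⊗ M_r^{⊗ m_r}`. -/
def tensorPowers {r : ℕ} {t : Fin r → ℂ[X]} (M : (a : Fin r) → ModuleCat.{u} (GWA (t a)))
    (m : Fin r → ℕ) : SomeModule.{u} :=
  tensorList (List.ofFn fun a => tensorPower (withParam (M a)) (m a))

/-! ### The tensor factors -/

/-- The extended list of roots `k_0 = -∞, k_1, …, k_r, k_{r+1} = ∞`; the root `k_a` of the text is
`k a` with `a : Fin r` shifted by one. -/
def extRoot {r : ℕ} (k : Fin r → ℝ) (a : ℕ) : EReal :=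
  if a = 0 then ⊥ else if h : a - 1 < r then ((k ⟨a - 1, h⟩ : ℝ) : EReal) else ⊤

open Classical in
/-- The factor `M_a` attached to the root `k_a` and to `S` with underlying set `(k_i, k_j)`. -/
def factor {r : ℕ} {k : Fin r → ℝ} (hk : ∀ a, IsHalfInt (k a)) (S : DirectedSubset) (i j : ℕ)
    (a : Fin r) : ModuleCat.{0} (GWA (X - C (k a : ℂ))) :=
  if (a : ℕ) + 1 ≤ i then modIoi (hk a)
  else if j ≤ (a : ℕ) + 1 then modIio (hk a)
  else if S (k a) = Membership.right then modPlus (hk a)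
  else modMinus (hk a)

/-! ### Modules over `sl₂` -/

/-- The Lie algebra `sl₂(ℂ)`. -/
abbrev sl2 : Type := LieAlgebra.SpecialLinear.sl (Fin 2) ℂ

/-- The enveloping algebra `U(sl₂)`. -/
abbrev Usl2 : Type := UniversalEnvelopingAlgebra ℂ sl2

/-- The matrix `e`. -/
def sl2e : sl2 := ⟨!![0, 1; 0, 0], by simp [LieAlgebra.SpecialLinear.sl, Matrix.trace_fin_two]⟩

/-- The matrix `f`. -/
def sl2f : sl2 := ⟨!![0, 0; 1, 0], by simp [LieAlgebra.SpecialLinear.sl, Matrix.trace_fin_two]⟩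

/-- The matrix `h`. -/
def sl2h : sl2 := ⟨!![1, 0; 0, -1], by simp [LieAlgebra.SpecialLinear.sl, Matrix.trace_fin_two]⟩

/-- The Verma module of highest weight `c`: the quotient of `U(sl₂)` by the left ideal generated by
`e` and `h - c`. -/
abbrev Verma (c : ℂ) : Type :=
  Usl2 ⧸ Submodule.span Usl2
    ({UniversalEnvelopingAlgebra.ι ℂ sl2e,
      UniversalEnvelopingAlgebra.ι ℂ sl2h - algebraMap ℂ Usl2 c} : Set Usl2)

section Sl2Map

open GWA

attribute [local instance] LieRing.ofAssociativeRing

variable (k l : ℂ)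

/-- The polynomial `(z - k)(z - l)`. -/
abbrev quad : ℂ[X] := (X - C k) * (X - C l)

/-- The image `2 z - (k + l)` of `h`. -/
def hImage : GWA (quad k l) := poly (quad k l) (C 2 * X - C (k + l))

theorem bracket_xp_xm :
    xp (quad k l) * xm (quad k l) - xm (quad k l) * xp (quad k l) = - hImage k l := by
  rw [xp_mul_xm, xm_mul_xp, hImage, ← map_sub, ← map_neg]
  congr 1
  apply Polynomial.funext
  intro c
  simp [eval_shift, quad]
  ring

theorem bracket_h_xp :
    hImage k l * xp (quad k l) - xp (quad k l) * hImage k l = (2 : ℂ) • xp (quad k l) := by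
  rw [hImage, xp_mul_poly, ← sub_mul, ← map_sub]
  have : C 2 * X - C (k + l) - shift 1 (C 2 * X - C (k + l)) = C (2 : ℂ) := by
    apply Polynomial.funext
    intro c
    simp [eval_shift]
    ring
  rw [this, Algebra.smul_def]
  congr 1
  simp [poly]

theorem bracket_h_xm :
    hImage k l * xm (quad k l) - xm (quad k l) * hImage k l = (-2 : ℂ) • xm (quad k l) := by
  rw [hImage, xm_mul_poly, ← sub_mul, ← map_sub]
  have : C 2 * X - C (k + l) - shift (-1) (C 2 * X - C (k + l)) = C (-2 : ℂ) := by
    apply Polynomial.funext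
    intro c
    simp [eval_shift]
    ring
  rw [this, Algebra.smul_def]
  congr 1
  simp [poly]

/-- The Lie algebra homomorphism `sl₂ → A((z-k)(z-l))` given by `e ↦ √-1 X⁺`, `f ↦ √-1 X⁻`,
`h ↦ 2 z - (k + l)`. -/
def sl2ToGWA : sl2 →ₗ⁅ℂ⁆ GWA (quad k l) where
  toFun A := (A.1 0 1 * Complex.I) • xp (quad k l) + (A.1 1 0 * Complex.I) • xm (quad k l)
    + A.1 0 0 • hImage k l
  map_add' A B := by
    have h : ∀ i j, (A + B).1 i j = A.1 i j + B.1 i j := fun i j => rfl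
    simp only [h, add_mul, add_smul]
    abel
  map_smul' c A := by
    have h : ∀ i j, (c • A).1 i j = c * A.1 i j := fun i j => rfl
    simp only [h, RingHom.id_apply, smul_add, smul_smul, mul_assoc]
  map_lie' := by
    intro A B
    have hA : A.1 1 1 = - A.1 0 0 := by
      have h := A.2
      have h' : Matrix.trace A.1 = 0 := h
      rw [Matrix.trace_fin_two] at h'
      linear_combination h'
    have hB : B.1 1 1 = - B.1 0 0 := by
      have h := B.2
      have h' : Matrix.trace B.1 = 0 := h
      rw [Matrix.trace_fin_two] at h'
      linear_combination h'
    have h1 := bracket_xp_xm k l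
    have h2 := bracket_h_xp k l
    have h3 := bracket_h_xm k l
    simp only [LieAlgebra.SpecialLinear.sl_bracket, Matrix.sub_apply, Matrix.mul_apply,
      Fin.sum_univ_two, hA, hB, Ring.lie_def]
    generalize xp (quad k l) = p at *
    generalize xm (quad k l) = q at *
    generalize hImage k l = h at *
    generalize A.1 0 0 = a at *
    generalize A.1 0 1 = b at *
    generalize A.1 1 0 = c at *
    generalize B.1 0 0 = a' at *
    generalize B.1 0 1 = b' at *
    generalize B.1 1 0 = c' at *
    have e1 : p * q = q * p - h := by rw [← sub_eq_zero, ← sub_eq_zero.2 h1]; abel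
    have e2 : h * p = p * h + (2 : ℂ) • p := by rw [← sub_eq_zero, ← sub_eq_zero.2 h2]; abel
    have e3 : h * q = q * h + (-2 : ℂ) • q := by rw [← sub_eq_zero, ← sub_eq_zero.2 h3]; abel
    simp only [add_mul, mul_add, smul_mul_assoc, mul_smul_comm, e1, e2, e3]
    match_scalars <;> ring_nf <;> simp <;> ring

/-- The algebra homomorphism `U(sl₂) → A((z-k)(z-l))`. -/
def envToGWA : Usl2 →ₐ[ℂ] GWA (quad k l) := UniversalEnvelopingAlgebra.lift ℂ (sl2ToGWA k l)

end Sl2Map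

/-- The `sl₂`-module structure on an `A((z-k)(z-l))`-module. -/
def toSl2 {k l : ℂ} (M : ModuleCat.{u} (GWA (quad k l))) : ModuleCat.{u} Usl2 :=
  (ModuleCat.restrictScalars (envToGWA k l).toRingHom).obj M

end RankOne

end

noncomputable section

namespace RankOne

/-! A weight module is a chain of spaces `W n` with maps `X⁺ : W n → W (n + 1)` and `X⁻` back, both
composites being the scalar `t(n + 1/2)`. Away from the finitely many roots of `t` the two maps are
inverse to each other up to a nonzero scalar; at a root both composites vanish. The classification
says that an indecomposable chain is a string: at most one vector per weight, and exactly one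
nonzero arrow across each root inside the support.

The proof splits a string off an arbitrary nonzero weight module, together with a dual string of
functionals. `exists_rightString` builds it to the right of a weight `n` for a pair of subspaces `A
< B` of `W n`, by downward induction on `n`: in `exists_rightString_step` the pair is pushed forward
along `X⁺` or pulled back along `X⁻` as long as it stays distinct, and the string stops if neither
works. `exists_string` completes it to the left. The map `w ↦ φ n w • x n` on weight `n` is then an
`A(t)`-linear idempotent, because the functionals obey the transposed relations with the same
coefficients. Indecomposability makes it the identity, so the string is a basis and the module is
some `M_S^t` (`exists_equiv_moduleOf`).

The tensor decompositions reduce to combinatorics through `Thin`, which records the set of weights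
and the sets where `X⁺` and `X⁻` are nonzero. These sets are isomorphism invariants (`Thin.eq`),
they are intersected by tensor products (`thin_tensor`), and they determine `S`
(`IsAdmissible.ext_of_weights`). Hence a thin module with the invariants of `S` is `M_S^t`
(`IsAdmissible.nonempty_equiv_of_thin`). In the product, the factor at `k_i` cuts the support below,
the one at `k_j` cuts it above, those in between supply the directions, and those outside act only
where nothing is left. Positive multiplicities do not matter, as intersection is idempotent.
Conversely a linear polynomial has only four connected admissible sets
(`IsAdmissible.linear_cases`), and comparing invariants identifies every factor from `k_i` to `k_j`
(`factor_unique`).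

The isomorphism with the Weyl algebra comes from the universal properties of both sides. For `sl₂`,
a thin module with top weight `K` has the highest weight vector `x K`, and the vectors `f^j x K` run
through its weight vectors as long as `X⁻` is nonzero. A Verma module is recognised by these vectors
being a basis (`IsHighest.nonempty_verma_equiv`), a finite-dimensional simple module by its highest
weight and its length (`IsHighest.nonempty_equiv`). For nonintegral highest weight the second factor
is a module on all of `ℤ` with both arrows bijective everywhere (`fullAction`). -/

/-! ### Linear maps and operators over `A(t)` -/

theorem gwa_induction {t : ℂ[X]} {P : GWA t → Prop} (hC : ∀ c : ℂ, P (algebraMap ℂ _ c))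
    (hz : P (GWA.z t)) (hp : P (GWA.xp t)) (hm : P (GWA.xm t))
    (hmul : ∀ a b, P a → P b → P (a * b)) (hadd : ∀ a b, P a → P b → P (a + b)) (a : GWA t) :
    P a := by
  obtain ⟨a, rfl⟩ := RingQuot.mkAlgHom_surjective ℂ (GWARel t) a
  induction a using FreeAlgebra.induction with
  | grade0 c => simpa using hC c
  | grade1 g =>
    cases g
    · exact hz
    · exact hp
    · exact hm
  | mul a b ha hb => rw [map_mul]; exact hmul _ _ ha hb
  | add a b ha hb => rw [map_add]; exact hadd _ _ ha hb

/-- An additive map commuting with `ℂ[z]` and `X^±` is `A(t)`-linear. -/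
theorem map_gwa_smul {t : ℂ[X]} {M : ModuleCat.{u} (GWA t)} {N : ModuleCat.{v} (GWA t)}
    (f : M →+ N) (hpoly : ∀ (p : ℂ[X]) w, f (p • w) = p • f w)
    (hp : ∀ w, f (GWA.xp t • w) = GWA.xp t • f w) (hm : ∀ w, f (GWA.xm t • w) = GWA.xm t • f w)
    (a : GWA t) (w : M) : f (a • w) = a • f w := by
  induction a using gwa_induction generalizing w with
  | hC c =>
    have h := hpoly (C c) w
    rwa [poly_smul_def, poly_smul_def, GWA.poly, aeval_C] at h
  | hz =>
    have h := hpoly X w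
    rwa [poly_smul_def, poly_smul_def, GWA.poly, aeval_X] at h
  | hp => exact hp w
  | hm => exact hm w
  | hmul a b ha hb => rw [mul_smul, ha, hb, mul_smul]
  | hadd a b ha hb => rw [add_smul, map_add, ha, hb, add_smul]

/-- The linear map over `A(t)` given by an additive map commuting with `ℂ[z]` and `X^±`. -/
def gwaHom {t : ℂ[X]} {M : ModuleCat.{u} (GWA t)} {N : ModuleCat.{v} (GWA t)}
    (f : M →+ N) (hpoly : ∀ (p : ℂ[X]) w, f (p • w) = p • f w)
    (hp : ∀ w, f (GWA.xp t • w) = GWA.xp t • f w) (hm : ∀ w, f (GWA.xm t • w) = GWA.xm t • f w) :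
    M →ₗ[GWA t] N where
  toFun := f
  map_add' := map_add f
  map_smul' := map_gwa_smul f hpoly hp hm

theorem gwaLin_poly {t : ℂ[X]} {M : ModuleCat.{u} (GWA t)} {N : ModuleCat.{v} (GWA t)}
    (f : M →ₗ[GWA t] N) (p : ℂ[X]) (w : M) : f (p • w) = p • f w := by
  rw [poly_smul_def, poly_smul_def, map_smul]

namespace GWAAction

variable {t : ℂ[X]} {V : Type u} [AddCommGroup V] [Module ℂ[X] V] (a : GWAAction t V)

/-- The identity map from the underlying `ℂ[z]`-module to the bundled `A(t)`-module. -/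
def equiv : V ≃+ a.toModuleCat := AddEquiv.refl V

theorem xp_smul_equiv (w : V) : GWA.xp t • a.equiv w = a.equiv (a.xp w) := by
  change a.toEnd (GWA.xp t) w = _
  let := complexModule V
  unfold toEnd GWA.xp GWA.gen
  rw [RingQuot.liftAlgHom_mkAlgHom_apply, FreeAlgebra.lift_ι_apply]
  rfl

theorem xm_smul_equiv (w : V) : GWA.xm t • a.equiv w = a.equiv (a.xm w) := by
  change a.toEnd (GWA.xm t) w = _
  let := complexModule V
  unfold toEnd GWA.xm GWA.gen
  rw [RingQuot.liftAlgHom_mkAlgHom_apply, FreeAlgebra.lift_ι_apply]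
  rfl

theorem z_smul_equiv (w : V) : GWA.z t • a.equiv w = a.equiv ((X : ℂ[X]) • w) := by
  change a.toEnd (GWA.z t) w = _
  let := complexModule V
  unfold toEnd GWA.z GWA.gen
  rw [RingQuot.liftAlgHom_mkAlgHom_apply, FreeAlgebra.lift_ι_apply]
  rfl

/-- The bundled module carries a second `ℂ[X]`-structure, pulled back along `GWA.poly`. It agrees
with the original one because the two agree on constants and on `X`. -/
theorem poly_smul_equiv (p : ℂ[X]) (w : V) : p • a.equiv w = a.equiv (p • w) := by
  induction p using Polynomial.induction_on generalizing w with
  | C c =>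
    rw [poly_smul_def, GWA.poly, aeval_C]
    change a.toEnd (algebraMap ℂ _ c) w = _
    let := complexModule V
    rw [AlgHom.commutes]
    rfl
  | add p q hp hq => rw [add_smul, add_smul, hp, hq, map_add]
  | monomial n c h =>
    rw [pow_succ, ← mul_assoc, mul_smul _ (X : ℂ[X]), mul_smul _ (X : ℂ[X]), ← h, ← z_smul_equiv,
      poly_smul_def a.toModuleCat X, GWA.poly, aeval_X]

end GWAAction

/-! ### Scalars and weight spaces -/

/-- The scalars `ℂ` acting on an `A(t)`-module. -/
instance scalarModule {t : ℂ[X]} (M : ModuleCat.{u} (GWA t)) : Module ℂ M :=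
  Module.compHom M (C : ℂ →+* ℂ[X])

section

variable {t : ℂ[X]} (M : ModuleCat.{u} (GWA t))

theorem C_smul (c : ℂ) (w : M) : (C c : ℂ[X]) • w = c • w := rfl

instance : IsScalarTower ℂ ℂ[X] M :=
  ⟨fun c p w => by rw [← C_smul, smul_smul, Polynomial.smul_eq_C_mul]⟩

instance : IsScalarTower ℂ (GWA t) M :=
  ⟨fun c p w => by
    rw [← C_smul, poly_smul_def, GWA.poly, aeval_C, smul_smul, Algebra.smul_def]⟩

theorem z_smul (w : M) : GWA.z t • w = (X : ℂ[X]) • w := by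
  rw [poly_smul_def, GWA.poly, aeval_X]

/-- The action of an element of `A(t)` as a `ℂ`-linear map. -/
def op (a : GWA t) : M →ₗ[ℂ] M where
  toFun w := a • w
  map_add' := smul_add a
  map_smul' c w := by
    rw [RingHom.id_apply, ← algebraMap_smul (GWA t) c w, ← algebraMap_smul (GWA t) c (a • w),
      smul_smul, smul_smul, Algebra.commutes]

@[simp]
theorem op_apply (a : GWA t) (w : M) : op M a w = a • w := rfl

variable {M}

theorem smul_scalar (a : GWA t) (c : ℂ) (w : M) : a • (c • w) = c • (a • w) :=
  map_smul (op M a) c w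

theorem mem_weightSpace {c : ℂ} {w : M} :
    w ∈ weightSpace M c ↔ (X : ℂ[X]) • w = c • w := by
  rw [weightSpace, Submodule.mem_torsionBy_iff, sub_smul, sub_eq_zero, C_smul]

theorem poly_smul_of_mem {c : ℂ} {w : M} (h : w ∈ weightSpace M c) (p : ℂ[X]) :
    p • w = p.eval c • w := by
  induction p using Polynomial.induction_on with
  | C a => rw [C_smul, eval_C]
  | add p q hp hq => rw [add_smul, eval_add, add_smul, hp, hq]
  | monomial n a h' =>
    rw [pow_succ', mul_comm X, ← mul_assoc, mul_smul, mem_weightSpace.1 h, smul_comm, h', eval_mul,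
      eval_mul, eval_mul, eval_X, smul_smul, mul_comm c]

theorem xp_mem {c : ℂ} {w : M} (h : w ∈ weightSpace M c) :
    GWA.xp t • w ∈ weightSpace M (c + 1) := by
  -- `X + 1` is the polynomial that becomes `X` when moved to the left of `X⁺`, so `z X⁺ w = X⁺ (z +
  -- 1) w`.
  have h1 := xp_smul_smul M (X + 1) w
  rw [show shift 1 (X + 1) = X by simp [shift], poly_smul_of_mem h, smul_scalar] at h1
  rw [mem_weightSpace, ← h1]
  simp

theorem xm_mem {c : ℂ} {w : M} (h : w ∈ weightSpace M c) :
    GWA.xm t • w ∈ weightSpace M (c - 1) := by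
  have h1 := xm_smul_smul M (X - 1) w
  rw [show shift (-1) (X - 1) = X by simp [shift], poly_smul_of_mem h, smul_scalar] at h1
  rw [mem_weightSpace, ← h1]
  simp

theorem xp_xm_of_mem {c : ℂ} {w : M} (h : w ∈ weightSpace M c) :
    GWA.xp t • GWA.xm t • w = t.eval (c - 1 / 2) • w := by
  rw [xp_smul_xm, poly_smul_of_mem h, eval_shift]

theorem xm_xp_of_mem {c : ℂ} {w : M} (h : w ∈ weightSpace M c) :
    GWA.xm t • GWA.xp t • w = t.eval (c + 1 / 2) • w := by
  rw [xm_smul_xp, poly_smul_of_mem h, eval_shift]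
  congr 2
  ring

/-- Weight spaces are eigenspaces of `z` over `ℂ`. The criterion by finite sums does not mention the
base ring, so independence passes from `ℂ` to `ℂ[X]`. -/
theorem weightSpace_iSupIndep : iSupIndep (weightSpace M) := by
  have h := Module.End.eigenspaces_iSupIndep (op M (GWA.z t))
  rw [iSupIndep_iff_finsetSum_eq_zero_imp_eq_zero] at h ⊢
  intro s v hv
  refine h s v fun i hi => ?_
  rw [Module.End.mem_eigenspace_iff, op_apply, z_smul]
  exact mem_weightSpace.1 (hv i hi)

theorem gwaLin_scalar {N : ModuleCat.{v} (GWA t)} (f : M →ₗ[GWA t] N) (c : ℂ) (w : M) :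
    f (c • w) = c • f w := by
  rw [← C_smul, gwaLin_poly, C_smul]

theorem map_mem_weightSpace {N : ModuleCat.{v} (GWA t)} (f : M →ₗ[GWA t] N) {c : ℂ} {w : M}
    (h : w ∈ weightSpace M c) : f w ∈ weightSpace N c := by
  rw [mem_weightSpace] at h ⊢
  rw [← gwaLin_poly, h, gwaLin_scalar]

end

/-! ### Indecomposability through idempotents -/

open CategoryTheory Limits in
/-- A module is indecomposable iff it is nonzero and has no nontrivial idempotent endomorphism. -/
theorem indecomposable_iff {R : Type v} [Ring R] (M : ModuleCat.{u} R) :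
    Indecomposable M ↔ Nontrivial M ∧ ∀ e : M →ₗ[R] M, (∀ w, e (e w) = e w) →
      (∀ w, e w = 0) ∨ ∀ w, e w = w := by
  constructor
  · rintro ⟨h0, h⟩
    refine ⟨?_, fun e he => ?_⟩
    · by_contra hn
      rw [not_nontrivial_iff_subsingleton] at hn
      exact h0 (ModuleCat.isZero_of_subsingleton M)
    -- An idempotent splits the module into its range and its kernel, one of which must therefore
    -- vanish.
    · have hc : IsCompl (LinearMap.range e) (LinearMap.ker e) :=
        LinearMap.IsIdempotentElem.isCompl (LinearMap.ext he)
      let i : M ≅ ModuleCat.of R (LinearMap.range e) ⊞ ModuleCat.of R (LinearMap.ker e) :=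
        (Submodule.prodEquivOfIsCompl _ _ hc).symm.toModuleIso ≪≫
          (ModuleCat.biprodIsoProd (ModuleCat.of R (LinearMap.range e))
            (ModuleCat.of R (LinearMap.ker e))).symm
      rcases h _ _ i with hz | hz
      · have := ModuleCat.subsingleton_of_isZero hz
        left
        intro w
        exact congrArg Subtype.val (Subsingleton.elim (α := LinearMap.range e) ⟨e w, w, rfl⟩ 0)
      · have := ModuleCat.subsingleton_of_isZero hz
        right
        intro w
        have h1 : w - e w ∈ LinearMap.ker e := by simp [he]
        have h2 := congrArg Subtype.val (Subsingleton.elim (α := LinearMap.ker e) ⟨w - e w, h1⟩ 0)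
        exact (sub_eq_zero.1 h2).symm
  · rintro ⟨h0, h⟩
    refine ⟨fun hz => ?_, fun Y Z i => ?_⟩
    · have := ModuleCat.subsingleton_of_isZero hz
      exact not_subsingleton M this
    -- The projection onto the first summand: if it is zero then `Y` is zero, and if it is the
    -- identity then `Z` is zero.
    · let e : M ⟶ M := i.hom ≫ biprod.fst ≫ biprod.inl ≫ i.inv
      have he : e ≫ e = e := by simp [e]
      rcases h e.hom (fun w => congrArg (fun g : M ⟶ M => g.hom w) he) with h1 | h1
      · left
        have h2 : e = 0 := by
          ext w
          exact h1 w
        rw [IsZero.iff_id_eq_zero]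
        have h3 : biprod.inl ≫ (i.inv ≫ e ≫ i.hom) ≫ biprod.fst = 𝟙 Y := by simp [e]
        rw [← h3, h2]
        simp
      · right
        have h2 : e = 𝟙 M := by
          ext w
          exact h1 w
        rw [IsZero.iff_id_eq_zero]
        have h3 : biprod.inr ≫ (i.inv ≫ e ≫ i.hom) ≫ biprod.snd = (0 : Z ⟶ Z) := by simp [e]
        rw [← h3, h2]
        simp

/-! ### Thin modules and their invariants -/

/-- The vectors `x n` with `n ∈ I` are a weight basis of `M`, with dual basis `φ n`; they are not
killed by `X⁺` if `n ∈ U`, and not by `X⁻` if `n - 1 ∈ D`. -/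
structure IsThinBasis {t : ℂ[X]} (M : ModuleCat.{u} (GWA t)) (I U D : Set ℤ) (x : ℤ → M)
    (φ : ℤ → M →+ ℂ) : Prop where
  mem : ∀ n : ℤ, x n ∈ weightSpace M n
  map_smul : ∀ (n : ℤ) (p : ℂ[X]) w, φ n (p • w) = p.eval (n : ℂ) * φ n w
  dual : ∀ n ∈ I, φ n (x n) = 1
  eq_zero : ∀ n ∉ I, x n = 0
  span : Submodule.span ℂ[X] (Set.range x) = ⊤
  up : ∀ n, n ∈ U ↔ GWA.xp t • x n ≠ 0
  down : ∀ n, n ∈ D ↔ GWA.xm t • x (n + 1) ≠ 0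

/-- `M` is a weight module with one-dimensional weight spaces of weights `I`, and `X⁺` (`X⁻`) is a
bijection between the weight spaces of weights `n` and `n + 1` exactly if `n ∈ U` (`n ∈ D`). -/
def Thin {t : ℂ[X]} (M : ModuleCat.{u} (GWA t)) (I U D : Set ℤ) : Prop :=
  ∃ x φ, IsThinBasis M I U D x φ

namespace IsThinBasis

variable {t : ℂ[X]} {M : ModuleCat.{u} (GWA t)} {I U D : Set ℤ} {x : ℤ → M} {φ : ℤ → M →+ ℂ}

theorem apply_scalar (h : IsThinBasis M I U D x φ) (n : ℤ) (c : ℂ) (w : M) :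
    φ n (c • w) = c * φ n w := by
  rw [← C_smul, h.map_smul, eval_C]

/-- Computing `φ n (z • w)` in two ways gives `(n - c) * φ n w = 0`. -/
theorem apply_of_mem (h : IsThinBasis M I U D x φ) {n : ℤ} {c : ℂ} (hc : (n : ℂ) ≠ c) {w : M}
    (hw : w ∈ weightSpace M c) : φ n w = 0 := by
  have h1 := h.map_smul n X w
  rw [mem_weightSpace.1 hw, h.apply_scalar, eval_X] at h1
  have : ((n : ℂ) - c) * φ n w = 0 := by linear_combination -h1
  exact (mul_eq_zero.1 this).resolve_left (sub_ne_zero.2 hc)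

theorem ne_zero (h : IsThinBasis M I U D x φ) {n : ℤ} (hn : n ∈ I) : x n ≠ 0 := by
  intro h0
  have := h.dual n hn
  rw [h0, map_zero] at this
  exact zero_ne_one this

theorem span_scalar (h : IsThinBasis M I U D x φ) : Submodule.span ℂ (Set.range x) = ⊤ := by
  rw [Submodule.eq_top_iff']
  intro w
  have hw : w ∈ Submodule.span ℂ[X] (Set.range x) := h.span ▸ Submodule.mem_top
  induction hw using Submodule.span_induction with
  | mem w hw => exact Submodule.subset_span hw
  | zero => exact zero_mem _
  | add v w _ _ hv hw => exact add_mem hv hw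
  | smul p w hp hw =>
    clear hp
    induction hw using Submodule.span_induction with
    | mem w hw =>
      obtain ⟨n, rfl⟩ := hw
      rw [poly_smul_of_mem (h.mem n)]
      exact Submodule.smul_mem _ _ (Submodule.subset_span ⟨n, rfl⟩)
    | zero => rw [smul_zero]; exact zero_mem _
    | add v w _ _ hv hw => rw [smul_add]; exact add_mem hv hw
    | smul c w _ hw => rw [smul_comm]; exact Submodule.smul_mem _ _ hw

/-- In an expansion of `w` in the vectors `x m`, the functional `φ n` reads off the coefficient at
`n ∈ I`; the vectors with index outside `I` are zero. -/
theorem ext_zero (h : IsThinBasis M I U D x φ) {w : M} (hw : ∀ n ∈ I, φ n w = 0) : w = 0 := by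
  have h1 : w ∈ Submodule.span ℂ (Set.range x) := h.span_scalar ▸ Submodule.mem_top
  obtain ⟨c, rfl⟩ := Finsupp.mem_span_range_iff_exists_finsupp.1 h1
  refine Finset.sum_eq_zero fun n hn => ?_
  by_cases hI : n ∈ I
  · have h2 := hw n hI
    rw [Finsupp.sum, map_sum, Finset.sum_eq_single n, h.apply_scalar, h.dual n hI, mul_one] at h2
    · simp only [h2, zero_smul]
    · intro m _ hm
      rw [h.apply_scalar, h.apply_of_mem (by exact_mod_cast hm.symm) (h.mem m), mul_zero]
    · intro hn'
      exact absurd hn hn'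
  · simp only [h.eq_zero n hI, smul_zero]

/-- One-dimensionality of the weight spaces: the difference of the two sides is killed by every
functional with index in `I`. For `n ∉ I` it says that `w = 0`. -/
theorem eq_smul (h : IsThinBasis M I U D x φ) {n : ℤ} {w : M} (hw : w ∈ weightSpace M n) :
    w = φ n w • x n := by
  rw [← sub_eq_zero]
  apply h.ext_zero
  intro m hm
  by_cases hmn : m = n
  · subst hmn
    rw [map_sub, h.apply_scalar, h.dual m hm, mul_one, sub_self]
  · refine h.apply_of_mem (c := (n : ℂ)) (by exact_mod_cast hmn) (sub_mem hw ?_)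
    rw [← C_smul]
    exact Submodule.smul_mem _ _ (h.mem n)

theorem eq_zero_of_mem (h : IsThinBasis M I U D x φ) {c : ℂ} (hc : ∀ n : ℤ, (n : ℂ) ≠ c) {w : M}
    (hw : w ∈ weightSpace M c) : w = 0 :=
  h.ext_zero fun n _ => h.apply_of_mem (hc n) hw

theorem isWeightModule (h : IsThinBasis M I U D x φ) : IsWeightModule M where
  isInternal := by
    classical
    convert DirectSum.isInternal_submodule_of_iSupIndep_of_iSup_eq_top weightSpace_iSupIndep ?_
    rw [eq_top_iff, ← h.span, Submodule.span_le]
    rintro _ ⟨n, rfl⟩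
    exact Submodule.mem_iSup_of_mem _ (h.mem n)
  finite c := by
    rw [Module.Finite.iff_fg]
    by_cases hc : ∃ n : ℤ, (n : ℂ) = c
    · obtain ⟨n, rfl⟩ := hc
      refine ⟨{x n}, le_antisymm ?_ fun w hw => ?_⟩
      · rw [Submodule.span_le]
        simpa using h.mem n
      · rw [h.eq_smul hw, ← C_smul]
        exact Submodule.smul_mem _ _ (Submodule.subset_span (by simp))
    · push Not at hc
      refine ⟨∅, le_antisymm (by simp) fun w hw => ?_⟩
      rw [h.eq_zero_of_mem hc hw]
      exact zero_mem _
  integral c hc := by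
    by_contra hn
    refine hc ((Submodule.eq_bot_iff _).2 fun w hw => h.eq_zero_of_mem (fun n hn' => ?_) hw)
    exact hn ⟨n, hn'⟩

theorem weightSpace_ne_bot (h : IsThinBasis M I U D x φ) (n : ℤ) :
    weightSpace M n ≠ ⊥ ↔ n ∈ I := by
  rw [Submodule.ne_bot_iff]
  constructor
  · rintro ⟨w, hw, h0⟩
    by_contra hn
    apply h0
    rw [h.eq_smul hw, h.eq_zero n hn, smul_zero]
  · exact fun hn => ⟨x n, h.mem n, h.ne_zero hn⟩

theorem support_eq (h : IsThinBasis M I U D x φ) : support M = {c : ℂ | ∃ n : ℤ, c = n ∧ n ∈ I} := by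
  ext c
  constructor
  · intro hc
    obtain ⟨n, rfl⟩ := h.isWeightModule.integral hc
    exact ⟨n, rfl, (h.weightSpace_ne_bot n).1 hc⟩
  · rintro ⟨n, rfl, hn⟩
    exact (h.weightSpace_ne_bot n).2 hn

theorem xp_ne_zero_iff (h : IsThinBasis M I U D x φ) {n : ℤ} {w : M} (hw : w ∈ weightSpace M n)
    (h0 : w ≠ 0) : GWA.xp t • w ≠ 0 ↔ n ∈ U := by
  have h1 := h.eq_smul hw
  have hc : φ n w ≠ 0 := fun hc => h0 (by rw [h1, hc, zero_smul])
  rw [h1, smul_scalar, h.up, smul_ne_zero_iff]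
  tauto

theorem xm_ne_zero_iff (h : IsThinBasis M I U D x φ) {n : ℤ} {w : M}
    (hw : w ∈ weightSpace M (n + 1 : ℤ)) (h0 : w ≠ 0) : GWA.xm t • w ≠ 0 ↔ n ∈ D := by
  have h1 := h.eq_smul hw
  have hc : φ (n + 1) w ≠ 0 := fun hc => h0 (by rw [h1, hc, zero_smul])
  rw [h1, smul_scalar, h.down, smul_ne_zero_iff]
  tauto

theorem mem_of_mem_up (h : IsThinBasis M I U D x φ) {n : ℤ} (hn : n ∈ U) : n ∈ I := by
  by_contra hI
  exact (h.up n).1 hn (by rw [h.eq_zero n hI, smul_zero])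

theorem mem_of_mem_down (h : IsThinBasis M I U D x φ) {n : ℤ} (hn : n ∈ D) : n + 1 ∈ I := by
  by_contra hI
  exact (h.down n).1 hn (by rw [h.eq_zero _ hI, smul_zero])

theorem xp_smul (h : IsThinBasis M I U D x φ) (n : ℤ) :
    GWA.xp t • x n = φ (n + 1) (GWA.xp t • x n) • x (n + 1) := by
  apply h.eq_smul
  push_cast
  exact xp_mem (h.mem n)

theorem xm_smul (h : IsThinBasis M I U D x φ) (n : ℤ) :
    GWA.xm t • x (n + 1) = φ n (GWA.xm t • x (n + 1)) • x n := by
  apply h.eq_smul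
  have := xm_mem (h.mem (n + 1))
  push_cast at this
  rwa [add_sub_cancel_right] at this

/-- An endomorphism multiplies each `x n` by a scalar `ε n`. A nonzero arrow in either direction
between `n` and `n + 1` forces `ε n = ε (n + 1)`, so by `hc` the endomorphism is a single scalar,
and an idempotent scalar is `0` or `1`. -/
theorem indecomposable (h : IsThinBasis M I U D x φ) (hI : I.Nonempty)
    (hc : ∀ m ∈ I, ∀ n ∈ I, ∀ l, m ≤ l → l < n → l ∈ U ∨ l ∈ D) :
    CategoryTheory.Indecomposable M := by
  rw [indecomposable_iff]
  obtain ⟨n₀, hn₀⟩ := hI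
  refine ⟨⟨x n₀, 0, h.ne_zero hn₀⟩, fun e he => ?_⟩
  set ε : ℤ → ℂ := fun n => φ n (e (x n)) with hε
  have hx : ∀ n, e (x n) = ε n • x n := fun n => h.eq_smul (map_mem_weightSpace e (h.mem n))
  have hstep : ∀ n, n ∈ U ∨ n ∈ D → ε n = ε (n + 1) := by
    rintro n (hn | hn)
    · have h1 := congrArg e (h.xp_smul n)
      rw [LinearMap.map_smul, gwaLin_scalar, hx, hx, smul_scalar, smul_comm _ (ε (n + 1)),
        ← h.xp_smul n] at h1
      exact smul_left_injective ℂ ((h.up n).1 hn) h1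
    · have h1 := congrArg e (h.xm_smul n)
      rw [LinearMap.map_smul, gwaLin_scalar, hx, hx, smul_scalar, smul_comm _ (ε n),
        ← h.xm_smul n] at h1
      exact (smul_left_injective ℂ ((h.down n).1 hn) h1).symm
  have hpath : ∀ m ∈ I, ∀ n ∈ I, m ≤ n → ε m = ε n := by
    intro m hm n hn hmn
    have : ∀ l, m ≤ l → l ≤ n → ε m = ε l := by
      intro l hl
      induction l, hl using Int.leInduction with
      | base => exact fun _ => rfl
      | succ l hl ih => exact fun hl' => (ih (by omega)).trans (hstep l (hc m hm n hn l hl (by omega)))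
    exact this n hmn le_rfl
  have hconst : ∀ n ∈ I, ε n = ε n₀ := by
    intro n hn
    rcases le_total n n₀ with hl | hl
    · exact hpath n hn n₀ hn₀ hl
    · exact (hpath n₀ hn₀ n hn hl).symm
  have hall : ∀ w, e w = ε n₀ • w := by
    intro w
    have hw : w ∈ Submodule.span ℂ (Set.range x) := h.span_scalar ▸ Submodule.mem_top
    induction hw using Submodule.span_induction with
    | mem w hw =>
      obtain ⟨n, rfl⟩ := hw
      by_cases hn : n ∈ I
      · rw [hx, hconst n hn]
      · rw [h.eq_zero n hn, map_zero, smul_zero]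
    | zero => rw [map_zero, smul_zero]
    | add v w _ _ hv hw => rw [map_add, hv, hw, smul_add]
    | smul c w _ hw => rw [gwaLin_scalar, hw, smul_comm]
  have h2 : ε n₀ * ε n₀ = ε n₀ := by
    have h3 := he (x n₀)
    rw [hall, hall, smul_smul] at h3
    exact smul_left_injective ℂ (h.ne_zero hn₀) h3
  have h3 : ε n₀ * (ε n₀ - 1) = 0 := by linear_combination h2
  rcases mul_eq_zero.1 h3 with h4 | h4
  · left
    intro w
    rw [hall, h4, zero_smul]
  · right
    intro w
    rw [hall, sub_eq_zero.1 h4, one_smul]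

end IsThinBasis

theorem Thin.congr {t : ℂ[X]} {M : ModuleCat.{u} (GWA t)} {N : ModuleCat.{v} (GWA t)}
    {I U D : Set ℤ} (h : Thin M I U D) (f : M ≃ₗ[GWA t] N) : Thin N I U D := by
  obtain ⟨x, φ, h⟩ := h
  refine ⟨fun n => f (x n), fun n => (φ n).comp f.symm.toAddEquiv.toAddMonoidHom, ?_, ?_, ?_, ?_,
    ?_, ?_, ?_⟩
  · exact fun n => map_mem_weightSpace f.toLinearMap (h.mem n)
  · intro n p w
    change φ n (f.symm (p • w)) = _ * φ n (f.symm w)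
    rw [← h.map_smul]
    exact congrArg (φ n) (gwaLin_poly f.symm.toLinearMap p w)
  · intro n hn
    change φ n (f.symm (f (x n))) = 1
    rw [f.symm_apply_apply, h.dual n hn]
  · intro n hn
    rw [h.eq_zero n hn, map_zero]
  · rw [Submodule.eq_top_iff']
    intro w
    have hw : f.symm w ∈ Submodule.span ℂ[X] (Set.range x) := h.span ▸ Submodule.mem_top
    rw [← f.apply_symm_apply w]
    generalize f.symm w = v at hw
    induction hw using Submodule.span_induction with
    | mem w hw =>
      obtain ⟨n, rfl⟩ := hw
      exact Submodule.subset_span ⟨n, rfl⟩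
    | zero => rw [map_zero]; exact zero_mem _
    | add v w _ _ hv hw => rw [map_add]; exact add_mem hv hw
    | smul p w _ hw =>
      have := gwaLin_poly f.toLinearMap p w
      rw [LinearEquiv.coe_coe] at this
      rw [this]
      exact Submodule.smul_mem _ _ hw
  · intro n
    rw [h.up]
    rw [← map_smul f, f.map_ne_zero_iff]
  · intro n
    rw [h.down]
    rw [← map_smul f, f.map_ne_zero_iff]

/-- Each set has an intrinsic meaning: `I` consists of the integers with nonzero weight space, and
`U`, `D` record whether `X⁺`, `X⁻` kill a nonzero weight vector, a question that does not depend on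
the chosen vector. -/
theorem Thin.eq {t : ℂ[X]} {M : ModuleCat.{u} (GWA t)} {I U D I' U' D' : Set ℤ}
    (h : Thin M I U D) (h' : Thin M I' U' D') : I = I' ∧ U = U' ∧ D = D' := by
  obtain ⟨x, φ, h⟩ := h
  obtain ⟨x', φ', h'⟩ := h'
  have hI : I = I' := by
    ext n
    rw [← h.weightSpace_ne_bot, h'.weightSpace_ne_bot]
  subst hI
  refine ⟨rfl, ?_, ?_⟩
  · ext n
    by_cases hn : n ∈ I
    · rw [h.up, h'.xp_ne_zero_iff (h.mem n) (h.ne_zero hn)]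
    · exact ⟨fun hU => absurd (h.mem_of_mem_up hU) hn, fun hU => absurd (h'.mem_of_mem_up hU) hn⟩
  · ext n
    by_cases hn : n + 1 ∈ I
    · rw [h.down, h'.xm_ne_zero_iff (h.mem (n + 1)) (h.ne_zero hn)]
    · exact ⟨fun hU => absurd (h.mem_of_mem_down hU) hn,
        fun hU => absurd (h'.mem_of_mem_down hU) hn⟩

/-! ### Thinness of `M_S^t` and of tensor products -/

/-- The weights of `M_S^t`. -/
def weights (S : DirectedSubset) : Set ℤ := {n | (n : ℝ) ∈ S.underlying}

/-- The weights of `M_S^t` on which `X⁺` does not vanish. -/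
def ups (S : DirectedSubset) : Set ℤ :=
  {n | n ∈ weights S ∧ n + 1 ∈ weights S ∧ S ((n : ℝ) + 1 / 2) ≠ Membership.left}

/-- The weights `n` such that `X⁻` does not vanish on the weight space of weight `n + 1`. -/
def downs (S : DirectedSubset) : Set ℤ :=
  {n | n ∈ weights S ∧ n + 1 ∈ weights S ∧ S ((n : ℝ) + 1 / 2) ≠ Membership.right}

/-- The coefficient functional of a basis vector. -/
def coordHom {S : DirectedSubset} (n : Weights S) : WeightSum S →ₗ[ℂ] ℂ :=
  (Finsupp.lapply n : (Weights S →₀ ℂ) →ₗ[ℂ] ℂ)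

/-- The coefficient functional of `v_n`, zero for `n ∉ S`. -/
def coeffHom (S : DirectedSubset) (n : ℤ) : WeightSum S →ₗ[ℂ] ℂ :=
  open Classical in
  if h : (n : ℝ) ∈ S.underlying then coordHom ⟨n, h⟩ else 0

theorem coeffHom_vec_self {S : DirectedSubset} {n : ℤ} (h : (n : ℝ) ∈ S.underlying) :
    coeffHom S n (vec S n) = 1 := by
  rw [coeffHom, dif_pos h, vec_of_mem h]
  exact Finsupp.single_eq_same

theorem coeffHom_vec_of_ne {S : DirectedSubset} {m n : ℤ} (h : m ≠ n) :
    coeffHom S m (vec S n) = 0 := by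
  by_cases hn : (n : ℝ) ∈ S.underlying
  · by_cases hm : (m : ℝ) ∈ S.underlying
    · rw [coeffHom, dif_pos hm, vec_of_mem hn]
      exact Finsupp.single_eq_of_ne (by simpa using h)
    · rw [coeffHom, dif_neg hm, LinearMap.zero_apply]
  · rw [vec_of_notMem hn, map_zero]

theorem span_vec (S : DirectedSubset) : Submodule.span ℂ (Set.range (vec S)) = ⊤ := by
  rw [Submodule.eq_top_iff']
  intro w
  have hw : w = Finsupp.sum (show Weights S →₀ ℂ from w) fun n c => c • vec S n := by
    have h : LinearMap.id = extend S fun n => vec S n := by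
      apply hom_ext
      intro n
      rw [extend_basisVec, vec_of_mem n.2]
      rfl
    exact LinearMap.congr_fun h w
  rw [hw]
  exact Submodule.sum_mem _ fun n _ => Submodule.smul_mem _ _ (Submodule.subset_span ⟨n, rfl⟩)

theorem hom_ext_vec' {S : DirectedSubset} {N : Type v} [AddCommGroup N] [Module ℂ N]
    {f g : WeightSum S →ₗ[ℂ] N}
    (h : ∀ n : ℤ, (n : ℝ) ∈ S.underlying → f (vec S n) = g (vec S n)) : f = g := by
  apply LinearMap.ext_on_range (span_vec S)
  intro n
  by_cases hn : (n : ℝ) ∈ S.underlying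
  · exact h n hn
  · rw [vec_of_notMem hn, map_zero, map_zero]

theorem coeffHom_poly {S : DirectedSubset} (n : ℤ) (p : ℂ[X]) (w : WeightSum S) :
    coeffHom S n (p • w) = p.eval (n : ℂ) * coeffHom S n w := by
  have : coeffHom S n ∘ₗ polyEnd S p = p.eval (n : ℂ) • coeffHom S n := by
    apply hom_ext_vec'
    intro m hm
    rw [LinearMap.comp_apply, polyEnd_vec, map_smul, LinearMap.smul_apply]
    by_cases hnm : n = m
    · subst hnm
      rfl
    · rw [coeffHom_vec_of_ne hnm, smul_zero, smul_zero]
  exact LinearMap.congr_fun this w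

theorem span_poly_vec (S : DirectedSubset) : Submodule.span ℂ[X] (Set.range (vec S)) = ⊤ := by
  rw [Submodule.eq_top_iff']
  intro w
  have hw : w ∈ Submodule.span ℂ (Set.range (vec S)) := span_vec S ▸ Submodule.mem_top
  induction hw using Submodule.span_induction with
  | mem w hw => exact Submodule.subset_span hw
  | zero => exact zero_mem _
  | add v w _ _ hv hw => exact add_mem hv hw
  | smul c w _ hw =>
    have : c • w = (C c : ℂ[X]) • w := by
      rw [poly_smul_eq, aeval_C, Module.algebraMap_end_apply]
    rw [this]
    exact Submodule.smul_mem _ _ hw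

/-- A basis of `v_n` gives a thin basis, for any operators on the space that make it a module. -/
theorem isThinBasis_toModuleCat {t : ℂ[X]} {S : DirectedSubset} (a : GWAAction t (WeightSum S)) :
    IsThinBasis a.toModuleCat (weights S) {n | a.xp (vec S n) ≠ 0} {n | a.xm (vec S (n + 1)) ≠ 0}
      (fun n => a.equiv (vec S n))
      (fun n => (coeffHom S n).toAddMonoidHom.comp a.equiv.symm.toAddMonoidHom) where
  mem n := by
    rw [mem_weightSpace, a.poly_smul_equiv, ← C_smul, a.poly_smul_equiv, poly_smul_vec,
      poly_smul_vec, eval_X, eval_C]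
  map_smul n p w := by
    obtain ⟨w, rfl⟩ := a.equiv.surjective w
    rw [a.poly_smul_equiv]
    exact coeffHom_poly n p w
  dual n hn := coeffHom_vec_self hn
  eq_zero n hn := by
    rw [vec_of_notMem hn, map_zero]
  span := by
    rw [Submodule.eq_top_iff']
    intro w
    obtain ⟨w, rfl⟩ := a.equiv.surjective w
    have hw : w ∈ Submodule.span ℂ[X] (Set.range (vec S)) := span_poly_vec S ▸ Submodule.mem_top
    induction hw using Submodule.span_induction with
    | mem w hw =>
      obtain ⟨n, rfl⟩ := hw
      exact Submodule.subset_span ⟨n, rfl⟩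
    | zero => rw [map_zero]; exact zero_mem _
    | add v w _ _ hv hw => rw [map_add]; exact add_mem hv hw
    | smul p w _ hw =>
      rw [← a.poly_smul_equiv]
      exact Submodule.smul_mem _ _ hw
  up n := by
    rw [a.xp_smul_equiv, AddEquiv.map_ne_zero_iff]
    rfl
  down n := by
    rw [a.xm_smul_equiv, AddEquiv.map_ne_zero_iff]
    rfl

theorem vec_ne_zero_iff {S : DirectedSubset} {n : ℤ} : vec S n ≠ 0 ↔ n ∈ weights S := by
  constructor
  · intro h
    by_contra hn
    exact h (vec_of_notMem hn)
  · intro hn h0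
    have := coeffHom_vec_self hn
    rw [h0, map_zero] at this
    exact zero_ne_one this

/-- Between two consecutive weights the midpoint lies in `S`, so a coefficient can vanish only
because of the direction there: `left` kills `X⁺`, and `right` kills `X⁻`. -/
theorem thin_moduleOf {t : ℂ[X]} {S : DirectedSubset} (hS : IsAdmissible t S) :
    Thin (moduleOf hS) (weights S) (ups S) (downs S) := by
  have h := isThinBasis_toModuleCat (moduleAction hS)
  have hmid : ∀ n : ℤ, n ∈ weights S → n + 1 ∈ weights S →
      S ((n : ℝ) + 1 / 2) ≠ Membership.zero := fun n h1 h2 => hS.mem_mid h1 h2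
  have hup : ups S = {n | (moduleAction hS).xp (vec S n) ≠ 0} := by
    ext n
    change _ ↔ raise S (vec S n) ≠ 0
    by_cases hn : n ∈ weights S
    · rw [raise_vec hn, smul_ne_zero_iff, vec_ne_zero_iff]
      simp only [ups, Set.mem_ofPred_eq, hn, true_and, and_comm (b := n + 1 ∈ weights S)]
      refine and_congr_right fun hn' => ?_
      have := hmid n hn hn'
      unfold upCoeff
      generalize S ((n : ℝ) + 1 / 2) = s at *
      cases s <;> simp_all
    · rw [vec_of_notMem hn, map_zero]
      simp [ups, hn]
  have hdown : downs S = {n | (moduleAction hS).xm (vec S (n + 1)) ≠ 0} := by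
    ext n
    change _ ↔ lower t S (vec S (n + 1)) ≠ 0
    by_cases hn : n + 1 ∈ weights S
    · rw [lower_vec hn, smul_ne_zero_iff, add_sub_cancel_right, vec_ne_zero_iff]
      simp only [downs, Set.mem_ofPred_eq, hn, true_and, and_comm (b := n ∈ weights S)]
      refine and_congr_right fun hn' => ?_
      have h1 := hmid n hn' hn
      -- Roots of `t` inside the underlying set are directed, so at an undirected midpoint the
      -- coefficient `t(n + 1/2)` of `X⁻` is nonzero.
      have h2 : S ((n : ℝ) + 1 / 2) = Membership.one → t.eval ((n : ℂ) + 1 / 2) ≠ 0 := by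
        intro h2 h3
        have h4 := (hS.directed ((n : ℝ) + 1 / 2)).2 ⟨h1, by
          rw [IsRoot.def]; push_cast; exact h3⟩
        rcases h4 with h4 | h4 <;> rw [h2] at h4 <;> cases h4
      unfold downCoeff
      generalize S ((n : ℝ) + 1 / 2) = s at *
      cases s <;> simp_all
    · rw [vec_of_notMem hn, map_zero]
      simp [downs, hn]
  rw [hup, hdown]
  exact ⟨_, _, h⟩

/-- Over `ℂ[X]` only tensors of equal weight survive, so `x n ⊗ y n` is a weight basis. Since `X^±`
act diagonally, an arrow of the product is nonzero exactly when both factors have it. -/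
theorem thin_tensor {s t : ℂ[X]} {M : ModuleCat.{u} (GWA s)} {N : ModuleCat.{u} (GWA t)}
    {I U D I' U' D' : Set ℤ} (h : Thin M I U D) (h' : Thin N I' U' D') :
    Thin (tensor M N) (I ∩ I') (U ∩ U') (D ∩ D') := by
  obtain ⟨x, φ, h⟩ := h
  obtain ⟨y, ψ, h'⟩ := h'
  set a := tensorAction M N with ha
  -- The product of `φ n` and `ψ n` is balanced over `ℂ[X]`, because a polynomial `p` comes out of
  -- either one as the same scalar `p(n)`.
  have hpair : ∀ n : ℤ, ∃ χ : M ⊗[ℂ[X]] N →+ ℂ, (∀ v w, χ (v ⊗ₜ w) = φ n v * ψ n w) ∧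
      ∀ (p : ℂ[X]) w, χ (p • w) = p.eval (n : ℂ) * χ w := by
    intro n
    let χ : M ⊗[ℂ[X]] N →+ ℂ := TensorProduct.liftAddHom
      ((AddMonoidHom.mul (R := ℂ)).compl₂ (ψ n) |>.comp (φ n)) (fun p v w => by
        change φ n (p • v) * ψ n w = φ n v * ψ n (p • w)
        rw [h.map_smul, h'.map_smul]
        ring)
    have h1 : ∀ v w, χ (v ⊗ₜ w) = φ n v * ψ n w := fun v w => rfl
    refine ⟨χ, h1, fun p w => ?_⟩
    induction w with
    | zero => rw [smul_zero, map_zero, mul_zero]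
    | add v w hv hw => rw [smul_add, map_add, map_add, hv, hw, mul_add]
    | tmul v w => rw [TensorProduct.smul_tmul', h1, h1, h.map_smul, mul_assoc]
  choose χ hχ hχp using hpair
  -- The functional `χ n` detects that a tensor of nonzero vectors of the same weight is nonzero;
  -- this can fail for general tensors over `ℂ[X]`.
  have hne : ∀ (n : ℤ) (v : M) (w : N), v ∈ weightSpace M n → w ∈ weightSpace N n →
      (v ⊗ₜ[ℂ[X]] w ≠ 0 ↔ v ≠ 0 ∧ w ≠ 0) := by
    intro n v w hv hw
    constructor
    · intro h0
      refine ⟨fun h1 => h0 ?_, fun h1 => h0 ?_⟩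
      · rw [h1, TensorProduct.zero_tmul]
      · rw [h1, TensorProduct.tmul_zero]
    · rintro ⟨h1, h2⟩ h0
      have h3 := hχ n v w
      rw [h0, map_zero, eq_comm, mul_eq_zero] at h3
      rcases h3 with h3 | h3
      · exact h1 (by rw [h.eq_smul hv, h3, zero_smul])
      · exact h2 (by rw [h'.eq_smul hw, h3, zero_smul])
  have hC : ∀ (c : ℂ) (v : M ⊗[ℂ[X]] N), c ≠ 0 → ((C c : ℂ[X]) • v ≠ 0 ↔ v ≠ 0) := by
    intro c v hc
    refine not_congr ⟨fun h0 => ?_, fun h0 => by rw [h0, smul_zero]⟩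
    have := congrArg (fun u => (C c⁻¹ : ℂ[X]) • u) h0
    simpa only [smul_smul, ← C_mul, inv_mul_cancel₀ hc, C_1, one_smul, smul_zero] using this
  refine ⟨fun n => a.equiv (x n ⊗ₜ y n), fun n => (χ n).comp a.equiv.symm.toAddMonoidHom,
    ?_, ?_, ?_, ?_, ?_, ?_, ?_⟩
  · intro n
    change _ ∈ weightSpace a.toModuleCat _
    rw [mem_weightSpace, a.poly_smul_equiv, ← C_smul, a.poly_smul_equiv,
      TensorProduct.smul_tmul', TensorProduct.smul_tmul', mem_weightSpace.1 (h.mem n), C_smul]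
  · intro n p w
    obtain ⟨w, rfl⟩ := a.equiv.surjective w
    have := a.poly_smul_equiv p w
    change χ n (a.equiv.symm (p • a.equiv w)) = _
    rw [this]
    exact hχp n p w
  · intro n hn
    change χ n (x n ⊗ₜ y n) = 1
    rw [hχ, h.dual n hn.1, h'.dual n hn.2, mul_one]
  · intro n hn
    have hn' : x n ⊗ₜ[ℂ[X]] y n = 0 := by
      rw [Set.mem_inter_iff, not_and_or] at hn
      rcases hn with hn | hn
      · rw [h.eq_zero n hn, TensorProduct.zero_tmul]
      · rw [h'.eq_zero n hn, TensorProduct.tmul_zero]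
    rw [hn', map_zero]
    rfl
  · rw [Submodule.eq_top_iff']
    intro w
    obtain ⟨w, rfl⟩ := a.equiv.surjective w
    -- For `m ≠ n` the tensor vanishes, since `z` acts on it both by `m` and by `n`.
    have key : ∀ m n, a.equiv (x m ⊗ₜ y n) ∈ Submodule.span ℂ[X]
        (Set.range fun n => a.equiv (x n ⊗ₜ y n)) := by
      intro m n
      by_cases hmn : m = n
      · subst hmn
        exact Submodule.subset_span ⟨m, rfl⟩
      · have h1 : (X : ℂ[X]) • (x m ⊗ₜ[ℂ[X]] y n) = (C (m : ℂ) : ℂ[X]) • (x m ⊗ₜ[ℂ[X]] y n) := by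
          rw [TensorProduct.smul_tmul', TensorProduct.smul_tmul', mem_weightSpace.1 (h.mem m),
            C_smul]
        have h2 : (X : ℂ[X]) • (x m ⊗ₜ[ℂ[X]] y n) = (C (n : ℂ) : ℂ[X]) • (x m ⊗ₜ[ℂ[X]] y n) := by
          rw [← TensorProduct.tmul_smul, ← TensorProduct.tmul_smul, mem_weightSpace.1 (h'.mem n),
            C_smul]
        have h3 : (x m ⊗ₜ[ℂ[X]] y n) = 0 := by
          by_contra h0
          rw [h1, ← sub_eq_zero, ← sub_smul, ← C_sub] at h2
          exact (hC _ _ (sub_ne_zero.2 (by exact_mod_cast hmn))).2 h0 h2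
        rw [h3, map_zero]
        exact zero_mem _
    induction w with
    | zero => rw [map_zero]; exact zero_mem _
    | add v w hv hw => rw [map_add]; exact add_mem hv hw
    | tmul v w =>
      have hv : v ∈ Submodule.span ℂ[X] (Set.range x) := h.span ▸ Submodule.mem_top
      have hw : w ∈ Submodule.span ℂ[X] (Set.range y) := h'.span ▸ Submodule.mem_top
      induction hv using Submodule.span_induction with
      | mem v hv =>
        obtain ⟨m, rfl⟩ := hv
        induction hw using Submodule.span_induction with
        | mem w hw =>
          obtain ⟨n, rfl⟩ := hw
          exact key m n
        | zero => rw [TensorProduct.tmul_zero, map_zero]; exact zero_mem _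
        | add w w' _ _ hw hw' => rw [TensorProduct.tmul_add, map_add]; exact add_mem hw hw'
        | smul p w _ hw =>
          rw [TensorProduct.tmul_smul, ← a.poly_smul_equiv]
          exact Submodule.smul_mem _ _ hw
      | zero => rw [TensorProduct.zero_tmul, map_zero]; exact zero_mem _
      | add v v' _ _ hv hv' => rw [TensorProduct.add_tmul, map_add]; exact add_mem hv hv'
      | smul p v _ hv =>
        rw [← TensorProduct.smul_tmul', ← a.poly_smul_equiv]
        exact Submodule.smul_mem _ _ hv
  · intro n
    change _ ↔ (GWA.xp (s * t) • a.equiv (x n ⊗ₜ y n) : a.toModuleCat) ≠ 0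
    rw [a.xp_smul_equiv, AddEquiv.map_ne_zero_iff]
    change _ ↔ (GWA.xp s • x n) ⊗ₜ[ℂ[X]] (GWA.xp t • y n) ≠ 0
    rw [Set.mem_inter_iff, h.up, h'.up, hne (n + 1)]
    · push_cast
      exact xp_mem (h.mem n)
    · push_cast
      exact xp_mem (h'.mem n)
  · intro n
    change _ ↔ (GWA.xm (s * t) • a.equiv (x (n + 1) ⊗ₜ y (n + 1)) : a.toModuleCat) ≠ 0
    rw [a.xm_smul_equiv, AddEquiv.map_ne_zero_iff]
    change _ ↔ (GWA.xm s • x (n + 1)) ⊗ₜ[ℂ[X]] (GWA.xm t • y (n + 1)) ≠ 0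
    rw [Set.mem_inter_iff, h.down, h'.down, hne n]
    · have := xm_mem (h.mem (n + 1))
      push_cast at this
      rwa [add_sub_cancel_right] at this
    · have := xm_mem (h'.mem (n + 1))
      push_cast at this
      rwa [add_sub_cancel_right] at this

/-! ### Strings in weight modules -/

/-- The coefficient of `X⁺` at a point with the given value of a directed subset. -/
def upC : Membership → ℂ
  | Membership.zero => 0
  | Membership.one => 1
  | Membership.right => 1
  | Membership.left => 0

/-- The coefficient of `X⁻` at a point with the given value of a directed subset, where `t` has the
value `c`. -/
def downC (c : ℂ) : Membership → ℂ
  | Membership.zero => 0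
  | Membership.one => c
  | Membership.right => 0
  | Membership.left => 1

section Linear

variable {V : Type u} [AddCommGroup V] [Module ℂ V]

/-- Weight spaces `W n` with operators `p : W n → W (n + 1)` and `q : W (n + 1) → W n` whose
products are multiplication by `τ n`. -/
structure IsRep (W : ℤ → Submodule ℂ V) (p q : V →ₗ[ℂ] V) (τ : ℤ → ℂ) : Prop where
  p_mem : ∀ n, ∀ v ∈ W n, p v ∈ W (n + 1)
  q_mem : ∀ n, ∀ v ∈ W (n + 1), q v ∈ W n
  qp : ∀ n, ∀ v ∈ W n, q (p v) = τ n • v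
  pq : ∀ n, ∀ v ∈ W (n + 1), p (q v) = τ n • v

/-- The vectors `x n, x (n + 1)` span a string, and the functionals `φ n, φ (n + 1)` a dual string,
with an edge of type `s n` between `n` and `n + 1`. -/
structure Link (W : ℤ → Submodule ℂ V) (p q : V →ₗ[ℂ] V) (τ : ℤ → ℂ) (x : ℤ → V)
    (φ : ℤ → V →ₗ[ℂ] ℂ) (s : ℤ → Membership) (n : ℤ) : Prop where
  up : p (x n) = upC (s n) • x (n + 1)
  down : q (x (n + 1)) = downC (τ n) (s n) • x n
  dual_up : ∀ y ∈ W n, φ (n + 1) (p y) = upC (s n) * φ n y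
  dual_down : ∀ y ∈ W (n + 1), φ n (q y) = downC (τ n) (s n) * φ (n + 1) y
  state : x n ≠ 0 → x (n + 1) ≠ 0 →
    (τ n = 0 ∧ (s n = Membership.right ∨ s n = Membership.left)) ∨ (τ n ≠ 0 ∧ s n = Membership.one)

/-- The vector `x n` has weight `n`, and is either dual to `φ n` or zero. -/
structure Node (W : ℤ → Submodule ℂ V) (x : ℤ → V) (φ : ℤ → V →ₗ[ℂ] ℂ) (n : ℤ) : Prop where
  mem : x n ∈ W n
  dual : x n ≠ 0 → φ n (x n) = 1
  zero : x n = 0 → φ n = 0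

/-- A string starting at `n`, with its dual string. -/
structure IsRightString (W : ℤ → Submodule ℂ V) (p q : V →ₗ[ℂ] V) (τ : ℤ → ℂ) (n : ℤ) (x : ℤ → V)
    (φ : ℤ → V →ₗ[ℂ] ℂ) (s : ℤ → Membership) : Prop where
  node : ∀ m, n ≤ m → Node W x φ m
  link : ∀ m, n ≤ m → Link W p q τ x φ s m
  interval : (∀ m, n ≤ m → x m ≠ 0) ∨ ∃ e, n ≤ e ∧ τ e = 0 ∧ ∀ m, n ≤ m → (x m ≠ 0 ↔ m ≤ e)

/-- The functional `f` kills the kernel of `E → V ⧸ A`, hence over a field it is pulled back from a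
functional on `V ⧸ A`. This is how a dual string is continued against the direction of an arrow. -/
theorem exists_functional {E : Type v} [AddCommGroup E] [Module ℂ E] (g : E →ₗ[ℂ] V)
    (A : Submodule ℂ V) (f : E →ₗ[ℂ] ℂ) (h : ∀ y, g y ∈ A → f y = 0) :
    ∃ ψ : V →ₗ[ℂ] ℂ, (∀ y, ψ (g y) = f y) ∧ ∀ a ∈ A, ψ a = 0 := by
  have h1 : f ∈ (LinearMap.ker (A.mkQ ∘ₗ g)).dualAnnihilator := by
    rw [Submodule.mem_dualAnnihilator]
    intro y hy
    apply h
    simpa using hy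
  rw [← LinearMap.range_dualMap_eq_dualAnnihilator_ker] at h1
  obtain ⟨ψ, rfl⟩ := h1
  refine ⟨ψ ∘ₗ A.mkQ, fun y => rfl, fun a ha => ?_⟩
  rw [LinearMap.comp_apply, Submodule.mkQ_apply, (Submodule.Quotient.mk_eq_zero A).2 ha, map_zero]

theorem exists_functional_of_notMem {A : Submodule ℂ V} {b : V} (hb : b ∉ A) :
    ∃ ψ : V →ₗ[ℂ] ℂ, ψ b = 1 ∧ ∀ a ∈ A, ψ a = 0 := by
  obtain ⟨ψ, h1, h2⟩ := exists_functional (LinearMap.toSpanSingleton ℂ V b) A LinearMap.id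
    (fun c hc => by
      by_contra h0
      rw [LinearMap.id_apply] at h0
      exact hb ((Submodule.smul_mem_iff A h0).1 hc))
  exact ⟨ψ, by simpa using h1 1, h2⟩

variable {W : ℤ → Submodule ℂ V} {p q : V →ₗ[ℂ] V} {τ : ℤ → ℂ}

/-- All conditions at indices from `n + 1` on are untouched by the change at `n`, and the right end
is inherited, so only the new node and the link between `n` and `n + 1` matter. -/
theorem IsRightString.prepend {n : ℤ} {x : ℤ → V} {φ : ℤ → V →ₗ[ℂ] ℂ} {s : ℤ → Membership}
    (h : IsRightString W p q τ (n + 1) x φ s) (x₀ : V) (φ₀ : V →ₗ[ℂ] ℂ)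
    (s₀ : Membership) (hmem : x₀ ∈ W n) (hdual : φ₀ x₀ = 1)
    (hl : Link W p q τ (Function.update x n x₀) (Function.update φ n φ₀) (Function.update s n s₀) n) :
    IsRightString W p q τ n (Function.update x n x₀) (Function.update φ n φ₀)
      (Function.update s n s₀) := by
  have hx₀ : x₀ ≠ 0 := by
    rintro rfl
    rw [map_zero] at hdual
    exact zero_ne_one hdual
  have hx : ∀ m, n + 1 ≤ m → Function.update x n x₀ m = x m :=
    fun m hm => Function.update_of_ne (by omega) _ _
  have hφ : ∀ m, n + 1 ≤ m → Function.update φ n φ₀ m = φ m :=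
    fun m hm => Function.update_of_ne (by omega) _ _
  have hs : ∀ m, n + 1 ≤ m → Function.update s n s₀ m = s m :=
    fun m hm => Function.update_of_ne (by omega) _ _
  refine ⟨fun m hm => ?_, fun m hm => ?_, ?_⟩
  · rcases eq_or_lt_of_le hm with rfl | hm
    · refine ⟨?_, ?_, ?_⟩
      · rwa [Function.update_self]
      · rw [Function.update_self, Function.update_self]
        exact fun _ => hdual
      · rw [Function.update_self]
        exact fun h => absurd h hx₀
    · have := h.node m hm
      refine ⟨?_, ?_, ?_⟩
      · rw [hx m hm]
        exact this.mem
      · rw [hx m hm, hφ m hm]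
        exact this.dual
      · rw [hx m hm, hφ m hm]
        exact this.zero
  · rcases eq_or_lt_of_le hm with rfl | hm
    · exact hl
    · have := h.link m hm
      have hm' : n + 1 ≤ m + 1 := by omega
      refine ⟨?_, ?_, ?_, ?_, ?_⟩
      · rw [hx m hm, hx _ hm', hs m hm]
        exact this.up
      · rw [hx m hm, hx _ hm', hs m hm]
        exact this.down
      · rw [hφ m hm, hφ _ hm', hs m hm]
        exact this.dual_up
      · rw [hφ m hm, hφ _ hm', hs m hm]
        exact this.dual_down
      · rw [hx m hm, hx _ hm', hs m hm]
        exact this.state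
  · rcases h.interval with hi | ⟨e, he, hτ, hi⟩
    · left
      intro m hm
      rcases eq_or_lt_of_le hm with rfl | hm
      · rwa [Function.update_self]
      · rw [hx m hm]
        exact hi m hm
    · right
      refine ⟨e, by omega, hτ, fun m hm => ?_⟩
      rcases eq_or_lt_of_le hm with rfl | hm
      · rw [Function.update_self]
        exact ⟨fun _ => by omega, fun _ => hx₀⟩
      · rw [hx m hm]
        exact hi m hm

/-- A string with only edges of type `one` to the right of a point beyond which `τ` has no zeros. -/
theorem exists_rightString_base (hW : IsRep W p q τ) {n : ℤ} (hτ : ∀ m, n ≤ m → τ m ≠ 0)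
    {A B : Submodule ℂ V} (hB : B ≤ W n) (h : ¬ B ≤ A) :
    ∃ x φ s, IsRightString W p q τ n x φ s ∧ x n ∈ B ∧ x n ≠ 0 ∧ ∀ a ∈ A, φ n a = 0 := by
  obtain ⟨b, hbB, hbA⟩ := SetLike.not_le_iff_exists.1 h
  obtain ⟨ψ, hψb, hψA⟩ := exists_functional_of_notMem hbA
  -- To the right of `n` all `τ m` are invertible, so vectors are carried along by `p` and
  -- functionals by `q` divided by `τ`, which keeps the pairing equal to `1`.
  let xs : ℕ → V := fun k => Nat.rec b (fun _ v => p v) k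
  let φs : ℕ → V →ₗ[ℂ] ℂ := fun k => Nat.rec ψ (fun k f => (τ (n + k))⁻¹ • f ∘ₗ q) k
  let x : ℤ → V := fun m => xs (m - n).toNat
  let φ : ℤ → V →ₗ[ℂ] ℂ := fun m => φs (m - n).toNat
  have hx0 : x n = b := by simp [x, xs]
  have hφ0 : φ n = ψ := by simp [φ, φs]
  have hx : ∀ m, n ≤ m → x (m + 1) = p (x m) := by
    intro m hm
    have : (m + 1 - n).toNat = (m - n).toNat + 1 := by omega
    simp only [x, this]
    rfl
  have hφ : ∀ m, n ≤ m → φ (m + 1) = (τ m)⁻¹ • φ m ∘ₗ q := by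
    intro m hm
    have h1 : (m + 1 - n).toNat = (m - n).toNat + 1 := by omega
    have h2 : n + ((m - n).toNat : ℤ) = m := by omega
    simp only [φ, h1]
    change (τ (n + ((m - n).toNat : ℤ)))⁻¹ • _ = _
    rw [h2]
  have hnode : ∀ m, n ≤ m → x m ∈ W m ∧ φ m (x m) = 1 := by
    intro m hm
    induction m, hm using Int.leInduction with
    | base => rw [hx0, hφ0]; exact ⟨hB hbB, hψb⟩
    | succ m hm ih =>
      rw [hx m hm, hφ m hm]
      refine ⟨hW.p_mem m _ ih.1, ?_⟩
      rw [LinearMap.smul_apply, LinearMap.comp_apply, hW.qp m _ ih.1, map_smul, ih.2, smul_eq_mul,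
        smul_eq_mul, mul_one, inv_mul_cancel₀ (hτ m hm)]
  have hne : ∀ m, n ≤ m → x m ≠ 0 := by
    intro m hm h0
    have := (hnode m hm).2
    rw [h0, map_zero] at this
    exact zero_ne_one this
  refine ⟨x, φ, fun _ => Membership.one, ⟨fun m hm => ?_, fun m hm => ?_, Or.inl hne⟩, ?_, ?_, ?_⟩
  · exact ⟨(hnode m hm).1, fun _ => (hnode m hm).2, fun h => absurd h (hne m hm)⟩
  · refine ⟨?_, ?_, fun y hy => ?_, fun y hy => ?_, fun _ _ => Or.inr ⟨hτ m hm, rfl⟩⟩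
    · rw [hx m hm, upC, one_smul]
    · rw [hx m hm, downC, hW.qp m _ (hnode m hm).1]
    · rw [hφ m hm, LinearMap.smul_apply, LinearMap.comp_apply, hW.qp m _ hy, map_smul, smul_eq_mul,
        smul_eq_mul, ← mul_assoc, inv_mul_cancel₀ (hτ m hm), upC]
    · rw [hφ m hm, LinearMap.smul_apply, LinearMap.comp_apply, downC, smul_eq_mul, ← mul_assoc,
        mul_inv_cancel₀ (hτ m hm), one_mul]
  · rwa [hx0]
  · exact hne n le_rfl
  · rwa [hφ0]

/-- The inductive step of a functorial filtration. If `p A < p B`, a string for this pair is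
continued to `n` by a preimage in `B`. Otherwise `τ n = 0`; if the preimages of `A` and `B` under
`q` differ, a string for them is continued to `n` by applying `q`. If they also agree, some vector
of `B` outside `A` is killed by `p` and invisible to the image of `q`, and it is a string by itself.
-/
theorem exists_rightString_step (hW : IsRep W p q τ) {n : ℤ}
    (ih : ∀ A B : Submodule ℂ V, A ≤ B → B ≤ W (n + 1) → ¬ B ≤ A →
      ∃ x φ s, IsRightString W p q τ (n + 1) x φ s ∧ x (n + 1) ∈ B ∧ x (n + 1) ≠ 0 ∧
        ∀ a ∈ A, φ (n + 1) a = 0)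
    {A B : Submodule ℂ V} (hAB : A ≤ B) (hB : B ≤ W n) (h : ¬ B ≤ A) :
    ∃ x φ s, IsRightString W p q τ n x φ s ∧ x n ∈ B ∧ x n ≠ 0 ∧ ∀ a ∈ A, φ n a = 0 := by
  by_cases h1 : B.map p ≤ A.map p
  -- If `τ n` were invertible then `p` would be injective on `W n`, and `p B ≤ p A` would give `B ≤
  -- A`.
  · have hτ : τ n = 0 := by
      by_contra hτ
      apply h
      intro b hb
      obtain ⟨a, ha, hab⟩ := h1 ⟨b, hb, rfl⟩
      have h2 := congrArg q hab
      rw [hW.qp n a (hB (hAB ha)), hW.qp n b (hB hb)] at h2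
      rwa [← smul_right_injective V hτ h2]
    by_cases h2 : (B.comap q ⊓ W (n + 1)) ≤ (A.comap q ⊓ W (n + 1))
    · obtain ⟨b, hbB, hbA⟩ := SetLike.not_le_iff_exists.1 h
      obtain ⟨a, ha, hab⟩ := h1 ⟨b, hbB, rfl⟩
      -- Subtracting `a` makes the vector a kernel vector of `p`. If it equalled `q w + a'`, then `q
      -- w` would lie in `B`, hence in `A` by `h2`, and `b` would lie in `A`.
      have hc : b - a ∉ A ⊔ (W (n + 1)).map q := by
        intro hc
        obtain ⟨a', ha', _, ⟨w, hw, rfl⟩, hsum⟩ := Submodule.mem_sup.1 hc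
        have h3 : q w = b - a - a' := by rw [← hsum]; abel
        have h4 : w ∈ A.comap q ⊓ W (n + 1) := by
          refine h2 ⟨?_, hw⟩
          rw [SetLike.mem_coe, Submodule.mem_comap, h3]
          exact sub_mem (sub_mem hbB (hAB ha)) (hAB ha')
        apply hbA
        have : b = q w + a' + a := by rw [h3]; abel
        rw [this]
        exact add_mem (add_mem h4.1 ha') ha
      obtain ⟨ψ, hψ1, hψ0⟩ := exists_functional_of_notMem hc
      have hne : b - a ≠ 0 := by
        intro h0
        rw [h0] at hc
        exact hc (zero_mem _)
      have hx : ∀ m, m ≠ n → Function.update (0 : ℤ → V) n (b - a) m = 0 :=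
        fun m hm => Function.update_of_ne hm _ _
      have hφ : ∀ m, m ≠ n → Function.update (0 : ℤ → V →ₗ[ℂ] ℂ) n ψ m = 0 :=
        fun m hm => Function.update_of_ne hm _ _
      have hn : n + 1 ≠ n := by omega
      refine ⟨Function.update 0 n (b - a), Function.update 0 n ψ, fun _ => Membership.zero,
        ⟨fun m hm => ?_, fun m hm => ?_, Or.inr ⟨n, le_rfl, hτ, fun m hm => ?_⟩⟩, ?_, ?_, ?_⟩
      · by_cases hmn : m = n
        · subst hmn
          refine ⟨?_, ?_, ?_⟩
          · rw [Function.update_self]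
            exact sub_mem (hB hbB) (hB (hAB ha))
          · rw [Function.update_self, Function.update_self]
            exact fun _ => hψ1
          · rw [Function.update_self]
            exact fun h => absurd h hne
        · refine ⟨?_, fun h => absurd (hx m hmn) h, fun _ => hφ m hmn⟩
          rw [hx m hmn]
          exact zero_mem _
      · have hm' : m + 1 ≠ n := by omega
        refine ⟨?_, ?_, ?_, ?_, fun _ h => absurd (hx _ hm') h⟩
        · rw [upC, zero_smul]
          by_cases hmn : m = n
          · subst hmn
            rw [Function.update_self, map_sub, hab, sub_self]
          · rw [hx m hmn, map_zero]
        · rw [hx _ hm', map_zero, downC, zero_smul]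
        · intro y _
          rw [hφ _ hm', upC, zero_mul, LinearMap.zero_apply]
        · intro y hy
          rw [downC, zero_mul]
          by_cases hmn : m = n
          · subst hmn
            rw [Function.update_self]
            exact hψ0 _ (Submodule.mem_sup_right ⟨y, hy, rfl⟩)
          · rw [hφ m hmn, LinearMap.zero_apply]
      · by_cases hmn : m = n
        · subst hmn
          rw [Function.update_self]
          exact ⟨fun _ => le_rfl, fun _ => hne⟩
        · exact ⟨fun h => absurd (hx m hmn) h, fun h => absurd (le_antisymm h hm) hmn⟩
      · rw [Function.update_self]
        exact sub_mem hbB (hAB ha)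
      · rwa [Function.update_self]
      · rw [Function.update_self]
        exact fun a ha => hψ0 a (Submodule.mem_sup_left ha)
    · obtain ⟨x, φ, s, hstr, hxB, hx0, hφA⟩ := ih _ _
        (inf_le_inf_right _ (Submodule.comap_mono hAB)) inf_le_right h2
      -- The condition `ψ ∘ q = φ (n + 1)` on `W (n + 1)` is compatible with `ψ` vanishing on `A`,
      -- because `φ (n + 1)` already vanishes on the preimage of `A` under `q`.
      obtain ⟨ψ, hψq, hψA⟩ := exists_functional (q ∘ₗ (W (n + 1)).subtype) A
        (φ (n + 1) ∘ₗ (W (n + 1)).subtype) (fun y hy => hφA _ ⟨hy, y.2⟩)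
      have hψ : ∀ y ∈ W (n + 1), ψ (q y) = φ (n + 1) y := fun y hy => hψq ⟨y, hy⟩
      have hn : n + 1 ≠ n := by omega
      have hd : ψ (q (x (n + 1))) = 1 := by
        rw [hψ _ hxB.2]
        exact (hstr.node _ le_rfl).dual hx0
      have hqx : q (x (n + 1)) ∈ W n := hW.q_mem n _ hxB.2
      refine ⟨_, _, _, hstr.prepend (q (x (n + 1))) ψ Membership.left hqx hd ?_, ?_, ?_, ?_⟩
      · refine ⟨?_, ?_, ?_, ?_, fun _ _ => Or.inl ⟨hτ, Or.inr (Function.update_self ..)⟩⟩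
        · rw [Function.update_self, Function.update_self, hW.pq n _ hxB.2, hτ, upC, zero_smul,
            zero_smul]
        · rw [Function.update_self, Function.update_self, Function.update_of_ne hn, downC, one_smul]
        · intro y hy
          rw [Function.update_self, Function.update_of_ne hn, upC, zero_mul]
          -- As `q (p y) = τ n • y = 0` lies in `A`, the vector `p y` is in the preimage of `A`,
          -- where `φ (n + 1)` vanishes.
          refine hφA _ ⟨?_, hW.p_mem n y hy⟩
          rw [SetLike.mem_coe, Submodule.mem_comap, hW.qp n y hy, hτ, zero_smul]
          exact zero_mem _
        · intro y hy
          rw [Function.update_self, Function.update_self, Function.update_of_ne hn, downC, one_mul,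
            hψ y hy]
      · rw [Function.update_self]
        exact hxB.1
      · rw [Function.update_self]
        intro h0
        rw [h0, map_zero] at hd
        exact zero_ne_one hd
      · rwa [Function.update_self]
  · obtain ⟨x, φ, s, hstr, hxB, hx0, hφA⟩ := ih _ _ (Submodule.map_mono hAB)
      (Submodule.map_le_iff_le_comap.2 fun b hb => hW.p_mem n b (hB hb)) h1
    obtain ⟨b, hb, hbx⟩ := hxB
    have hn : n + 1 ≠ n := by omega
    have hd : (φ (n + 1) ∘ₗ p) b = 1 := by
      rw [LinearMap.comp_apply, hbx]
      exact (hstr.node _ le_rfl).dual hx0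
    classical
    -- At a root the arrow `X⁺` is used, and the coefficient of `X⁻` is zero, which is also the
    -- value of `τ n`; so both cases are covered by coefficients `1` and `τ n`.
    set s₀ : Membership := if τ n = 0 then Membership.right else Membership.one with hs₀
    have hup : upC s₀ = 1 := by
      rw [hs₀]
      split_ifs <;> rfl
    have hdown : downC (τ n) s₀ = τ n := by
      rw [hs₀]
      split_ifs with h
      · rw [downC, h]
      · rfl
    refine ⟨_, _, _, hstr.prepend b (φ (n + 1) ∘ₗ p) s₀ (hB hb) hd ?_, ?_, ?_, ?_⟩
    · refine ⟨?_, ?_, ?_, ?_, fun _ _ => ?_⟩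
      · rw [Function.update_self, Function.update_self, Function.update_of_ne hn, hup, one_smul, hbx]
      · rw [Function.update_self, Function.update_self, Function.update_of_ne hn, hdown, ← hbx,
          hW.qp n b (hB hb)]
      · intro y hy
        rw [Function.update_self, Function.update_self, Function.update_of_ne hn, hup, one_mul,
          LinearMap.comp_apply]
      · intro y hy
        rw [Function.update_self, Function.update_self, Function.update_of_ne hn, hdown,
          LinearMap.comp_apply, hW.pq n y hy, map_smul, smul_eq_mul]
      · rw [Function.update_self, hs₀]
        by_cases h : τ n = 0
        · exact Or.inl ⟨h, Or.inl (if_pos h)⟩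
        · exact Or.inr ⟨h, if_neg h⟩
    · rwa [Function.update_self]
    · rw [Function.update_self]
      rintro rfl
      rw [map_zero] at hd
      exact zero_ne_one hd
    · rw [Function.update_self]
      exact fun a ha => hφA _ ⟨a, ha, rfl⟩

/-- Given `A < B ≤ W n`, there are a string starting in `B` and a dual string that vanishes on
`A`. -/
theorem exists_rightString (hW : IsRep W p q τ) {N : ℤ} (hN : ∀ m, N ≤ m → τ m ≠ 0) (n : ℤ)
    {A B : Submodule ℂ V} (hAB : A ≤ B) (hB : B ≤ W n) (h : ¬ B ≤ A) :
    ∃ x φ s, IsRightString W p q τ n x φ s ∧ x n ∈ B ∧ x n ≠ 0 ∧ ∀ a ∈ A, φ n a = 0 := by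
  rcases le_total N n with hn | hn
  · exact exists_rightString_base hW (fun m hm => hN m (hn.trans hm)) hB h
  · obtain ⟨k, rfl⟩ : ∃ k : ℕ, n = N - k := ⟨(N - n).toNat, by omega⟩
    clear hn
    -- The pair of subspaces changes with the weight, so the induction runs over all pairs.
    induction k generalizing A B with
    | zero => exact exists_rightString_base hW (fun m hm => hN m (by simpa using hm)) hB h
    | succ k ih =>
      refine exists_rightString_step hW (fun A' B' h1 h2 h3 => ?_) hAB hB h
      have hk : N - ((k + 1 : ℕ) : ℤ) + 1 = N - (k : ℤ) := by push_cast; ring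
      rw [hk] at h2 ⊢
      exact ih h1 h3 h2

/-- A string with its dual string. -/
structure IsString (W : ℤ → Submodule ℂ V) (p q : V →ₗ[ℂ] V) (τ : ℤ → ℂ) (n : ℤ) (x : ℤ → V)
    (φ : ℤ → V →ₗ[ℂ] ℂ) (s : ℤ → Membership) : Prop where
  node : ∀ m, Node W x φ m
  link : ∀ m, Link W p q τ x φ s m
  right : (∀ m, n ≤ m → x m ≠ 0) ∨ ∃ e, n ≤ e ∧ τ e = 0 ∧ ∀ m, n ≤ m → (x m ≠ 0 ↔ m ≤ e)
  left : (∀ m, m ≤ n → x m ≠ 0) ∨ ∃ e, e < n ∧ τ e = 0 ∧ ∀ m, m ≤ n → (x m ≠ 0 ↔ e < m)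
  ne_zero : x n ≠ 0

/-- Gluing a string to the right of `n` to a string to the left of `n`. -/
theorem IsRightString.extend {n : ℤ} {x y : ℤ → V} {φ ψ : ℤ → V →ₗ[ℂ] ℂ} {s r : ℤ → Membership}
    (h : IsRightString W p q τ n x φ s) (h0 : x n ≠ 0) (hy : y n = x n) (hψ : ψ n = φ n)
    (hnode : ∀ m, m < n → Node W y ψ m) (hlink : ∀ m, m < n → Link W p q τ y ψ r m)
    (hleft : (∀ m, m ≤ n → y m ≠ 0) ∨ ∃ e, e < n ∧ τ e = 0 ∧ ∀ m, m ≤ n → (y m ≠ 0 ↔ e < m)) :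
    ∃ x φ s, IsString W p q τ n x φ s := by
  set x' : ℤ → V := fun m => if n ≤ m then x m else y m
  set φ' : ℤ → V →ₗ[ℂ] ℂ := fun m => if n ≤ m then φ m else ψ m
  set s' : ℤ → Membership := fun m => if n ≤ m then s m else r m
  have hx : ∀ m, n ≤ m → x' m = x m := fun m hm => if_pos hm
  have hφ : ∀ m, n ≤ m → φ' m = φ m := fun m hm => if_pos hm
  have hs : ∀ m, n ≤ m → s' m = s m := fun m hm => if_pos hm
  have hx' : ∀ m, m ≤ n → x' m = y m := by
    intro m hm
    rcases eq_or_lt_of_le hm with rfl | hm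
    · rw [hx _ le_rfl, hy]
    · exact if_neg (not_le.2 hm)
  have hφ' : ∀ m, m ≤ n → φ' m = ψ m := by
    intro m hm
    rcases eq_or_lt_of_le hm with rfl | hm
    · rw [hφ _ le_rfl, hψ]
    · exact if_neg (not_le.2 hm)
  have hs' : ∀ m, m < n → s' m = r m := fun m hm => if_neg (not_le.2 hm)
  refine ⟨x', φ', s', fun m => ?_, fun m => ?_, ?_, ?_, ?_⟩
  · rcases le_or_gt n m with hm | hm
    · have := h.node m hm
      refine ⟨?_, ?_, ?_⟩
      · rw [hx m hm]
        exact this.mem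
      · rw [hx m hm, hφ m hm]
        exact this.dual
      · rw [hx m hm, hφ m hm]
        exact this.zero
    · have := hnode m hm
      refine ⟨?_, ?_, ?_⟩
      · rw [hx' m hm.le]
        exact this.mem
      · rw [hx' m hm.le, hφ' m hm.le]
        exact this.dual
      · rw [hx' m hm.le, hφ' m hm.le]
        exact this.zero
  · rcases le_or_gt n m with hm | hm
    · have := h.link m hm
      have hm' : n ≤ m + 1 := by omega
      refine ⟨?_, ?_, ?_, ?_, ?_⟩
      · rw [hx m hm, hx _ hm', hs m hm]
        exact this.up
      · rw [hx m hm, hx _ hm', hs m hm]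
        exact this.down
      · rw [hφ m hm, hφ _ hm', hs m hm]
        exact this.dual_up
      · rw [hφ m hm, hφ _ hm', hs m hm]
        exact this.dual_down
      · rw [hx m hm, hx _ hm', hs m hm]
        exact this.state
    · have := hlink m hm
      have hm' : m + 1 ≤ n := by omega
      refine ⟨?_, ?_, ?_, ?_, ?_⟩
      · rw [hx' m hm.le, hx' _ hm', hs' m hm]
        exact this.up
      · rw [hx' m hm.le, hx' _ hm', hs' m hm]
        exact this.down
      · rw [hφ' m hm.le, hφ' _ hm', hs' m hm]
        exact this.dual_up
      · rw [hφ' m hm.le, hφ' _ hm', hs' m hm]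
        exact this.dual_down
      · rw [hx' m hm.le, hx' _ hm', hs' m hm]
        exact this.state
  · rcases h.interval with hi | ⟨e, he, hτ, hi⟩
    · exact Or.inl fun m hm => by rw [hx m hm]; exact hi m hm
    · exact Or.inr ⟨e, he, hτ, fun m hm => by rw [hx m hm]; exact hi m hm⟩
  · rcases hleft with hi | ⟨e, he, hτ, hi⟩
    · exact Or.inl fun m hm => by rw [hx' m hm]; exact hi m hm
    · exact Or.inr ⟨e, he, hτ, fun m hm => by rw [hx' m hm]; exact hi m hm⟩
  · rwa [hx n le_rfl]

/-- To the left of `n` the scalars `τ m` are invertible: vectors continue by `q` divided by `τ`,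
functionals by composition with `p`, and all new edges are undirected. -/
theorem IsRightString.extend_unbounded (hW : IsRep W p q τ) {n : ℤ} (hτ : ∀ m, m < n → τ m ≠ 0)
    {x : ℤ → V} {φ : ℤ → V →ₗ[ℂ] ℂ} {s : ℤ → Membership} (h : IsRightString W p q τ n x φ s)
    (h0 : x n ≠ 0) : ∃ x φ s, IsString W p q τ n x φ s := by
  let ys : ℕ → V := fun k => Nat.rec (x n) (fun k v => (τ (n - (k + 1 : ℕ)))⁻¹ • q v) k
  let ψs : ℕ → V →ₗ[ℂ] ℂ := fun k => Nat.rec (φ n) (fun _ f => f ∘ₗ p) k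
  let y : ℤ → V := fun m => ys (n - m).toNat
  let ψ : ℤ → V →ₗ[ℂ] ℂ := fun m => ψs (n - m).toNat
  have hy0 : y n = x n := by simp [y, ys]
  have hψ0 : ψ n = φ n := by simp [ψ, ψs]
  have hy : ∀ m, m < n → y m = (τ m)⁻¹ • q (y (m + 1)) := by
    intro m hm
    have h1 : (n - m).toNat = (n - (m + 1)).toNat + 1 := by omega
    have h2 : n - (((n - (m + 1)).toNat + 1 : ℕ) : ℤ) = m := by omega
    simp only [y, h1]
    change (τ (n - (((n - (m + 1)).toNat + 1 : ℕ) : ℤ)))⁻¹ • _ = _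
    rw [h2]
  have hψ : ∀ m, m < n → ψ m = ψ (m + 1) ∘ₗ p := by
    intro m hm
    have h1 : (n - m).toNat = (n - (m + 1)).toNat + 1 := by omega
    simp only [ψ, h1]
    rfl
  have hnode : ∀ m, m ≤ n → y m ∈ W m ∧ ψ m (y m) = 1 := by
    intro m hm
    induction m, hm using Int.leInductionDown with
    | base =>
      rw [hy0, hψ0]
      exact ⟨(h.node n le_rfl).mem, (h.node n le_rfl).dual h0⟩
    | pred m hm ih =>
      have hm' : m - 1 < n := by omega
      rw [hψ _ hm', hy _ hm', sub_add_cancel]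
      have ih' := ih
      rw [← sub_add_cancel m 1] at ih'
      have hq := hW.q_mem _ _ ih'.1
      have hpq := hW.pq _ _ ih'.1
      rw [sub_add_cancel] at hq hpq
      refine ⟨Submodule.smul_mem _ _ hq, ?_⟩
      rw [LinearMap.comp_apply, map_smul, hpq, smul_smul, inv_mul_cancel₀ (hτ _ hm'), one_smul]
      exact ih.2
  have hne : ∀ m, m ≤ n → y m ≠ 0 := by
    intro m hm h0
    have := (hnode m hm).2
    rw [h0, map_zero] at this
    exact zero_ne_one this
  refine h.extend h0 (r := fun _ => Membership.one) hy0 hψ0 (fun m hm => ?_) (fun m hm => ?_)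
    (Or.inl hne)
  · exact ⟨(hnode m hm.le).1, fun _ => (hnode m hm.le).2, fun h => absurd h (hne m hm.le)⟩
  · have hm' : m + 1 ≤ n := by omega
    refine ⟨?_, ?_, fun v hv => ?_, fun v hv => ?_, fun _ _ => Or.inr ⟨hτ m hm, rfl⟩⟩
    · rw [hy m hm, map_smul, hW.pq m _ (hnode _ hm').1, smul_smul, inv_mul_cancel₀ (hτ m hm), upC]
    · rw [hy m hm, downC, smul_smul, mul_inv_cancel₀ (hτ m hm), one_smul]
    · rw [hψ m hm, upC, one_mul, LinearMap.comp_apply]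
    · rw [hψ m hm, LinearMap.comp_apply, hW.pq m v hv, map_smul, downC, smul_eq_mul]

/-- Extension by zero works because the link from `n - 1` to `n` passes through `W (n - 1) = ⊥`: `q
(x n)` is zero there, and `p` has nothing to act on. -/
theorem IsRightString.extend_bounded {n : ℤ} (hτ : τ (n - 1) = 0) (hbot : W (n - 1) = ⊥)
    (hW : IsRep W p q τ) {x : ℤ → V} {φ : ℤ → V →ₗ[ℂ] ℂ} {s : ℤ → Membership}
    (h : IsRightString W p q τ n x φ s) (h0 : x n ≠ 0) : ∃ x φ s, IsString W p q τ n x φ s := by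
  have hx : ∀ m, m ≠ n → Function.update (0 : ℤ → V) n (x n) m = 0 :=
    fun m hm => Function.update_of_ne hm _ _
  have hφ : ∀ m, m ≠ n → Function.update (0 : ℤ → V →ₗ[ℂ] ℂ) n (φ n) m = 0 :=
    fun m hm => Function.update_of_ne hm _ _
  have hzero : ∀ v ∈ W (n - 1), v = 0 := fun v hv => by
    rw [hbot] at hv
    exact (Submodule.mem_bot ℂ).1 hv
  refine h.extend h0 (y := Function.update 0 n (x n)) (ψ := Function.update 0 n (φ n))
    (r := fun _ => Membership.zero) (Function.update_self ..) (Function.update_self ..)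
    (fun m hm => ?_) (fun m hm => ?_) (Or.inr ⟨n - 1, by omega, hτ, fun m hm => ?_⟩)
  · refine ⟨?_, fun h => absurd (hx m hm.ne) h, fun _ => hφ m hm.ne⟩
    rw [hx m hm.ne]
    exact zero_mem _
  · refine ⟨?_, ?_, fun v hv => ?_, fun v hv => ?_, fun h => absurd (hx m hm.ne) h⟩
    · rw [hx m hm.ne, map_zero, upC, zero_smul]
    · rw [downC, zero_smul]
      by_cases hmn : m + 1 = n
      · obtain rfl : m = n - 1 := by omega
        rw [sub_add_cancel, Function.update_self]
        have := hW.q_mem (n - 1) (x n)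
        rw [sub_add_cancel] at this
        exact hzero _ (this (h.node n le_rfl).mem)
      · rw [hx _ hmn, map_zero]
    · rw [upC, zero_mul]
      by_cases hmn : m + 1 = n
      · obtain rfl : m = n - 1 := by omega
        rw [hzero v hv, map_zero, map_zero]
      · rw [hφ _ hmn, LinearMap.zero_apply]
    · rw [hφ m hm.ne, downC, zero_mul, LinearMap.zero_apply]
  · by_cases hmn : m = n
    · subst hmn
      rw [Function.update_self]
      exact ⟨fun _ => by omega, fun _ => h0⟩
    · exact ⟨fun h => absurd (hx m hmn) h, fun h => absurd h (by omega)⟩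

/-- A nonzero representation contains a string with a dual string. -/
theorem exists_string (hW : IsRep W p q τ) {N N' : ℤ} (hN : ∀ m, N ≤ m → τ m ≠ 0)
    (hN' : ∀ m, m < N' → τ m ≠ 0) (hne : ∃ n, W n ≠ ⊥) : ∃ n x φ s, IsString W p q τ n x φ s := by
  have hright : ∀ n, W n ≠ ⊥ → ∃ x φ s, IsRightString W p q τ n x φ s ∧ x n ≠ 0 := by
    intro n hn
    obtain ⟨x, φ, s, h, -, h0, -⟩ := exists_rightString hW hN n (A := ⊥) (B := W n) bot_le le_rfl
      (by rwa [le_bot_iff])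
    exact ⟨x, φ, s, h, h0⟩
  -- Below `N'` there are no roots, so the spaces up to `N'` are all zero or a string can be
  -- continued from `N'` to the left indefinitely. In the first case a string is started at the
  -- least weight that occurs.
  by_cases h0 : W N' = ⊥
  · have hlow : ∀ m, m ≤ N' → W m = ⊥ := by
      intro m hm
      induction m, hm using Int.leInductionDown with
      | base => exact h0
      | pred m hm ih =>
        rw [Submodule.eq_bot_iff]
        intro v hv
        have h1 := hW.p_mem _ v hv
        rw [sub_add_cancel, ih, Submodule.mem_bot] at h1
        have h2 := hW.qp _ v hv
        rw [h1, map_zero] at h2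
        exact (smul_eq_zero.1 h2.symm).resolve_left (hN' _ (by omega))
    obtain ⟨n, hn, hmin⟩ := Int.exists_least_of_bdd (P := fun n => W n ≠ ⊥)
      ⟨N', fun m hm => by
        by_contra hc
        exact hm (hlow m (by omega))⟩ hne
    have hbot : W (n - 1) = ⊥ := by
      by_contra hc
      have := hmin _ hc
      omega
    -- On `W n` the scalar `τ (n - 1)` factors through `W (n - 1) = ⊥`, so the left end of the
    -- string sits at a root.
    have hτ : τ (n - 1) = 0 := by
      by_contra hc
      apply hn
      rw [Submodule.eq_bot_iff]
      intro v hv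
      have h1 := hW.q_mem (n - 1) v
      have h2 := hW.pq (n - 1) v
      rw [sub_add_cancel, hbot, Submodule.mem_bot] at h1
      rw [sub_add_cancel] at h2
      have h3 := h2 hv
      rw [h1 hv, map_zero] at h3
      exact (smul_eq_zero.1 h3.symm).resolve_left hc
    obtain ⟨x, φ, s, h, hx⟩ := hright n hn
    exact ⟨n, h.extend_bounded hτ hbot hW hx⟩
  · obtain ⟨x, φ, s, h, hx⟩ := hright N' h0
    exact ⟨N', h.extend_unbounded hW hN' hx⟩

end Linear

/-! ### Classification of the indecomposable weight modules -/

section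

variable {t : ℂ[X]} {M : ModuleCat.{u} (GWA t)}

theorem weight_induction (hM : IsWeightModule M) {P : M → Prop} (h0 : P 0)
    (hadd : ∀ v w, P v → P w → P (v + w)) (h : ∀ (n : ℤ), ∀ w ∈ weightSpace M n, P w) (w : M) :
    P w := by
  classical
  have hw : w ∈ ⨆ c, weightSpace M c := by
    have := hM.isInternal.submodule_iSup_eq_top
    rw [this]
    exact Submodule.mem_top
  induction hw using Submodule.iSup_induction' with
  | mem c w hw =>
    by_cases hc : weightSpace M c = ⊥
    · rw [hc, Submodule.mem_bot] at hw
      rwa [hw]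
    · obtain ⟨n, rfl⟩ := hM.integral hc
      exact h n w hw
  | zero => exact h0
  | add v w _ _ hv hw => exact hadd v w hv hw

/-- The module is the direct sum of its weight spaces, so an additive map may be prescribed on each
of them. This defines the projection onto a string. -/
theorem exists_hom (hM : IsWeightModule M) {N : Type v} [AddCommGroup N] (g : ℤ → M →+ N) :
    ∃ e : M →+ N, ∀ (n : ℤ), ∀ w ∈ weightSpace M n, e w = g n w := by
  classical
  let g' : (c : ℂ) → weightSpace M c →+ N := fun c =>
    if h : ∃ n : ℤ, (n : ℂ) = c then (g h.choose).comp (weightSpace M c).subtype.toAddMonoidHom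
    else 0
  have hi : Function.Bijective (DirectSum.coeAddMonoidHom (weightSpace M)) := by
    have := hM.isInternal
    unfold DirectSum.IsInternal at this
    convert this
  let d := AddEquiv.ofBijective _ hi
  refine ⟨(DirectSum.toAddMonoid g').comp d.symm.toAddMonoidHom, fun n w hw => ?_⟩
  have h1 : d.symm w = DirectSum.of (fun c => weightSpace M c) (n : ℂ) ⟨w, hw⟩ := by
    rw [AddEquiv.symm_apply_eq]
    exact (DirectSum.coeAddMonoidHom_of (weightSpace M) (n : ℂ) ⟨w, hw⟩).symm
  change DirectSum.toAddMonoid g' (d.symm w) = _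
  rw [h1, DirectSum.toAddMonoid_of]
  have h2 : ∃ m : ℤ, (m : ℂ) = n := ⟨n, rfl⟩
  have h3 : h2.choose = n := by exact_mod_cast h2.choose_spec
  change (if h : ∃ m : ℤ, (m : ℂ) = n then (g h.choose).comp _ else 0) _ = _
  rw [dif_pos h2, h3]
  rfl

/-- The weight space as a complex vector space. -/
def weightSub (M : ModuleCat.{u} (GWA t)) (n : ℤ) : Submodule ℂ M :=
  (weightSpace M n).restrictScalars ℂ

theorem mem_weightSub {n : ℤ} {w : M} : w ∈ weightSub M n ↔ w ∈ weightSpace M n := Iff.rfl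

/-- The link between the weights `n` and `n + 1` belongs to the midpoint `n + 1/2`: both composites
act by the value of `t` there. -/
theorem isRep_weightSub : IsRep (weightSub M) (op M (GWA.xp t)) (op M (GWA.xm t))
    (fun n => t.eval ((n : ℂ) + 1 / 2)) where
  p_mem n v hv := by
    rw [mem_weightSub, op_apply]
    push_cast
    exact xp_mem hv
  q_mem n v hv := by
    have := xm_mem (mem_weightSub.1 hv)
    push_cast at this
    rwa [add_sub_cancel_right] at this
  qp n v hv := xm_xp_of_mem hv
  pq n v hv := by
    rw [op_apply, op_apply, xp_xm_of_mem (mem_weightSub.1 hv)]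
    congr 2
    push_cast
    ring

theorem exists_eval_ne_zero (ht : t ≠ 0) :
    ∃ N : ℕ, ∀ m : ℤ, (N : ℤ) ≤ |m| → t.eval ((m : ℂ) + 1 / 2) ≠ 0 := by
  classical
  obtain ⟨R, hR⟩ := (t.roots.toFinset.image fun c : ℂ => ‖c‖).exists_le
  obtain ⟨N, hN⟩ := exists_nat_gt (R + 1)
  refine ⟨N, fun m hm h0 => ?_⟩
  have h1 : ‖(m : ℂ) + 1 / 2‖ ≤ R := hR _ (Finset.mem_image_of_mem _ (by
    rw [Multiset.mem_toFinset, mem_roots ht]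
    exact h0))
  have h2 : ‖(m : ℂ)‖ ≤ ‖(m : ℂ) + 1 / 2‖ + ‖(1 / 2 : ℂ)‖ := by
    have := norm_sub_le ((m : ℂ) + 1 / 2) (1 / 2)
    rwa [add_sub_cancel_right] at this
  have h3 : ‖(1 / 2 : ℂ)‖ = 1 / 2 := by norm_num
  rw [Complex.norm_intCast, h3] at h2
  have h4 : (N : ℝ) ≤ |(m : ℝ)| := by exact_mod_cast hm
  linarith

/-- The basis vectors `v_n ↦ x n`. -/
def sumHom (S : DirectedSubset) (x : ℤ → M) : WeightSum S →ₗ[ℂ] M :=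
  (Finsupp.linearCombination ℂ fun n : Weights S => x n : (Weights S →₀ ℂ) →ₗ[ℂ] M)

theorem sumHom_vec {S : DirectedSubset} {x : ℤ → M} (h : ∀ n ∉ weights S, x n = 0) (n : ℤ) :
    sumHom S x (vec S n) = x n := by
  by_cases hn : n ∈ weights S
  · rw [vec_of_mem hn]
    exact (Finsupp.linearCombination_single ℂ (1 : ℂ) _).trans (one_smul ℂ _)
  · rw [vec_of_notMem hn, map_zero, h n hn]

/-- A module with a basis on which `X^±` act as on the basis `v_n` of `M_S^t` is isomorphic to
`M_S^t`. -/
theorem nonempty_equiv_moduleOf {S : DirectedSubset} (hS : IsAdmissible t S) (x : ℤ → M)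
    (hmem : ∀ n : ℤ, x n ∈ weightSpace M n) (hx : ∀ n, n ∈ weights S ↔ x n ≠ 0)
    (hspan : ∀ n : ℤ, ∀ w ∈ weightSpace M n, ∃ c : ℂ, w = c • x n) (hM : IsWeightModule M)
    (hp : ∀ n ∈ weights S, GWA.xp t • x n = upCoeff S n • x (n + 1))
    (hm : ∀ n ∈ weights S, GWA.xm t • x n = downCoeff t S (n - 1) • x (n - 1)) :
    Nonempty (M ≃ₗ[GWA t] moduleOf hS) := by
  set a := moduleAction hS
  have h0 : ∀ n ∉ weights S, x n = 0 := fun n hn => by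
    rwa [hx, not_not] at hn
  have hF := sumHom_vec h0
  set F := sumHom S x
  let f : a.toModuleCat →+ M := F.toAddMonoidHom.comp a.equiv.symm.toAddMonoidHom
  have hf : ∀ w, f (a.equiv w) = F w := fun w => rfl
  have key : ∀ (g : WeightSum S →ₗ[ℂ] WeightSum S) (b : GWA t),
      (∀ n ∈ weights S, F (g (vec S n)) = b • x n) → ∀ w, F (g w) = b • F w := by
    intro g b h w
    have : F ∘ₗ g = op M b ∘ₗ F := by
      apply hom_ext_vec'
      intro n hn
      rw [LinearMap.comp_apply, LinearMap.comp_apply, op_apply, hF, h n hn]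
    exact LinearMap.congr_fun this w
  let φ : a.toModuleCat →ₗ[GWA t] M := gwaHom f
    (fun p w => by
      obtain ⟨w, rfl⟩ := a.equiv.surjective w
      rw [a.poly_smul_equiv, hf, hf, poly_smul_def]
      refine key (polyEnd S p) (GWA.poly t p) (fun n _ => ?_) w
      rw [polyEnd_vec, map_smul, hF, ← poly_smul_def, poly_smul_of_mem (hmem n)])
    (fun w => by
      obtain ⟨w, rfl⟩ := a.equiv.surjective w
      rw [a.xp_smul_equiv, hf, hf]
      refine key (raise S) (GWA.xp t) (fun n hn => ?_) w
      rw [raise_vec hn, map_smul, hF, hp n hn])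
    (fun w => by
      obtain ⟨w, rfl⟩ := a.equiv.surjective w
      rw [a.xm_smul_equiv, hf, hf]
      refine key (lower t S) (GWA.xm t) (fun n hn => ?_) w
      rw [lower_vec hn, map_smul, hF, hm n hn])
  have hφ : ∀ w, φ (a.equiv w) = F w := fun w => rfl
  have hbij : Function.Bijective φ := by
    constructor
    · have hli : LinearIndependent ℂ fun n : Weights S => x n := by
        refine Module.End.eigenvectors_linearIndependent' (op M (GWA.z t))
          (fun n : Weights S => ((n : ℤ) : ℂ)) (fun m n h => Subtype.ext (Int.cast_injective h)) _
          fun n => ?_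
        rw [Module.End.hasEigenvector_iff, Module.End.mem_eigenspace_iff, op_apply, z_smul]
        exact ⟨mem_weightSpace.1 (hmem n), (hx n).1 n.2⟩
      intro v w hvw
      obtain ⟨v, rfl⟩ := a.equiv.surjective v
      obtain ⟨w, rfl⟩ := a.equiv.surjective w
      rw [hφ, hφ] at hvw
      rw [show v = w from hli hvw]
    · intro w
      induction w using weight_induction hM with
      | h0 => exact ⟨0, map_zero φ⟩
      | hadd v w hv hw =>
        obtain ⟨v, rfl⟩ := hv
        obtain ⟨w, rfl⟩ := hw
        exact ⟨v + w, map_add φ v w⟩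
      | h n w hw =>
        obtain ⟨c, rfl⟩ := hspan n w hw
        refine ⟨a.equiv (c • vec S n), ?_⟩
        rw [hφ, map_smul, hF]
  exact ⟨(LinearEquiv.ofBijective φ hbij).symm⟩

open Classical in
/-- The directed subset with underlying set `J` and directions `s n` at the zeros `n + 1/2` of
`t`. -/
def directedOf (t : ℂ[X]) (J : Set ℝ) (s : ℤ → Membership) : DirectedSubset := fun r =>
  if r ∈ J then if t.IsRoot (r : ℂ) then s ⌊r⌋ else Membership.one else Membership.zero

theorem mid_floor (n : ℤ) : ⌊(n : ℝ) + 1 / 2⌋ = n := by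
  rw [Int.floor_eq_iff]
  constructor <;> linarith

/-- A string determines an admissible set. -/
theorem exists_admissible (ht : t.Monic)
    (hroot : ∀ c : ℂ, t.IsRoot c → ∃ k : ℝ, IsHalfInt k ∧ c = k) {W : ℤ → Submodule ℂ M}
    {p q : M →ₗ[ℂ] M} {n : ℤ} {x : ℤ → M} {φ : ℤ → M →ₗ[ℂ] ℂ} {s : ℤ → Membership}
    (h : IsString W p q (fun n => t.eval ((n : ℂ) + 1 / 2)) n x φ s) :
    ∃ S, IsAdmissible t S ∧ S.Connected ∧ (∀ m, m ∈ weights S ↔ x m ≠ 0) ∧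
      ∀ m, m ∈ weights S → m + 1 ∈ weights S → S ((m : ℝ) + 1 / 2) = s m := by
  have hcast : ∀ e : ℤ, t.eval ((e : ℂ) + 1 / 2) = 0 → t.IsRoot (((e : ℝ) + 1 / 2 : ℝ) : ℂ) := by
    intro e he
    rw [IsRoot.def]
    push_cast
    exact he
  have hlt : ∀ e m : ℤ, ((e : ℝ) + 1 / 2 < m ↔ e < m) := by
    intro e m
    constructor
    · intro h
      have : (e : ℝ) < m := by linarith
      exact_mod_cast this
    · intro h
      have : ((e + 1 : ℤ) : ℝ) ≤ m := by exact_mod_cast h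
      push_cast at this
      linarith
  have hgt : ∀ e m : ℤ, ((m : ℝ) < (e : ℝ) + 1 / 2 ↔ m ≤ e) := by
    intro e m
    constructor
    · intro h
      have : (m : ℝ) < (e + 1 : ℤ) := by push_cast; linarith
      exact Int.lt_add_one_iff.1 (by exact_mod_cast this)
    · intro h
      have : (m : ℝ) ≤ e := by exact_mod_cast h
      linarith
  -- The set of upper bounds: empty if the string does not end on the right, and otherwise the
  -- single root `e + 1/2` just after the last vector.
  obtain ⟨B, hB, hBn⟩ : ∃ B : Set ℝ, (∀ k ∈ B, t.IsRoot (k : ℂ)) ∧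
      ∀ m, n ≤ m → (x m ≠ 0 ↔ ∀ k ∈ B, (m : ℝ) < k) := by
    rcases h.right with hi | ⟨e, he, hτ, hi⟩
    · exact ⟨∅, by simp, fun m hm => by simp [hi m hm]⟩
    · refine ⟨{(e : ℝ) + 1 / 2}, ?_, fun m hm => ?_⟩
      · rintro k rfl
        exact hcast e hτ
      · rw [hi m hm]
        simp only [Set.mem_singleton_iff, forall_eq]
        exact (hgt e m).symm
  obtain ⟨A, hA, hAn⟩ : ∃ A : Set ℝ, (∀ k ∈ A, t.IsRoot (k : ℂ)) ∧
      ∀ m, m ≤ n → (x m ≠ 0 ↔ ∀ k ∈ A, k < (m : ℝ)) := by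
    rcases h.left with hi | ⟨e, he, hτ, hi⟩
    · exact ⟨∅, by simp, fun m hm => by simp [hi m hm]⟩
    · refine ⟨{(e : ℝ) + 1 / 2}, ?_, fun m hm => ?_⟩
      · rintro k rfl
        exact hcast e hτ
      · rw [hi m hm]
        simp only [Set.mem_singleton_iff, forall_eq]
        exact (hlt e m).symm
  have hA0 := (hAn n le_rfl).1 h.ne_zero
  have hB0 := (hBn n le_rfl).1 h.ne_zero
  set J : Set ℝ := (⋂ k ∈ A, Set.Ioi k) ∩ ⋂ k ∈ B, Set.Iio k with hJ
  have hJmem : ∀ r : ℝ, r ∈ J ↔ (∀ k ∈ A, k < r) ∧ ∀ k ∈ B, r < k := by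
    intro r
    simp only [hJ, Set.mem_inter_iff, Set.mem_iInter, Set.mem_Ioi, Set.mem_Iio]
  have hxJ : ∀ m : ℤ, (m : ℝ) ∈ J ↔ x m ≠ 0 := by
    intro m
    rw [hJmem]
    rcases le_total n m with hm | hm
    · rw [hBn m hm]
      have hm' : (n : ℝ) ≤ m := by exact_mod_cast hm
      exact ⟨fun h => h.2, fun h => ⟨fun k hk => (hA0 k hk).trans_le hm', h⟩⟩
    · rw [hAn m hm]
      have hm' : (m : ℝ) ≤ n := by exact_mod_cast hm
      exact ⟨fun h => h.1, fun h => ⟨h, fun k hk => hm'.trans_lt (hB0 k hk)⟩⟩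
  have hhalf : ∀ r : ℝ, t.IsRoot (r : ℂ) → ∃ m : ℤ, r = m + 1 / 2 := by
    intro r hr
    obtain ⟨k, ⟨m, rfl⟩, hk⟩ := hroot _ hr
    exact ⟨m, by exact_mod_cast hk⟩
  -- The endpoints of `J` are half-integers, so around a half-integer in `J` there is room for both
  -- neighbouring integers.
  have hmid : ∀ m : ℤ, (m : ℝ) + 1 / 2 ∈ J → (m : ℝ) ∈ J ∧ ((m + 1 : ℤ) : ℝ) ∈ J := by
    intro m hm
    rw [hJmem] at hm
    rw [hJmem, hJmem]
    refine ⟨⟨fun k hk => ?_, fun k hk => ?_⟩, fun k hk => ?_, fun k hk => ?_⟩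
    · have := hm.1 k hk
      obtain ⟨e, rfl⟩ := hhalf k (hA k hk)
      rw [hlt]
      have : (e : ℝ) < m := by linarith
      exact_mod_cast this
    · have := hm.2 k hk
      linarith
    · have := hm.1 k hk
      push_cast
      linarith
    · have := hm.2 k hk
      obtain ⟨e, rfl⟩ := hhalf k (hB k hk)
      rw [hgt]
      have : (m : ℝ) < e := by linarith
      exact_mod_cast this
  set S := directedOf t J s with hS
  -- Both neighbours of a root in `J` carry nonzero vectors of the string, so the link across the
  -- root is directed.
  have hdir : ∀ r, r ∈ J → t.IsRoot (r : ℂ) → S.IsDirectedAt r := by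
    intro r hr ht'
    have h1 : S r = s ⌊r⌋ := by rw [hS, directedOf, if_pos hr, if_pos ht']
    obtain ⟨m, rfl⟩ := hhalf r ht'
    obtain ⟨h2, h3⟩ := hmid m hr
    rw [hxJ] at h2 h3
    rw [DirectedSubset.IsDirectedAt, h1, mid_floor]
    rcases (h.link m).state h2 h3 with ⟨-, h4⟩ | ⟨h4, -⟩
    · exact h4
    · rw [IsRoot.def] at ht'
      push_cast at ht'
      exact absurd ht' h4
  have hund : S.underlying = J := by
    ext r
    rw [DirectedSubset.underlying, Set.mem_ofPred_eq]
    constructor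
    · intro h1
      by_contra h2
      exact h1 (by rw [hS, directedOf, if_neg h2])
    · intro h1
      by_cases h2 : t.IsRoot (r : ℂ)
      · rcases hdir r h1 h2 with h3 | h3 <;> rw [h3] <;> simp
      · rw [hS, directedOf, if_pos h1, if_neg h2]
        simp
  have hw : ∀ m, m ∈ weights S ↔ x m ≠ 0 := by
    intro m
    rw [weights, Set.mem_ofPred_eq, hund, hxJ]
  refine ⟨S, ⟨ht, hroot, ⟨A, B, hA, hB, hund⟩, fun r => ⟨fun h1 => ?_, fun h1 => ?_⟩⟩, ?_, hw, ?_⟩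
  · rw [hund]
    have hrJ : r ∈ J := by
      by_contra h2
      have : S r = Membership.zero := by rw [hS, directedOf, if_neg h2]
      rcases h1 with h1 | h1 <;> rw [h1] at this <;> cases this
    refine ⟨hrJ, ?_⟩
    by_contra h2
    have : S r = Membership.one := by rw [hS, directedOf, if_pos hrJ, if_neg h2]
    rcases h1 with h1 | h1 <;> rw [h1] at this <;> cases this
  · rw [hund] at h1
    exact hdir r h1.1 h1.2
  · rw [DirectedSubset.Connected, hund]
    refine ⟨⟨n, (hxJ n).2 h.ne_zero⟩, Set.OrdConnected.isPreconnected ⟨fun a ha b hb c hc => ?_⟩⟩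
    rw [hJmem] at ha hb ⊢
    exact ⟨fun k hk => (ha.1 k hk).trans_le hc.1, fun k hk => hc.2.trans_lt (hb.2 k hk)⟩
  · intro m h1 h2
    rw [weights, Set.mem_ofPred_eq, hund] at h1 h2
    have hm : (m : ℝ) + 1 / 2 ∈ J := by
      rw [hJmem] at h1 h2 ⊢
      push_cast at h2
      exact ⟨fun k hk => by linarith [h1.1 k hk], fun k hk => by linarith [h2.2 k hk]⟩
    rw [hxJ] at h1 h2
    rcases (h.link m).state h1 h2 with ⟨h3, -⟩ | ⟨h3, h4⟩
    · rw [hS, directedOf, if_pos hm, if_pos (hcast m h3), mid_floor]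
    · rw [hS, directedOf, if_pos hm, if_neg, h4]
      rw [IsRoot.def]
      push_cast
      exact h3

/-- Every indecomposable weight module is isomorphic to some `M_S^t`. -/
theorem exists_equiv_moduleOf (ht : t.Monic)
    (hroot : ∀ c : ℂ, t.IsRoot c → ∃ k : ℝ, IsHalfInt k ∧ c = k) (hM : IsWeightModule M)
    (hind : CategoryTheory.Indecomposable M) :
    ∃ (S : DirectedSubset) (hS : IsAdmissible t S), S.Connected ∧
      Nonempty (M ≃ₗ[GWA t] moduleOf hS) := by
  rw [indecomposable_iff] at hind
  obtain ⟨hnt, hidem⟩ := hind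
  obtain ⟨N, hN⟩ := exists_eval_ne_zero ht.ne_zero
  have hne : ∃ n, weightSub M n ≠ ⊥ := by
    by_contra hc
    push Not at hc
    obtain ⟨v, hv⟩ := exists_ne (0 : M)
    refine hv (weight_induction hM (P := fun w => w = 0) rfl (fun v w hv hw => ?_)
      (fun n w hw => ?_) v)
    · rw [hv, hw, add_zero]
    · rw [← mem_weightSub, hc n] at hw
      exact (Submodule.mem_bot ℂ).1 hw
  -- All roots have index of absolute value less than `N`, so `N` and `-N` bound them on the two
  -- sides.
  obtain ⟨n₀, x, φ, s, hstr⟩ := exists_string (isRep_weightSub (M := M)) (N := N) (N' := -N)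
    (fun m hm => hN m (by rw [abs_of_nonneg (by omega)]; exact hm))
    (fun m hm => hN m (by rw [abs_of_neg (by omega)]; omega)) hne
  obtain ⟨S, hS, hconn, hSx, hSs⟩ := exists_admissible ht hroot hstr
  -- The projection onto the string along the common kernel of the dual string.
  obtain ⟨e, he⟩ := exists_hom hM (fun n =>
    ((LinearMap.toSpanSingleton ℂ M (x n)) ∘ₗ φ n).toAddMonoidHom)
  have he' : ∀ n : ℤ, ∀ w ∈ weightSpace M n, e w = φ n w • x n := fun n w hw => he n w hw
  have hx : ∀ n : ℤ, x n ∈ weightSpace M n := fun n => (hstr.node n).mem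
  have hscal : ∀ (n : ℤ) (c : ℂ), c • x n ∈ weightSpace M n := fun n c =>
    Submodule.smul_mem (weightSub M n) c (hx n)
  have hxx : ∀ n, φ n (x n) • x n = x n := by
    intro n
    by_cases h0 : x n = 0
    · rw [h0, smul_zero]
    · rw [(hstr.node n).dual h0, one_smul]
  have hadd : ∀ (g : M →+ M) (g' : M →+ M), (∀ (n : ℤ), ∀ w ∈ weightSpace M n, g w = g' w) →
      ∀ w, g w = g' w := by
    intro g g' h w
    induction w using weight_induction hM with
    | h0 => rw [map_zero, map_zero]
    | hadd v w hv hw => rw [map_add, map_add, hv, hw]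
    | h n w hw => exact h n w hw
  -- Linearity over `X^±` holds since the vectors and the functionals obey the relations of a link
  -- with the same coefficient.
  let E : M →ₗ[GWA t] M := gwaHom e
    (fun p => hadd (e.comp (op M (GWA.poly t p)).toAddMonoidHom)
      ((op M (GWA.poly t p)).toAddMonoidHom.comp e) fun n w hw => by
        change e (p • w) = p • e w
        rw [he' n _ (Submodule.smul_mem _ p hw), he' n w hw, poly_smul_of_mem hw,
          poly_smul_of_mem (hscal n _), map_smul, smul_eq_mul, mul_smul])
    (hadd (e.comp (op M (GWA.xp t)).toAddMonoidHom) ((op M (GWA.xp t)).toAddMonoidHom.comp e)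
      fun n w hw => by
        change e (GWA.xp t • w) = GWA.xp t • e w
        have h1 := xp_mem hw
        have h2 := (hstr.link n).dual_up w hw
        have h3 := (hstr.link n).up
        rw [op_apply] at h2 h3
        rw [he' n w hw, he' (n + 1) _ (by push_cast; exact h1), h2, smul_scalar, h3, smul_smul,
          mul_comm])
    (hadd (e.comp (op M (GWA.xm t)).toAddMonoidHom) ((op M (GWA.xm t)).toAddMonoidHom.comp e)
      fun n w hw => by
        change e (GWA.xm t • w) = GWA.xm t • e w
        have h1 := xm_mem hw
        have h2 := (hstr.link (n - 1)).dual_down w (by rw [sub_add_cancel]; exact hw)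
        have h3 := (hstr.link (n - 1)).down
        rw [sub_add_cancel, op_apply] at h3
        rw [sub_add_cancel, op_apply] at h2
        rw [he' n w hw, he' (n - 1) _ (by push_cast; exact h1), h2, smul_scalar, h3, smul_smul,
          mul_comm])
  have hE : ∀ w, E w = e w := fun w => rfl
  -- The idempotent `e` fixes the nonzero vector `x n₀`, so it is not zero and must be the identity;
  -- every weight vector is then a multiple of `x n`.
  have hid : ∀ w, e w = w := by
    rcases hidem E (fun w => by
      rw [hE, hE]
      refine hadd (e.comp e) e (fun n w hw => ?_) w
      change e (e w) = e w
      rw [he' n w hw, he' n _ (hscal n _), map_smul, smul_eq_mul, mul_smul, hxx]) with h | h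
    · have h1 := h (x n₀)
      rw [hE, he' n₀ _ (hx n₀), hxx] at h1
      exact absurd h1 hstr.ne_zero
    · exact h
  have hcoeff : ∀ m, m ∈ weights S → m + 1 ∈ weights S →
      upCoeff S m = upC (s m) ∧ downCoeff t S m = downC (t.eval ((m : ℂ) + 1 / 2)) (s m) := by
    intro m h1 h2
    have := hSs m h1 h2
    unfold upCoeff downCoeff
    rw [this]
    cases s m <;> exact ⟨rfl, rfl⟩
  refine ⟨S, hS, hconn, nonempty_equiv_moduleOf hS x hx hSx (fun n w hw => ⟨φ n w, ?_⟩) hM ?_ ?_⟩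
  · rw [← he' n w hw, hid]
  · intro n hn
    have h1 := (hstr.link n).up
    rw [op_apply] at h1
    by_cases hn' : n + 1 ∈ weights S
    · rw [h1, (hcoeff n hn hn').1]
    · have h2 : x (n + 1) = 0 := by rwa [hSx, not_not] at hn'
      rw [h1, h2, smul_zero, smul_zero]
  · intro n hn
    have h1 := (hstr.link (n - 1)).down
    rw [op_apply, sub_add_cancel] at h1
    by_cases hn' : n - 1 ∈ weights S
    · rw [h1, (hcoeff (n - 1) hn' (by rwa [sub_add_cancel])).2]
    · have h2 : x (n - 1) = 0 := by rwa [hSx, not_not] at hn'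
      rw [h1, h2, smul_zero, smul_zero]

end

/-! ### Admissible sets are determined by their modules -/

section

variable {t : ℂ[X]} {S S' : DirectedSubset}

theorem half_lt_iff {e m : ℤ} : (e : ℝ) + 1 / 2 < m ↔ e < m := by
  constructor
  · intro h
    have : (e : ℝ) < m := by linarith
    exact_mod_cast this
  · intro h
    have : ((e + 1 : ℤ) : ℝ) ≤ m := by exact_mod_cast h
    push_cast at this
    linarith

theorem lt_half_iff {e m : ℤ} : (m : ℝ) < (e : ℝ) + 1 / 2 ↔ m ≤ e := by
  constructor
  · intro h
    have : (m : ℝ) < (e + 1 : ℤ) := by push_cast; linarith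
    exact Int.lt_add_one_iff.1 (by exact_mod_cast this)
  · intro h
    have : (m : ℝ) ≤ e := by exact_mod_cast h
    linarith

namespace IsAdmissible

/-- The boundary points are half-integers. If `r = n + 1/2` the two integers are `n` and `n + 1`;
otherwise both are the integer nearest to `r`. Hence the weights determine the underlying set. -/
theorem mem_underlying_iff (hS : IsAdmissible t S) (r : ℝ) :
    r ∈ S.underlying ↔ ⌈r - 1 / 2⌉ ∈ weights S ∧ ⌊r + 1 / 2⌋ ∈ weights S := by
  obtain ⟨A, B, hA, hB, hu⟩ := hS.interval
  have hA' : ∀ k ∈ A, ∃ e : ℤ, k = e + 1 / 2 := fun k hk => hS.isHalfInt (hA k hk)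
  have hB' : ∀ k ∈ B, ∃ e : ℤ, k = e + 1 / 2 := fun k hk => hS.isHalfInt (hB k hk)
  have h1 := Int.ceil_lt_add_one (r - 1 / 2)
  have h2 := Int.le_ceil (r - 1 / 2)
  have h3 := Int.lt_floor_add_one (r + 1 / 2)
  have h4 := Int.floor_le (r + 1 / 2)
  simp only [weights, Set.mem_ofPred_eq, hu, Set.mem_inter_iff, Set.mem_iInter, Set.mem_Ioi,
    Set.mem_Iio]
  generalize ⌈r - 1 / 2⌉ = a at *
  generalize ⌊r + 1 / 2⌋ = b at *
  have cast_lt : ∀ m n : ℤ, (m : ℝ) < n ↔ m < n := fun m n => Int.cast_lt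
  constructor
  · rintro ⟨hr1, hr2⟩
    refine ⟨⟨fun k hk => ?_, fun k hk => ?_⟩, fun k hk => ?_, fun k hk => ?_⟩
    · obtain ⟨e, rfl⟩ := hA' k hk
      have := hr1 _ hk
      rw [half_lt_iff, ← cast_lt]
      linarith
    · obtain ⟨e, rfl⟩ := hB' k hk
      have := hr2 _ hk
      rw [lt_half_iff, ← Int.lt_add_one_iff, ← cast_lt]
      push_cast
      linarith
    · obtain ⟨e, rfl⟩ := hA' k hk
      have := hr1 _ hk
      rw [half_lt_iff, ← cast_lt]
      linarith
    · obtain ⟨e, rfl⟩ := hB' k hk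
      have := hr2 _ hk
      rw [lt_half_iff, ← Int.lt_add_one_iff, ← cast_lt]
      push_cast
      linarith
  · rintro ⟨⟨ha, -⟩, -, hb⟩
    refine ⟨fun k hk => ?_, fun k hk => ?_⟩
    · obtain ⟨e, rfl⟩ := hA' k hk
      have h5 := half_lt_iff.1 (ha _ hk)
      have h6 : ((e + 1 : ℤ) : ℝ) ≤ a := by exact_mod_cast h5
      push_cast at h6
      linarith
    · obtain ⟨e, rfl⟩ := hB' k hk
      have h5 := lt_half_iff.1 (hb _ hk)
      have h6 : (b : ℝ) ≤ e := by exact_mod_cast h5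
      linarith

theorem mid_mem_iff (hS : IsAdmissible t S) (n : ℤ) :
    (n : ℝ) + 1 / 2 ∈ S.underlying ↔ n ∈ weights S ∧ n + 1 ∈ weights S := by
  rw [hS.mem_underlying_iff, add_sub_cancel_right, Int.ceil_intCast, add_assoc, add_halves,
    Int.floor_intCast_add, Int.floor_one]

theorem eq_one (hS : IsAdmissible t S) {x : ℝ} (hx : x ∈ S.underlying) (ht : ¬ t.IsRoot (x : ℂ)) :
    S x = Membership.one := by
  have h1 : ¬ S.IsDirectedAt x := fun h => ht ((hS.directed x).1 h).2
  have h2 : S x ≠ Membership.zero := hx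
  rw [DirectedSubset.IsDirectedAt] at h1
  generalize S x = s at *
  cases s <;> simp_all

/-- A root in the underlying set is directed, so there "not left" means "right". -/
theorem mem_ups_iff (hS : IsAdmissible t S) {n : ℤ} (hn : t.IsRoot (((n : ℝ) + 1 / 2 : ℝ) : ℂ)) :
    n ∈ ups S ↔ S ((n : ℝ) + 1 / 2) = Membership.right := by
  have h1 := hS.directed ((n : ℝ) + 1 / 2)
  have h2 := hS.mid_mem_iff n
  simp only [hn, and_true] at h1
  rw [ups, Set.mem_ofPred_eq, ← and_assoc, ← h2, ← h1, DirectedSubset.IsDirectedAt]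
  generalize S ((n : ℝ) + 1 / 2) = s
  cases s <;> simp

theorem mem_downs_iff (hS : IsAdmissible t S) {n : ℤ} (hn : t.IsRoot (((n : ℝ) + 1 / 2 : ℝ) : ℂ)) :
    n ∈ downs S ↔ S ((n : ℝ) + 1 / 2) = Membership.left := by
  have h1 := hS.directed ((n : ℝ) + 1 / 2)
  have h2 := hS.mid_mem_iff n
  simp only [hn, and_true] at h1
  rw [downs, Set.mem_ofPred_eq, ← and_assoc, ← h2, ← h1, DirectedSubset.IsDirectedAt]
  generalize S ((n : ℝ) + 1 / 2) = s
  cases s <;> simp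

/-- The weights give the underlying set, on which `S` is `one` away from the roots; at a root the
two possible directions are told apart by whether `X⁺` vanishes. -/
theorem ext_of_weights (hS : IsAdmissible t S) (hS' : IsAdmissible t S')
    (hw : weights S = weights S') (hu : ups S = ups S') : S = S' := by
  have hund : ∀ r, r ∈ S.underlying ↔ r ∈ S'.underlying := by
    intro r
    rw [hS.mem_underlying_iff, hS'.mem_underlying_iff, hw]
  funext r
  by_cases hr : r ∈ S.underlying
  · have hr' := (hund r).1 hr
    by_cases ht : t.IsRoot (r : ℂ)
    · have h1 := (hS.directed r).2 ⟨hr, ht⟩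
      have h2 := (hS'.directed r).2 ⟨hr', ht⟩
      obtain ⟨n, rfl⟩ := hS.isHalfInt ht
      have h3 := hS.mem_ups_iff ht
      rw [hu, hS'.mem_ups_iff ht] at h3
      rw [DirectedSubset.IsDirectedAt] at h1 h2
      generalize S ((n : ℝ) + 1 / 2) = s at *
      generalize S' ((n : ℝ) + 1 / 2) = s' at *
      cases s <;> cases s' <;> simp_all
    · rw [hS.eq_one hr ht, hS'.eq_one hr' ht]
  · have h1 : S r = Membership.zero := not_not.1 hr
    have h2 : S' r = Membership.zero := not_not.1 fun h => hr ((hund r).2 h)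
    rw [h1, h2]

theorem weights_nonempty (hS : IsAdmissible t S) (hc : S.Connected) : (weights S).Nonempty := by
  obtain ⟨r, hr⟩ := hc.nonempty
  exact ⟨_, ((hS.mem_underlying_iff r).1 hr).1⟩

theorem ordConnected (hS : IsAdmissible t S) {x y z : ℝ} (hx : x ∈ S.underlying)
    (hz : z ∈ S.underlying) (hxy : x ≤ y) (hyz : y ≤ z) : y ∈ S.underlying := by
  obtain ⟨A, B, hA, hB, hu⟩ := hS.interval
  rw [hu] at hx hz ⊢
  simp only [Set.mem_inter_iff, Set.mem_iInter, Set.mem_Ioi, Set.mem_Iio] at hx hz ⊢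
  exact ⟨fun k hk => (hx.1 k hk).trans_le hxy, fun k hk => hyz.trans_lt (hz.2 k hk)⟩

/-- A midpoint cannot have both directions, so at least one arrow between consecutive weights is
nonzero. This is the connectedness used for indecomposability. -/
theorem mem_ups_or_downs (hS : IsAdmissible t S) :
    ∀ m ∈ weights S, ∀ n ∈ weights S, ∀ l, m ≤ l → l < n → l ∈ ups S ∨ l ∈ downs S := by
  intro m hm n hn l hml hln
  have h1 : l ∈ weights S := hS.ordConnected hm hn (by exact_mod_cast hml) (by exact_mod_cast hln.le)
  have h2 : l + 1 ∈ weights S :=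
    hS.ordConnected hm hn (by exact_mod_cast (by omega : m ≤ l + 1))
      (by exact_mod_cast (by omega : l + 1 ≤ n))
  by_cases h : S ((l : ℝ) + 1 / 2) = Membership.left
  · right
    exact ⟨h1, h2, by rw [h]; simp⟩
  · left
    exact ⟨h1, h2, h⟩

theorem isWeightModule (hS : IsAdmissible t S) : IsWeightModule (moduleOf hS) := by
  obtain ⟨x, φ, h⟩ := thin_moduleOf hS
  exact h.isWeightModule

theorem indecomposable (hS : IsAdmissible t S) (hc : S.Connected) :
    CategoryTheory.Indecomposable (moduleOf hS) := by
  obtain ⟨x, φ, h⟩ := thin_moduleOf hS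
  exact h.indecomposable (hS.weights_nonempty hc) hS.mem_ups_or_downs

theorem xp_ne_zero_iff (hS : IsAdmissible t S) {k : ℝ} (hk : t.IsRoot (k : ℂ)) {w : moduleOf hS}
    (h0 : w ≠ 0) (hw : w ∈ weightSpace (moduleOf hS) (k - 1 / 2)) :
    GWA.xp t • w ≠ 0 ↔ S k = Membership.right := by
  obtain ⟨n, rfl⟩ := hS.isHalfInt hk
  obtain ⟨x, φ, h⟩ := thin_moduleOf hS
  rw [← hS.mem_ups_iff hk]
  refine h.xp_ne_zero_iff ?_ h0
  convert hw using 2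
  push_cast
  ring

theorem xm_ne_zero_iff (hS : IsAdmissible t S) {k : ℝ} (hk : t.IsRoot (k : ℂ)) {w : moduleOf hS}
    (h0 : w ≠ 0) (hw : w ∈ weightSpace (moduleOf hS) (k + 1 / 2)) :
    GWA.xm t • w ≠ 0 ↔ S k = Membership.left := by
  obtain ⟨n, rfl⟩ := hS.isHalfInt hk
  obtain ⟨x, φ, h⟩ := thin_moduleOf hS
  rw [← hS.mem_downs_iff hk]
  refine h.xm_ne_zero_iff ?_ h0
  convert hw using 2
  push_cast
  ring

theorem support_eq (hS : IsAdmissible t S) :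
    support (moduleOf hS) = {c : ℂ | ∃ n : ℤ, c = n ∧ (n : ℝ) ∈ S.underlying} := by
  obtain ⟨x, φ, h⟩ := thin_moduleOf hS
  exact h.support_eq

/-- A thin module with the same weights and arrows as `M_S^t` is isomorphic to `M_S^t`. -/
theorem nonempty_equiv_of_thin (hS : IsAdmissible t S) (hc : S.Connected)
    {P : ModuleCat.{u} (GWA t)} (hP : Thin P (weights S) (ups S) (downs S)) :
    Nonempty (P ≃ₗ[GWA t] moduleOf hS) := by
  obtain ⟨x, φ, h⟩ := id hP
  -- No isomorphism is written down: `P` is indecomposable, so it is isomorphic to the module of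
  -- some `S'`, and the invariants give `S' = S`.
  obtain ⟨S', hS', hc', ⟨f⟩⟩ := exists_equiv_moduleOf hS.monic hS.halfInt h.isWeightModule
    (h.indecomposable (hS.weights_nonempty hc) hS.mem_ups_or_downs)
  obtain ⟨h1, h2, -⟩ := (thin_moduleOf hS').eq (hP.congr f)
  obtain rfl := hS'.ext_of_weights hS h1 h2
  exact ⟨f⟩

theorem eq_of_equiv {M : ModuleCat.{u} (GWA t)} (hS : IsAdmissible t S) (hS' : IsAdmissible t S')
    (f : M ≃ₗ[GWA t] moduleOf hS) (f' : M ≃ₗ[GWA t] moduleOf hS') : S = S' := by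
  obtain ⟨h1, h2, -⟩ := (thin_moduleOf hS).eq ((thin_moduleOf hS').congr (f'.symm.trans f))
  exact hS.ext_of_weights hS' h1 h2

end IsAdmissible

end

/-! ### Iterated tensor products -/

theorem Thin.of_iff {t : ℂ[X]} {M : ModuleCat.{u} (GWA t)} {I U D I' U' D' : Set ℤ}
    (h : Thin M I U D) (hI : ∀ n, n ∈ I ↔ n ∈ I') (hU : ∀ n, n ∈ U ↔ n ∈ U')
    (hD : ∀ n, n ∈ D ↔ n ∈ D') : Thin M I' U' D' := by
  rwa [← Set.ext hI, ← Set.ext hU, ← Set.ext hD]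

theorem thin_unitModule : Thin unitModule.{u} Set.univ Set.univ Set.univ := by
  have h := (thin_moduleOf admissible_one).congr
    (N := unitModule.{u}) (ULift.moduleEquiv (R := GWA 1) (M := moduleOf admissible_one)).symm
  have h1 : ∀ n : ℤ, n ∈ weights (DirectedSubset.ofSet Set.univ) := fun n => by
    simp [weights, underlying_ofSet]
  have h2 : ∀ x, DirectedSubset.ofSet Set.univ x = Membership.one := fun x => by
    simp [DirectedSubset.ofSet]
  exact h.of_iff (by simpa using h1)
    (fun n => ⟨fun _ => trivial, fun _ => ⟨h1 n, h1 _, by rw [h2]; simp⟩⟩)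
    (fun n => ⟨fun _ => trivial, fun _ => ⟨h1 n, h1 _, by rw [h2]; simp⟩⟩)

/-- Iterating `thin_tensor` intersects the sets over the list; the unit module, with all of `ℤ` in
each set, matches the empty intersection. -/
theorem thin_tensorList {ι : Type*} (l : List ι) (P : ι → SomeModule.{u}) (I U D : ι → Set ℤ)
    (h : ∀ a ∈ l, Thin (P a).module (I a) (U a) (D a)) :
    Thin (tensorList (l.map P)).module {n | ∀ a ∈ l, n ∈ I a} {n | ∀ a ∈ l, n ∈ U a}
      {n | ∀ a ∈ l, n ∈ D a} := by
  induction l with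
  | nil => exact thin_unitModule.of_iff (by simp) (by simp) (by simp)
  | cons a l ih =>
    cases l with
    | nil => exact (h a (by simp)).of_iff (by simp) (by simp) (by simp)
    | cons b l =>
      have h1 := thin_tensor (h a (by simp)) (ih fun c hc => h c (List.mem_cons_of_mem _ hc))
      exact h1.of_iff (fun n => (List.forall_mem_cons (p := fun c => n ∈ I c)).symm)
        (fun n => (List.forall_mem_cons (p := fun c => n ∈ U c)).symm)
        (fun n => (List.forall_mem_cons (p := fun c => n ∈ D c)).symm)

theorem param_tensorList (l : List SomeModule.{u}) :
    (tensorList l).param = (l.map SomeModule.param).prod := by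
  induction l with
  | nil => rfl
  | cons a l ih =>
    cases l with
    | nil => simp [tensorList]
    | cons b l =>
      rw [List.map_cons, List.prod_cons, ← ih]
      rfl

/-- The exponents disappear, because a positive number of copies of a set has that set as
intersection. -/
theorem thin_tensorPowers {r : ℕ} {t : Fin r → ℂ[X]} (M : (a : Fin r) → ModuleCat.{u} (GWA (t a)))
    (m : Fin r → ℕ) (hm : ∀ a, 0 < m a) (I U D : Fin r → Set ℤ)
    (h : ∀ a, Thin (M a) (I a) (U a) (D a)) :
    Thin (tensorPowers M m).module {n | ∀ a, n ∈ I a} {n | ∀ a, n ∈ U a} {n | ∀ a, n ∈ D a} := by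
  have h1 : ∀ a, Thin (tensorPower (withParam (M a)) (m a)).module (I a) (U a) (D a) := by
    intro a
    have h2 := thin_tensorList (List.replicate (m a) ()) (fun _ => withParam (M a)) (fun _ => I a)
      (fun _ => U a) (fun _ => D a) (fun _ _ => h a)
    rw [List.map_replicate] at h2
    exact h2.of_iff (by simp [List.mem_replicate, (hm a).ne'])
      (by simp [List.mem_replicate, (hm a).ne']) (by simp [List.mem_replicate, (hm a).ne'])
  have h3 := thin_tensorList (List.finRange r) (fun a => tensorPower (withParam (M a)) (m a)) I U D
    fun a _ => h1 a
  rw [← List.ofFn_eq_map] at h3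
  exact h3.of_iff (by simp) (by simp) (by simp)

theorem param_tensorPowers {r : ℕ} {t : Fin r → ℂ[X]}
    (M : (a : Fin r) → ModuleCat.{u} (GWA (t a))) (m : Fin r → ℕ) :
    (tensorPowers M m).param = ∏ a, t a ^ m a := by
  have h : ∀ a, (tensorPower (withParam (M a)) (m a)).param = t a ^ m a := by
    intro a
    rw [tensorPower, param_tensorList, List.map_replicate, List.prod_replicate]
    rfl
  rw [tensorPowers, param_tensorList, List.map_ofFn, List.prod_ofFn]
  exact Finset.prod_congr rfl fun a _ => h a

/-- Removes the transport along the equality of parameters, so that ordinary linear equivalences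
over a fixed `A(t)` can be used. -/
theorem isoTo_of_equiv {t : ℂ[X]} {M : ModuleCat.{u} (GWA t)} {P : SomeModule.{v}}
    (ht : t = P.param) (h : ∀ (N : ModuleCat.{v} (GWA t)), P = withParam N →
      Nonempty (M ≃ₗ[GWA t] N)) : IsoTo M P := by
  obtain ⟨s, N⟩ := P
  obtain rfl : t = s := ht
  obtain ⟨f⟩ := h N rfl
  exact ⟨rfl, f.toAddEquiv, fun a w => f.map_smul a w⟩

theorem IsoTo.thin {t : ℂ[X]} {M : ModuleCat.{u} (GWA t)} {P : SomeModule.{v}} (h : IsoTo M P)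
    {I U D : Set ℤ} (hM : Thin M I U D) : Thin P.module I U D := by
  obtain ⟨s, N⟩ := P
  obtain ⟨hs, f, hf⟩ := h
  obtain rfl : t = s := hs
  exact hM.congr { f with map_smul' := hf }

theorem isoTo_of_thin {t : ℂ[X]} {M : ModuleCat.{u} (GWA t)} {S : DirectedSubset}
    (hS : IsAdmissible t S) (hc : S.Connected) (f : M ≃ₗ[GWA t] moduleOf hS) {P : SomeModule.{v}}
    (ht : t = P.param) (hP : Thin P.module (weights S) (ups S) (downs S)) : IsoTo M P := by
  refine isoTo_of_equiv ht fun N hN => ?_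
  subst hN
  obtain ⟨g⟩ := hS.nonempty_equiv_of_thin hc hP
  exact ⟨f.trans g.symm⟩

/-! ### The tensor factors -/

section

variable {r : ℕ} {k : Fin r → ℝ}

/-- As the roots increase, lying above `k_i` means lying above all the roots up to `k_i`. For `i =
0` the condition is empty, in accordance with the endpoint `-∞`. -/
theorem extRoot_lt_iff (hk : StrictMono k) {i : ℕ} (hi : i ≤ r) (x : ℝ) :
    extRoot k i < (x : EReal) ↔ ∀ a : Fin r, (a : ℕ) + 1 ≤ i → k a < x := by
  rcases i with _ | i
  · simp [extRoot]
  · have hi' : i < r := by omega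
    have : extRoot k (i + 1) = ((k ⟨i, hi'⟩ : ℝ) : EReal) := by simp [extRoot, hi']
    rw [this, EReal.coe_lt_coe_iff]
    constructor
    · intro h a ha
      exact (hk.monotone (show a ≤ ⟨i, hi'⟩ from Fin.le_def.2 (by simpa using ha))).trans_lt h
    · intro h
      exact h ⟨i, hi'⟩ le_rfl

theorem lt_extRoot_iff (hk : StrictMono k) {j : ℕ} (hj0 : 0 < j) (x : ℝ) :
    (x : EReal) < extRoot k j ↔ ∀ a : Fin r, j ≤ (a : ℕ) + 1 → x < k a := by
  obtain ⟨j, rfl⟩ : ∃ j', j = j' + 1 := ⟨j - 1, by omega⟩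
  by_cases hj : j < r
  · have : extRoot k (j + 1) = ((k ⟨j, hj⟩ : ℝ) : EReal) := by simp [extRoot, hj]
    rw [this, EReal.coe_lt_coe_iff]
    constructor
    · intro h a ha
      exact h.trans_le (hk.monotone (show ⟨j, hj⟩ ≤ a from Fin.le_def.2 (by simpa using ha)))
    · intro h
      exact h ⟨j, hj⟩ le_rfl
  · have : extRoot k (j + 1) = ⊤ := by simp [extRoot, hj]
    rw [this]
    refine ⟨fun _ a ha => ?_, fun _ => EReal.coe_lt_top x⟩
    have := a.2
    omega

/-- The underlying set of an admissible set is `(k_i, k_j)` for some `i < j`. -/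
theorem exists_bounds (hk : StrictMono k) {t : ℂ[X]} (ht : ∀ c : ℝ, t.IsRoot (c : ℂ) ↔ ∃ a, c = k a)
    {S : DirectedSubset} (hS : IsAdmissible t S) (hc : S.Connected) :
    ∃ i j : ℕ, i < j ∧ j ≤ r + 1 ∧ ∀ x : ℝ, x ∈ S.underlying ↔
      (∀ a : Fin r, (a : ℕ) + 1 ≤ i → k a < x) ∧ ∀ a : Fin r, j ≤ (a : ℕ) + 1 → x < k a := by
  obtain ⟨A, B, hA, hB, hu⟩ := hS.interval
  have hmem : ∀ x, x ∈ S.underlying ↔ (∀ k ∈ A, k < x) ∧ ∀ k ∈ B, x < k := by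
    intro x
    simp only [hu, Set.mem_inter_iff, Set.mem_iInter, Set.mem_Ioi, Set.mem_Iio]
  -- Only the largest root in `A` matters, and `i` is its number counted from one; `i = 0` if `A` is
  -- empty.
  have hAi : ∃ i ≤ r, ∀ x : ℝ, (∀ k ∈ A, k < x) ↔ ∀ a : Fin r, (a : ℕ) + 1 ≤ i → k a < x := by
    by_cases hAe : ∃ a, k a ∈ A
    · obtain ⟨a, ha, hmax⟩ := Set.exists_max_image {a | k a ∈ A} id (Set.toFinite _) hAe
      refine ⟨a + 1, a.2, fun x => ⟨fun h b hb => ?_, fun h c hc => ?_⟩⟩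
      · exact (hk.monotone (Fin.le_def.2 (by omega) : b ≤ a)).trans_lt (h _ ha)
      · obtain ⟨b, rfl⟩ := (ht c).1 (hA c hc)
        have : b ≤ a := hmax b hc
        exact h b (by rw [Fin.le_def] at this; omega)
    · refine ⟨0, Nat.zero_le _, fun x => ⟨fun _ a ha => by omega, fun _ c hc => ?_⟩⟩
      obtain ⟨b, rfl⟩ := (ht c).1 (hA c hc)
      exact absurd ⟨b, hc⟩ hAe
  have hBj : ∃ j, 0 < j ∧ j ≤ r + 1 ∧ ∀ x : ℝ, (∀ k ∈ B, x < k) ↔ ∀ a : Fin r, j ≤ (a : ℕ) + 1 → x < k a := by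
    by_cases hBe : ∃ a, k a ∈ B
    · obtain ⟨a, ha, hmin⟩ := Set.exists_min_image {a | k a ∈ B} id (Set.toFinite _) hBe
      refine ⟨a + 1, by omega, by omega, fun x => ⟨fun h b hb => ?_, fun h c hc => ?_⟩⟩
      · exact (h _ ha).trans_le (hk.monotone (Fin.le_def.2 (by omega) : a ≤ b))
      · obtain ⟨b, rfl⟩ := (ht c).1 (hB c hc)
        have : a ≤ b := hmin b hc
        exact h b (by rw [Fin.le_def] at this; omega)
    · refine ⟨r + 1, by omega, le_rfl, fun x => ⟨fun _ a ha => by omega, fun _ c hc => ?_⟩⟩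
      obtain ⟨b, rfl⟩ := (ht c).1 (hB c hc)
      exact absurd ⟨b, hc⟩ hBe
  obtain ⟨i, hi, hAi⟩ := hAi
  obtain ⟨j, hj0, hj, hBj⟩ := hBj
  refine ⟨i, j, ?_, hj, fun x => by rw [hmem, hAi, hBj]⟩
  -- If `j ≤ i`, a point of the underlying set would be both above and below the root `k_i`.
  by_contra hij
  obtain ⟨x, hx⟩ := hc.nonempty
  rw [hmem, hAi, hBj] at hx
  rcases i with _ | i
  · omega
  · have h1 := hx.1 ⟨i, by omega⟩ le_rfl
    have h2 := hx.2 ⟨i, by omega⟩ (not_lt.1 hij)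
    exact lt_asymm h1 h2

end

/-! ### Connected admissible sets of a linear polynomial -/

section

variable {k : ℝ}

theorem connected_Ioi : (DirectedSubset.ofSet (Set.Ioi k)).Connected := by
  rw [DirectedSubset.Connected, underlying_ofSet]
  exact isConnected_Ioi

theorem connected_Iio : (DirectedSubset.ofSet (Set.Iio k)).Connected := by
  rw [DirectedSubset.Connected, underlying_ofSet]
  exact isConnected_Iio

theorem connected_linePlus : (DirectedSubset.linePlus k).Connected := by
  rw [DirectedSubset.Connected, underlying_linePlus]
  exact isConnected_univ

theorem connected_lineMinus : (DirectedSubset.lineMinus k).Connected := by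
  rw [DirectedSubset.Connected, underlying_lineMinus]
  exact isConnected_univ

theorem IsAdmissible.ext_of_underlying {t : ℂ[X]} {S S' : DirectedSubset} (hS : IsAdmissible t S)
    (hS' : IsAdmissible t S') (hu : S.underlying = S'.underlying)
    (h : ∀ x ∈ S.underlying, t.IsRoot (x : ℂ) → S x = S' x) : S = S' := by
  funext x
  by_cases hx : x ∈ S.underlying
  · by_cases ht : t.IsRoot (x : ℂ)
    · exact h x hx ht
    · rw [hS.eq_one hx ht, hS'.eq_one (hu ▸ hx) ht]
  · have h1 : S x = Membership.zero := not_not.1 hx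
    rw [hu] at hx
    have h2 : S' x = Membership.zero := not_not.1 hx
    rw [h1, h2]

/-- The connected `(z - k)`-admissible sets. -/
theorem IsAdmissible.linear_cases {T : DirectedSubset} (hk : IsHalfInt k)
    (hT : IsAdmissible (X - C (k : ℂ)) T) (hc : T.Connected) :
    T = DirectedSubset.ofSet (Set.Ioi k) ∨ T = DirectedSubset.ofSet (Set.Iio k) ∨
      T = DirectedSubset.linePlus k ∨ T = DirectedSubset.lineMinus k := by
  obtain ⟨A, B, hA, hB, hu⟩ := hT.interval
  have hroot : ∀ c : ℝ, (X - C (k : ℂ) : ℂ[X]).IsRoot (c : ℂ) ↔ c = k := fun c => by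
    rw [isRoot_linear, Complex.ofReal_inj]
  simp only [hroot] at hA hB
  have hmem : ∀ x, x ∈ T.underlying ↔ (k ∈ A → k < x) ∧ (k ∈ B → x < k) := by
    intro x
    simp only [hu, Set.mem_inter_iff, Set.mem_iInter, Set.mem_Ioi, Set.mem_Iio]
    refine and_congr ⟨fun h => h k, fun h c hc => ?_⟩ ⟨fun h => h k, fun h c hc => ?_⟩
    · obtain rfl := hA c hc
      exact h hc
    · obtain rfl := hB c hc
      exact h hc
  -- The sets of bounds can contain only `k`. A bound on one side gives a ray, bounds on both sides
  -- leave nothing, and no bound gives the line with one of two directions at `k`.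
  by_cases h1 : k ∈ A
  · by_cases h2 : k ∈ B
    · obtain ⟨x, hx⟩ := hc.nonempty
      rw [hmem] at hx
      exact absurd (hx.1 h1) (lt_asymm (hx.2 h2))
    · left
      have hu' : T.underlying = Set.Ioi k := by
        ext x
        rw [hmem, Set.mem_Ioi]
        exact ⟨fun h => h.1 h1, fun h => ⟨fun _ => h, fun h' => absurd h' h2⟩⟩
      refine hT.ext_of_underlying (admissible_Ioi hk) (by rw [hu', underlying_ofSet])
        fun x hx hx' => ?_
      rw [hroot] at hx'
      rw [hu', hx'] at hx
      exact absurd hx (lt_irrefl k)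
  · by_cases h2 : k ∈ B
    · right; left
      have hu' : T.underlying = Set.Iio k := by
        ext x
        rw [hmem, Set.mem_Iio]
        exact ⟨fun h => h.2 h2, fun h => ⟨fun h' => absurd h' h1, fun _ => h⟩⟩
      refine hT.ext_of_underlying (admissible_Iio hk) (by rw [hu', underlying_ofSet])
        fun x hx hx' => ?_
      rw [hroot] at hx'
      rw [hu', hx'] at hx
      exact absurd hx (lt_irrefl k)
    · right; right
      have hu' : T.underlying = Set.univ := by
        ext x
        rw [hmem]
        exact ⟨fun _ => trivial, fun _ => ⟨fun h' => absurd h' h1, fun h' => absurd h' h2⟩⟩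
      have hk' : T.IsDirectedAt k := (hT.directed k).2 ⟨hu' ▸ Set.mem_univ k, (hroot k).2 rfl⟩
      rcases hk' with hk' | hk'
      · left
        refine hT.ext_of_underlying (admissible_linePlus hk) (by rw [hu', underlying_linePlus])
          fun x _ hx' => ?_
        obtain rfl := (hroot x).1 hx'
        rw [hk', DirectedSubset.linePlus, if_pos rfl]
      · right
        refine hT.ext_of_underlying (admissible_lineMinus hk) (by rw [hu', underlying_lineMinus])
          fun x _ hx' => ?_
        obtain rfl := (hroot x).1 hx'
        rw [hk', DirectedSubset.lineMinus, if_pos rfl]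

end

/-! ### Comparing an admissible set with those of its tensor factors -/

section

variable {r : ℕ} {k : Fin r → ℝ}

/-- The condition on the directed subset of a tensor factor at the root `k a` that the product has
directed subset `S`, with underlying set `(k_i, k_j)`. -/
structure IsFactorSet (k : Fin r → ℝ) (S : DirectedSubset) (i j : ℕ) (a : Fin r)
    (T : DirectedSubset) : Prop where
  mem : ∀ x : ℝ, ((a : ℕ) + 1 ≤ i → k a < x) → (j ≤ (a : ℕ) + 1 → x < k a) → x ∈ T.underlying
  lower : (a : ℕ) + 1 = i → ∀ x ∈ T.underlying, k a < x
  upper : (a : ℕ) + 1 = j → ∀ x ∈ T.underlying, x < k a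
  mid : i < (a : ℕ) + 1 → (a : ℕ) + 1 < j → T (k a) = S (k a)

/-- Only the factors at `k_i` and `k_j` have to cut: being above `k_i` implies being above all
smaller roots, and similarly for `k_j`. The other factors need only contain the interval. -/
theorem weights_eq_of_isFactorSet (hk : StrictMono k) {S : DirectedSubset} {i j : ℕ} (hij : i < j)
    (hj : j ≤ r + 1)
    (hS : ∀ x : ℝ, x ∈ S.underlying ↔
      (∀ a : Fin r, (a : ℕ) + 1 ≤ i → k a < x) ∧ ∀ a : Fin r, j ≤ (a : ℕ) + 1 → x < k a)
    {T : Fin r → DirectedSubset} (hT : ∀ a, IsFactorSet k S i j a (T a)) (n : ℤ) :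
    n ∈ weights S ↔ ∀ a, n ∈ weights (T a) := by
  simp only [weights, Set.mem_ofPred_eq]
  rw [hS]
  constructor
  · exact fun h a => (hT a).mem _ (h.1 a) (h.2 a)
  · refine fun h => ⟨fun a ha => ?_, fun a ha => ?_⟩
    · have hi : i - 1 < r := by omega
      have h1 := (hT ⟨i - 1, hi⟩).lower (by simp only; omega) _ (h _)
      exact (hk.monotone (Fin.le_def.2 (by simp only; omega) : a ≤ ⟨i - 1, hi⟩)).trans_lt h1
    · have ha' := a.2
      have hj' : j - 1 < r := by omega
      have h1 := (hT ⟨j - 1, hj'⟩).upper (by simp only; omega) _ (h _)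
      exact h1.trans_le (hk.monotone (Fin.le_def.2 (by simp only; omega) : ⟨j - 1, hj'⟩ ≤ a))

section

variable {t : ℂ[X]} (ht : ∀ c : ℝ, t.IsRoot (c : ℂ) ↔ ∃ a, c = k a) {S : DirectedSubset}
  (hS : IsAdmissible t S) {T : Fin r → DirectedSubset}
  (hT : ∀ a, IsAdmissible (X - C (k a : ℂ)) (T a))
  (hd : ∀ a, k a ∈ S.underlying → T a (k a) = S (k a))

include ht hS hT hd

/-- The set `T a` is directed only at `k a`, where it agrees with `S` if `k a` lies in `S`. So a
direction of `S` comes from a factor, and a direction of a factor inside `S` is one of `S`. -/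
theorem value_eq_iff {n : ℤ} (hn : n ∈ weights S) (hn' : n + 1 ∈ weights S) {s : Membership}
    (hs : s = Membership.left ∨ s = Membership.right) :
    S ((n : ℝ) + 1 / 2) = s ↔ ∃ a, T a ((n : ℝ) + 1 / 2) = s := by
  have hmid := (hS.mid_mem_iff n).2 ⟨hn, hn'⟩
  constructor
  · intro h
    have h1 : S.IsDirectedAt ((n : ℝ) + 1 / 2) := by
      rw [DirectedSubset.IsDirectedAt, h]
      exact hs.symm
    obtain ⟨a, ha⟩ := (ht _).1 ((hS.directed _).1 h1).2
    refine ⟨a, ?_⟩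
    rw [ha] at h hmid ⊢
    rw [hd a hmid, h]
  · rintro ⟨a, h⟩
    have h1 : (T a).IsDirectedAt ((n : ℝ) + 1 / 2) := by
      rw [DirectedSubset.IsDirectedAt, h]
      exact hs.symm
    have h2 := (((hT a).directed _).1 h1).2
    rw [isRoot_linear, Complex.ofReal_inj] at h2
    rw [h2] at h hmid ⊢
    rw [← hd a hmid, h]

variable (hw : ∀ n, n ∈ weights S ↔ ∀ a, n ∈ weights (T a))

include hw

/-- Between two weights of `S`, the arrow `X⁺` vanishes exactly if the midpoint is left-directed in
`S`, which by `value_eq_iff` means in some factor. -/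
theorem ups_eq_of_factors (n : ℤ) : n ∈ ups S ↔ ∀ a, n ∈ ups (T a) := by
  by_cases hn : n ∈ weights S ∧ n + 1 ∈ weights S
  · have h1 := value_eq_iff ht hS hT hd hn.1 hn.2 (Or.inl rfl)
    have h2 := (hw n).1 hn.1
    have h3 := (hw (n + 1)).1 hn.2
    simp only [ups, Set.mem_ofPred_eq, hn.1, hn.2, h2, h3, true_and, ne_eq, h1, not_exists]
  · simp only [ups, Set.mem_ofPred_eq]
    constructor
    · exact fun h => absurd ⟨h.1, h.2.1⟩ hn
    · intro h
      exact absurd ⟨(hw n).2 fun a => (h a).1, (hw _).2 fun a => (h a).2.1⟩ hn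

theorem downs_eq_of_factors (n : ℤ) : n ∈ downs S ↔ ∀ a, n ∈ downs (T a) := by
  by_cases hn : n ∈ weights S ∧ n + 1 ∈ weights S
  · have h1 := value_eq_iff ht hS hT hd hn.1 hn.2 (Or.inr rfl)
    have h2 := (hw n).1 hn.1
    have h3 := (hw (n + 1)).1 hn.2
    simp only [downs, Set.mem_ofPred_eq, hn.1, hn.2, h2, h3, true_and, ne_eq, h1, not_exists]
  · simp only [downs, Set.mem_ofPred_eq]
    constructor
    · exact fun h => absurd ⟨h.1, h.2.1⟩ hn
    · intro h
      exact absurd ⟨(hw n).2 fun a => (h a).1, (hw _).2 fun a => (h a).2.1⟩ hn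

end

variable (hk : ∀ a, IsHalfInt (k a))

theorem isFactorSet_linePlus {S : DirectedSubset} {i j : ℕ} {a : Fin r} (hi : (a : ℕ) + 1 ≠ i)
    (hj : (a : ℕ) + 1 ≠ j)
    (hS : i < (a : ℕ) + 1 → (a : ℕ) + 1 < j → S (k a) = Membership.right) :
    IsFactorSet k S i j a (DirectedSubset.linePlus (k a)) where
  mem x _ _ := by
    rw [underlying_linePlus]
    trivial
  lower h := absurd h hi
  upper h := absurd h hj
  mid h h' := by rw [hS h h', DirectedSubset.linePlus, if_pos rfl]

theorem isFactorSet_lineMinus {S : DirectedSubset} {i j : ℕ} {a : Fin r} (hi : (a : ℕ) + 1 ≠ i)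
    (hj : (a : ℕ) + 1 ≠ j)
    (hS : i < (a : ℕ) + 1 → (a : ℕ) + 1 < j → S (k a) = Membership.left) :
    IsFactorSet k S i j a (DirectedSubset.lineMinus (k a)) where
  mem x _ _ := by
    rw [underlying_lineMinus]
    trivial
  lower h := absurd h hi
  upper h := absurd h hj
  mid h h' := by rw [hS h h', DirectedSubset.lineMinus, if_pos rfl]

/-- The factor `M_a` is `M_T` for a suitable `T`. -/
theorem exists_factor_eq {S : DirectedSubset} {i j : ℕ} (hij : i < j) (a : Fin r)
    (hS : i < (a : ℕ) + 1 → (a : ℕ) + 1 < j → S.IsDirectedAt (k a)) :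
    ∃ (T : DirectedSubset) (hT : IsAdmissible (X - C (k a : ℂ)) T), T.Connected ∧
      factor hk S i j a = moduleOf hT ∧ IsFactorSet k S i j a T := by
  unfold factor
  split_ifs with h1 h2 h3
  · refine ⟨_, admissible_Ioi (hk a), connected_Ioi, rfl, ?_, ?_, ?_, ?_⟩
    · intro x hx _
      rw [underlying_ofSet]
      exact hx h1
    · intro _ x hx
      rwa [underlying_ofSet] at hx
    · intro h
      omega
    · intro h
      omega
  · refine ⟨_, admissible_Iio (hk a), connected_Iio, rfl, ?_, ?_, ?_, ?_⟩
    · intro x _ hx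
      rw [underlying_ofSet]
      exact hx h2
    · intro h
      omega
    · intro _ x hx
      rwa [underlying_ofSet] at hx
    · intro _ h
      omega
  · exact ⟨_, admissible_linePlus (hk a), connected_linePlus, rfl,
      isFactorSet_linePlus (by omega) (by omega) fun _ _ => h3⟩
  · exact ⟨_, admissible_lineMinus (hk a), connected_lineMinus, rfl,
      isFactorSet_lineMinus (by omega) (by omega) fun h h' => (hS h h').resolve_left h3⟩

theorem nonempty_equiv_of_eq {t : ℂ[X]} {S S' : DirectedSubset} (hS : IsAdmissible t S)
    (hS' : IsAdmissible t S') (h : S = S') : Nonempty (moduleOf hS ≃ₗ[GWA t] moduleOf hS') := by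
  subst h
  exact ⟨LinearEquiv.refl _ _⟩

/-- Each factor of a product with directed subset `S` that is not strictly outside of `(k_i, k_j)`
is determined by `S`. -/
theorem factor_unique (hmono : StrictMono k) {t : ℂ[X]}
    (ht : ∀ c : ℝ, t.IsRoot (c : ℂ) ↔ ∃ a, c = k a) {S : DirectedSubset} (hS : IsAdmissible t S)
    {i j : ℕ} (hij : i < j)
    (hund : ∀ x : ℝ, x ∈ S.underlying ↔
      (∀ a : Fin r, (a : ℕ) + 1 ≤ i → k a < x) ∧ ∀ a : Fin r, j ≤ (a : ℕ) + 1 → x < k a)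
    {T : Fin r → DirectedSubset} (hT : ∀ a, IsAdmissible (X - C (k a : ℂ)) (T a))
    (hc : ∀ a, (T a).Connected) (hw : ∀ n, n ∈ weights S ↔ ∀ a, n ∈ weights (T a))
    (hu : ∀ n, n ∈ ups S ↔ ∀ a, n ∈ ups (T a)) (hd : ∀ n, n ∈ downs S ↔ ∀ a, n ∈ downs (T a))
    (a : Fin r) (hia : i ≤ (a : ℕ) + 1) (haj : (a : ℕ) + 1 ≤ j) :
    Nonempty (moduleOf (hT a) ≃ₗ[GWA (X - C (k a : ℂ))] factor hk S i j a) := by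
  have hcases := fun b => (hT b).linear_cases (hk b) (hc b)
  obtain ⟨n, hn⟩ := hk a
  have hroot : t.IsRoot (((n : ℝ) + 1 / 2 : ℝ) : ℂ) := (ht _).2 ⟨a, hn.symm⟩
  have hroot' : (X - C (k a : ℂ) : ℂ[X]).IsRoot (((n : ℝ) + 1 / 2 : ℝ) : ℂ) := by
    rw [← hn, isRoot_linear]
  rcases eq_or_lt_of_le hia with hi | hi
  -- Case `a = i`. Here `n = k_i - 1/2` is not a weight and `n + 1` is one, so some factor contains
  -- `n + 1` but not `n`. Among the four possible sets only a ray to the right with endpoint `n +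
  -- 1/2` does so, and the roots are distinct.
  · have h1 : n ∉ weights S := by
      intro h
      have := ((hund n).1 h).1 a hi.ge
      rw [hn, half_lt_iff] at this
      omega
    have h2 : n + 1 ∈ weights S := by
      refine (hund _).2 ⟨fun b hb => ?_, fun b hb => ?_⟩
      · refine (hmono.monotone (Fin.le_def.2 (by omega) : b ≤ a)).trans_lt ?_
        rw [hn, half_lt_iff]
        omega
      -- The next root is a larger half-integer, so it exceeds `n + 1`.
      · have h3 := hmono (Fin.lt_def.2 (by omega) : a < b)
        obtain ⟨e, he⟩ := hk b
        rw [hn, he, add_lt_add_iff_right, Int.cast_lt] at h3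
        rw [he, lt_half_iff]
        omega
    obtain ⟨b, hb⟩ := not_forall.1 (mt (hw n).2 h1)
    have h3 := (hw (n + 1)).1 h2 b
    obtain ⟨e, he⟩ := hk b
    have h4 : T b = DirectedSubset.ofSet (Set.Ioi (k b)) ∧ e = n := by
      simp only [weights, Set.mem_ofPred_eq] at hb h3
      rcases hcases b with h | h | h | h <;> rw [h] at hb h3
      · rw [underlying_ofSet, Set.mem_Ioi, he, half_lt_iff] at hb h3
        exact ⟨h, by omega⟩
      · rw [underlying_ofSet, Set.mem_Iio, he, lt_half_iff] at hb h3
        omega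
      · rw [underlying_linePlus] at hb
        exact absurd trivial hb
      · rw [underlying_lineMinus] at hb
        exact absurd trivial hb
    obtain rfl : b = a := hmono.injective (by rw [he, hn, h4.2])
    rw [show factor hk S i j b = modIoi (hk b) from if_pos hi.ge]
    exact nonempty_equiv_of_eq _ _ h4.1
  rcases eq_or_lt_of_le haj with hj | hj
  -- Case `a = j`, the mirror image: some factor contains `n` but not `n + 1`, and it must be the
  -- ray to the left ending at `k_j`.
  · have h1 : n + 1 ∉ weights S := by
      intro h
      have := ((hund _).1 h).2 a hj.ge
      rw [hn, lt_half_iff] at this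
      omega
    have h2 : n ∈ weights S := by
      refine (hund _).2 ⟨fun b hb => ?_, fun b hb => ?_⟩
      · have h3 := hmono (Fin.lt_def.2 (by omega) : b < a)
        obtain ⟨e, he⟩ := hk b
        rw [hn, he, add_lt_add_iff_right, Int.cast_lt] at h3
        rw [he, half_lt_iff]
        omega
      · refine lt_of_lt_of_le ?_ (hmono.monotone (Fin.le_def.2 (by omega) : a ≤ b))
        rw [hn, lt_half_iff]
    obtain ⟨b, hb⟩ := not_forall.1 (mt (hw (n + 1)).2 h1)
    have h3 := (hw n).1 h2 b
    obtain ⟨e, he⟩ := hk b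
    have h4 : T b = DirectedSubset.ofSet (Set.Iio (k b)) ∧ e = n := by
      simp only [weights, Set.mem_ofPred_eq] at hb h3
      rcases hcases b with h | h | h | h <;> rw [h] at hb h3
      · rw [underlying_ofSet, Set.mem_Ioi, he, half_lt_iff] at hb h3
        omega
      · rw [underlying_ofSet, Set.mem_Iio, he, lt_half_iff] at hb h3
        exact ⟨h, by omega⟩
      · rw [underlying_linePlus] at hb
        exact absurd trivial hb
      · rw [underlying_lineMinus] at hb
        exact absurd trivial hb
    obtain rfl : b = a := hmono.injective (by rw [he, hn, h4.2])
    rw [show factor hk S i j b = modIio (hk b) from (if_neg (by omega)).trans (if_pos hj.ge)]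
    exact nonempty_equiv_of_eq _ _ h4.1
  -- Strictly inside, both neighbours of `k a` are weights, so the factor is a full line. Its
  -- direction is that of `S`, since an arrow of the product is present in every factor.
  · have h1 : (n : ℝ) + 1 / 2 ∈ S.underlying := by
      rw [← hn, hund]
      exact ⟨fun b hb => hmono (Fin.lt_def.2 (by omega)), fun b hb => hmono (Fin.lt_def.2 (by omega))⟩
    have h2 := ((hS.mid_mem_iff n).1 h1).1
    have h3 := ((hS.mid_mem_iff n).1 h1).2
    have h4 := (hw n).1 h2 a
    have h5 := (hw _).1 h3 a
    have h6 : (T a).underlying = Set.univ := by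
      simp only [weights, Set.mem_ofPred_eq] at h4 h5
      rcases hcases a with h | h | h | h <;> rw [h] at h4 h5 ⊢
      · rw [underlying_ofSet, Set.mem_Ioi, hn, half_lt_iff] at h4
        omega
      · rw [underlying_ofSet, Set.mem_Iio, hn, lt_half_iff] at h5
        omega
      · exact underlying_linePlus
      · exact underlying_lineMinus
    rcases (hS.directed _).2 ⟨h1, hroot⟩ with h | h
    · rw [show factor hk S i j a = modPlus (hk a) from
        (if_neg (by omega)).trans ((if_neg (by omega)).trans (if_pos (by rw [hn, h])))]
      refine nonempty_equiv_of_eq _ _ ((hT a).ext_of_underlying (admissible_linePlus (hk a))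
        (by rw [h6, underlying_linePlus]) fun x _ hx => ?_)
      rw [isRoot_linear, Complex.ofReal_inj] at hx
      rw [hx, DirectedSubset.linePlus, if_pos rfl, hn]
      exact ((hT a).mem_ups_iff hroot').1 ((hu n).1 ((hS.mem_ups_iff hroot).2 h) a)
    · rw [show factor hk S i j a = modMinus (hk a) from
        (if_neg (by omega)).trans ((if_neg (by omega)).trans (if_neg (by rw [hn, h]; simp)))]
      refine nonempty_equiv_of_eq _ _ ((hT a).ext_of_underlying (admissible_lineMinus (hk a))
        (by rw [h6, underlying_lineMinus]) fun x _ hx => ?_)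
      rw [isRoot_linear, Complex.ofReal_inj] at hx
      rw [hx, DirectedSubset.lineMinus, if_pos rfl, hn]
      exact ((hT a).mem_downs_iff hroot').1 ((hd n).1 ((hS.mem_downs_iff hroot).2 h) a)

end

/-- The classification of the indecomposable weight modules and their tensor decomposition. -/
theorem classification {r : ℕ} {k : Fin r → ℝ} {m : Fin r → ℕ} (hk : ∀ a, IsHalfInt (k a))
    (hmono : StrictMono k) (hm : ∀ a, 0 < m a) {t : ℂ[X]}
    (htk : t = ∏ a, (X - C (k a : ℂ)) ^ m a) (M : ModuleCat.{u} (GWA t)) (hM : IsWeightModule M)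
    (hind : CategoryTheory.Indecomposable M) :
    (∃! S : DirectedSubset, ∃ hS : IsAdmissible t S,
      S.Connected ∧ Nonempty (M ≃ₗ[GWA t] moduleOf hS)) ∧
    ∀ (S : DirectedSubset) (hS : IsAdmissible t S), S.Connected →
      Nonempty (M ≃ₗ[GWA t] moduleOf hS) →
      ∃ i j : ℕ, i < j ∧ j ≤ r + 1 ∧
        S.underlying = {x : ℝ | extRoot k i < (x : EReal) ∧ (x : EReal) < extRoot k j} ∧
        (∀ a, IsWeightModule (factor hk S i j a) ∧
          CategoryTheory.Indecomposable (factor hk S i j a)) ∧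
        IsoTo M (tensorPowers (factor hk S i j) m) ∧
        (∀ N : (a : Fin r) → ModuleCat.{v} (GWA (X - C (k a : ℂ))),
          (∀ a, IsWeightModule (N a) ∧ CategoryTheory.Indecomposable (N a)) →
          IsoTo M (tensorPowers N m) →
          ∀ a : Fin r, i ≤ (a : ℕ) + 1 → (a : ℕ) + 1 ≤ j →
            Nonempty (N a ≃ₗ[GWA (X - C (k a : ℂ))] factor hk S i j a)) ∧
        (∀ N : (a : Fin r) → ModuleCat.{0} (GWA (X - C (k a : ℂ))),
          (∀ a : Fin r, N a = factor hk S i j a ∨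
            (((a : ℕ) + 1 < i ∨ j < (a : ℕ) + 1) ∧
              (N a = modPlus (hk a) ∨ N a = modMinus (hk a)))) →
          IsoTo M (tensorPowers N m)) := by
  have hmonic : t.Monic := by
    rw [htk]
    exact monic_prod_of_monic _ _ fun a _ => (monic_X_sub_C _).pow _
  have hrootC : ∀ c : ℂ, t.IsRoot c ↔ ∃ a, c = k a := by
    intro c
    rw [htk, IsRoot.def, eval_prod, Finset.prod_eq_zero_iff]
    simp [(hm _).ne', sub_eq_zero]
  have hroot : ∀ c : ℂ, t.IsRoot c → ∃ k : ℝ, IsHalfInt k ∧ c = k := by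
    intro c hc
    obtain ⟨a, ha⟩ := (hrootC c).1 hc
    exact ⟨k a, hk a, ha⟩
  have ht : ∀ c : ℝ, t.IsRoot (c : ℂ) ↔ ∃ a, c = k a := by
    intro c
    simp only [hrootC, Complex.ofReal_inj]
  refine ⟨?_, fun S hS hc hf => ?_⟩
  · obtain ⟨S, hS, hc, hf⟩ := exists_equiv_moduleOf hmonic hroot hM hind
    refine ⟨S, ⟨hS, hc, hf⟩, ?_⟩
    rintro S' ⟨hS', -, ⟨f'⟩⟩
    obtain ⟨f⟩ := hf
    exact hS'.eq_of_equiv hS f' f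
  · obtain ⟨f⟩ := hf
    obtain ⟨i, j, hij, hj, hund⟩ := exists_bounds hmono ht hS hc
    have hdir : ∀ a : Fin r, i < (a : ℕ) + 1 → (a : ℕ) + 1 < j → S.IsDirectedAt (k a) := by
      intro a hi hj
      refine (hS.directed _).2 ⟨(hund _).2 ⟨fun b hb => hmono (Fin.lt_def.2 (by omega)),
        fun b hb => hmono (Fin.lt_def.2 (by omega))⟩, (ht _).2 ⟨a, rfl⟩⟩
    -- Proved for all families satisfying `IsFactorSet`, so that it gives both the decomposition
    -- itself and the replacement of the outer factors.
    have hiso : ∀ (N : (a : Fin r) → ModuleCat.{0} (GWA (X - C (k a : ℂ))))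
        (T : Fin r → DirectedSubset) (hT : ∀ a, IsAdmissible (X - C (k a : ℂ)) (T a)),
        (∀ a, N a = moduleOf (hT a) ∧ IsFactorSet k S i j a (T a)) →
        IsoTo M (tensorPowers N m) := by
      intro N T hT hN
      have hw := weights_eq_of_isFactorSet hmono hij hj hund fun a => (hN a).2
      have hd : ∀ a, k a ∈ S.underlying → T a (k a) = S (k a) := by
        intro a ha
        refine (hN a).2.mid ?_ ?_
        · by_contra hi
          exact lt_irrefl _ (((hund _).1 ha).1 a (by omega))
        · by_contra hi
          exact lt_irrefl _ (((hund _).1 ha).2 a (by omega))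
      refine isoTo_of_thin hS hc f (by rw [param_tensorPowers, htk]) ?_
      refine (thin_tensorPowers N m hm (fun a => weights (T a)) (fun a => ups (T a))
        (fun a => downs (T a)) fun a => ?_).of_iff (fun n => (hw n).symm)
        (fun n => (ups_eq_of_factors ht hS hT hd hw n).symm)
        (fun n => (downs_eq_of_factors ht hS hT hd hw n).symm)
      rw [(hN a).1]
      exact thin_moduleOf (hT a)
    choose T hT hTc hTf hTs using fun a => exists_factor_eq hk hij a (hdir a)
    refine ⟨i, j, hij, hj, ?_, ?_, ?_, ?_, ?_⟩
    · ext x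
      rw [hund, Set.mem_ofPred_eq, extRoot_lt_iff hmono (by omega), lt_extRoot_iff hmono (by omega)]
    · intro a
      rw [hTf]
      exact ⟨(hT a).isWeightModule, (hT a).indecomposable (hTc a)⟩
    · exact hiso _ T hT fun a => ⟨hTf a, hTs a⟩
    · intro N hN hMN a hia haj
      -- By the classification for linear polynomials each `N a` has a directed subset, so
      -- uniqueness becomes a comparison of invariants.
      choose T' hT' hc' hf' using fun a => exists_equiv_moduleOf (monic_X_sub_C (k a : ℂ))
        (fun c hc => ⟨k a, hk a, (isRoot_linear c).1 hc⟩) (hN a).1 (hN a).2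
      have h1 := thin_tensorPowers N m hm (fun a => weights (T' a)) (fun a => ups (T' a))
        (fun a => downs (T' a)) fun a => (thin_moduleOf (hT' a)).congr (hf' a).some.symm
      obtain ⟨h2, h3, h4⟩ := (hMN.thin ((thin_moduleOf hS).congr f.symm)).eq h1
      obtain ⟨g⟩ := factor_unique hk hmono ht hS hij hund hT' hc' (fun n => by rw [h2]; rfl)
        (fun n => by rw [h3]; rfl) (fun n => by rw [h4]; rfl) a hia haj
      exact ⟨(hf' a).some.trans g⟩
    · intro N hN
      -- For a root strictly outside `k_i` and `k_j` the conditions `lower`, `upper` and `mid` are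
      -- vacuous, so either line is allowed.
      have h1 : ∀ a, ∃ (T : DirectedSubset) (hT : IsAdmissible (X - C (k a : ℂ)) T),
          N a = moduleOf hT ∧ IsFactorSet k S i j a T := by
        intro a
        rcases hN a with h | ⟨h, h' | h'⟩
        · exact ⟨T a, hT a, h.trans (hTf a), hTs a⟩
        · exact ⟨_, admissible_linePlus (hk a), h',
            isFactorSet_linePlus (by omega) (by omega) (by omega)⟩
        · exact ⟨_, admissible_lineMinus (hk a), h',
            isFactorSet_lineMinus (by omega) (by omega) (by omega)⟩
      choose T' hT' hN' using h1
      exact hiso N T' hT' hN'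

/-! ### The Weyl algebra -/

section

variable {A : Type u} [Ring A] [Algebra ℂ A]

/-- The rule for moving `a` past a polynomial is multiplicative in the polynomial, so the relation
for `z` alone implies it. This leaves four identities to check when mapping out of `A(t)`. -/
theorem mul_aeval_of_comm {a Z : A} {c : ℂ} (h : a * Z = (Z - algebraMap ℂ A c) * a) (p : ℂ[X]) :
    a * aeval Z p = aeval Z (shift c p) * a := by
  induction p using Polynomial.induction_on with
  | C b => rw [aeval_C, GWAAction.shift_C, aeval_C, Algebra.commutes]
  | add p q hp hq => rw [map_add, mul_add, hp, hq, map_add, map_add, add_mul]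
  | monomial n b ih =>
    have h1 : shift c X = X - C c := aeval_X _
    rw [pow_succ, ← mul_assoc, map_mul, ← mul_assoc, ih, mul_assoc, aeval_X, h, map_mul (shift c) _ X,
      map_mul (aeval Z) _ (shift c X), h1, map_sub (aeval Z : ℂ[X] →ₐ[ℂ] A), aeval_X, aeval_C, mul_assoc]

theorem aeval_shift_linear (Z : A) (k c : ℂ) :
    aeval Z (shift c (X - C k)) = Z - algebraMap ℂ A (c + k) := by
  have h1 : shift c (X - C k) = X - C (c + k) := by
    rw [map_sub, GWAAction.shift_C, C_add, shift, aeval_X]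
    ring
  rw [h1, map_sub, aeval_X, aeval_C]

/-- The universal property of `A(t)`. -/
def GWA.lift (t : ℂ[X]) (Z P Q : A) (h1 : P * Z = (Z - algebraMap ℂ A 1) * P)
    (h2 : Q * Z = (Z - algebraMap ℂ A (-1)) * Q) (h3 : P * Q = aeval Z (shift (1 / 2) t))
    (h4 : Q * P = aeval Z (shift (-1 / 2) t)) : GWA t →ₐ[ℂ] A :=
  let g : Gen → A := fun | Gen.z => Z | Gen.xp => P | Gen.xm => Q
  have hg : ∀ p, FreeAlgebra.lift ℂ g (freePoly p) = aeval Z p := fun p => by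
    rw [freePoly, ← aeval_algHom_apply, FreeAlgebra.lift_ι_apply]
  RingQuot.liftAlgHom ℂ ⟨FreeAlgebra.lift ℂ g, by
    intro a b h
    cases h with
    | xp_comm p =>
      rw [map_mul, map_mul, hg, hg, FreeAlgebra.lift_ι_apply]
      exact mul_aeval_of_comm h1 p
    | xm_comm p =>
      rw [map_mul, map_mul, hg, hg, FreeAlgebra.lift_ι_apply]
      exact mul_aeval_of_comm h2 p
    | xp_xm =>
      rw [map_mul, hg, FreeAlgebra.lift_ι_apply, FreeAlgebra.lift_ι_apply]
      exact h3
    | xm_xp =>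
      rw [map_mul, hg, FreeAlgebra.lift_ι_apply, FreeAlgebra.lift_ι_apply]
      exact h4⟩

variable {t : ℂ[X]} {Z P Q : A} {h1 : P * Z = (Z - algebraMap ℂ A 1) * P}
    {h2 : Q * Z = (Z - algebraMap ℂ A (-1)) * Q} {h3 : P * Q = aeval Z (shift (1 / 2) t)}
    {h4 : Q * P = aeval Z (shift (-1 / 2) t)}

theorem GWA.lift_z : GWA.lift t Z P Q h1 h2 h3 h4 (GWA.z t) = Z := by
  rw [GWA.lift, GWA.z, GWA.gen, RingQuot.liftAlgHom_mkAlgHom_apply, FreeAlgebra.lift_ι_apply]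

theorem GWA.lift_xp : GWA.lift t Z P Q h1 h2 h3 h4 (GWA.xp t) = P := by
  rw [GWA.lift, GWA.xp, GWA.gen, RingQuot.liftAlgHom_mkAlgHom_apply, FreeAlgebra.lift_ι_apply]

theorem GWA.lift_xm : GWA.lift t Z P Q h1 h2 h3 h4 (GWA.xm t) = Q := by
  rw [GWA.lift, GWA.xm, GWA.gen, RingQuot.liftAlgHom_mkAlgHom_apply, FreeAlgebra.lift_ι_apply]

end

theorem weylD_mul_weylX : weylD * weylX = weylX * weylD + 1 := by
  have h := RingQuot.mkAlgHom_rel ℂ WeylRel.comm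
  rwa [map_mul, map_add, map_mul, map_one] at h

/-- The image of `z` in the Weyl algebra. -/
def weylZ (k : ℂ) : WeylAlgebra :=
  (1 / 2 : ℂ) • (weylX * weylD + weylD * weylX) + algebraMap ℂ WeylAlgebra k

/-- Symmetrising contributes `1/2`, which compensates for the half shifts: `X⁺ X⁻ = z - 1/2 - k`
goes to `x ∂`, and `X⁻ X⁺ = z + 1/2 - k` goes to `x ∂ + 1`. -/
theorem weylZ_eq (k : ℂ) : weylZ k = weylX * weylD + algebraMap ℂ WeylAlgebra (1 / 2 + k) := by
  rw [weylZ, weylD_mul_weylX, map_add, Algebra.algebraMap_eq_smul_one (1 / 2 : ℂ)]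
  match_scalars <;> norm_num

/-- The algebra homomorphism `A(z - k) → A₁(ℂ)`. -/
def gwaToWeyl (k : ℂ) : GWA (X - C k) →ₐ[ℂ] WeylAlgebra :=
  GWA.lift (X - C k) (weylZ k) weylX weylD
    (by
      have h := Algebra.commutes (A := WeylAlgebra) (1 / 2 + k) weylX
      rw [weylZ_eq, mul_add, sub_mul, add_mul, h, mul_assoc, weylD_mul_weylX, map_one, mul_add]
      simp only [mul_one, one_mul]
      abel)
    (by
      have h := Algebra.commutes (A := WeylAlgebra) (1 / 2 + k) weylD
      rw [map_neg, map_one, sub_neg_eq_add, weylZ_eq, mul_add, add_mul, add_mul, h, ← mul_assoc,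
        weylD_mul_weylX, add_mul]
      simp only [one_mul]
      abel)
    (by
      rw [aeval_shift_linear, weylZ_eq, add_sub_cancel_right])
    (by
      rw [aeval_shift_linear, weylZ_eq, weylD_mul_weylX, add_sub_assoc, ← map_sub,
        show (1 / 2 + k - (-1 / 2 + k) : ℂ) = 1 by ring, map_one])

/-- The algebra homomorphism `A₁(ℂ) → A(z - k)`. -/
def weylToGWA (k : ℂ) : WeylAlgebra →ₐ[ℂ] GWA (X - C k) :=
  RingQuot.liftAlgHom ℂ ⟨FreeAlgebra.lift ℂ fun b => bif b then GWA.xm _ else GWA.xp _, by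
    intro a b h
    cases h
    rw [map_mul, map_add, map_mul, map_one, FreeAlgebra.lift_ι_apply, FreeAlgebra.lift_ι_apply,
      cond_true, cond_false, GWA.xm_mul_xp, GWA.xp_mul_xm, GWA.poly, aeval_shift_linear,
      aeval_shift_linear, sub_add, ← map_one (algebraMap ℂ (GWA (X - C k))), ← map_sub]
    congr 2
    ring⟩

theorem weylToGWA_weylX (k : ℂ) : weylToGWA k weylX = GWA.xp _ := by
  rw [weylToGWA, weylX, RingQuot.liftAlgHom_mkAlgHom_apply, FreeAlgebra.lift_ι_apply, cond_false]

theorem weylToGWA_weylD (k : ℂ) : weylToGWA k weylD = GWA.xm _ := by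
  rw [weylToGWA, weylD, RingQuot.liftAlgHom_mkAlgHom_apply, FreeAlgebra.lift_ι_apply, cond_true]

theorem gwaToWeyl_xp (k : ℂ) : gwaToWeyl k (GWA.xp _) = weylX := GWA.lift_xp

theorem gwaToWeyl_xm (k : ℂ) : gwaToWeyl k (GWA.xm _) = weylD := GWA.lift_xm

theorem gwaToWeyl_z (k : ℂ) : gwaToWeyl k (GWA.z _) = weylZ k := GWA.lift_z

/-- `A(z - k)` is the Weyl algebra. -/
def gwaEquivWeyl (k : ℂ) : GWA (X - C k) ≃ₐ[ℂ] WeylAlgebra :=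
  AlgEquiv.ofAlgHom (gwaToWeyl k) (weylToGWA k)
    (by
      apply RingQuot.ringQuot_ext'
      apply FreeAlgebra.hom_ext
      funext b
      cases b
      · exact (congrArg (gwaToWeyl k) (weylToGWA_weylX k)).trans (gwaToWeyl_xp k)
      · exact (congrArg (gwaToWeyl k) (weylToGWA_weylD k)).trans (gwaToWeyl_xm k))
    (by
      apply RingQuot.ringQuot_ext'
      apply FreeAlgebra.hom_ext
      funext g
      cases g
      -- The generator `z` is recovered as `X⁺ X⁻ + 1/2 + k`.
      · refine (congrArg (weylToGWA k) (gwaToWeyl_z k)).trans ?_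
        rw [weylZ_eq, map_add, map_mul, weylToGWA_weylX, weylToGWA_weylD, GWA.xp_mul_xm, GWA.poly,
          aeval_shift_linear, AlgHom.commutes, sub_add_cancel]
        rfl
      · exact (congrArg (weylToGWA k) (gwaToWeyl_xp k)).trans (weylToGWA_weylX k)
      · exact (congrArg (weylToGWA k) (gwaToWeyl_xm k)).trans (weylToGWA_weylD k))

/-! ### Highest weight modules over `sl₂` -/

/-- The element `e` of `U(sl₂)`. -/
def envE : Usl2 := UniversalEnvelopingAlgebra.ι ℂ sl2e

/-- The element `f` of `U(sl₂)`. -/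
def envF : Usl2 := UniversalEnvelopingAlgebra.ι ℂ sl2f

/-- The element `h` of `U(sl₂)`. -/
def envH : Usl2 := UniversalEnvelopingAlgebra.ι ℂ sl2h

theorem sl2_eq (A : sl2) : A = A.1 0 1 • sl2e + A.1 1 0 • sl2f + A.1 0 0 • sl2h := by
  have hA : A.1 1 1 = - A.1 0 0 := by
    have h : Matrix.trace A.1 = 0 := A.2
    rw [Matrix.trace_fin_two] at h
    linear_combination h
  apply Subtype.ext
  change A.1 = A.1 0 1 • sl2e.1 + A.1 1 0 • sl2f.1 + A.1 0 0 • sl2h.1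
  ext i j
  fin_cases i <;> fin_cases j <;> simp [sl2e, sl2f, sl2h, hA]

theorem usl2_induction {P : Usl2 → Prop} (hC : ∀ c : ℂ, P (algebraMap ℂ _ c)) (he : P envE)
    (hf : P envF) (hh : P envH) (hmul : ∀ a b, P a → P b → P (a * b))
    (hadd : ∀ a b, P a → P b → P (a + b)) (a : Usl2) : P a := by
  have hsurj : Function.Surjective (UniversalEnvelopingAlgebra.mkAlgHom ℂ sl2) :=
    RingCon.mkₐ_surjective _
  have hsmul : ∀ (c : ℂ) a, P a → P (c • a) := fun c a ha => by
    rw [Algebra.smul_def]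
    exact hmul _ _ (hC c) ha
  obtain ⟨a, rfl⟩ := hsurj a
  induction a using TensorAlgebra.induction with
  | algebraMap c => rw [AlgHom.commutes]; exact hC c
  | ι A =>
    rw [← UniversalEnvelopingAlgebra.ι_apply, sl2_eq A, map_add, map_add, map_smul, map_smul,
      map_smul]
    exact hadd _ _ (hadd _ _ (hsmul _ _ he) (hsmul _ _ hf)) (hsmul _ _ hh)
  | mul a b ha hb => rw [map_mul]; exact hmul _ _ ha hb
  | add a b ha hb => rw [map_add]; exact hadd _ _ ha hb

section

attribute [local instance] LieRing.ofAssociativeRing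

theorem env_lie {A B D : sl2} (h : ⁅A, B⁆ = D) :
    UniversalEnvelopingAlgebra.ι ℂ A * UniversalEnvelopingAlgebra.ι ℂ B =
      UniversalEnvelopingAlgebra.ι ℂ B * UniversalEnvelopingAlgebra.ι ℂ A +
        UniversalEnvelopingAlgebra.ι ℂ D := by
  rw [← h, LieHom.map_lie, Ring.lie_def]
  abel

end

theorem envE_mul_envF : envE * envF = envF * envE + envH := by
  apply env_lie
  apply Subtype.ext
  rw [LieAlgebra.SpecialLinear.sl_bracket]
  ext i j
  fin_cases i <;> fin_cases j <;> simp [sl2e, sl2f, sl2h]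

theorem envH_mul_envE : envH * envE = envE * envH + (2 : ℂ) • envE := by
  rw [envE, ← map_smul]
  apply env_lie
  apply Subtype.ext
  rw [LieAlgebra.SpecialLinear.sl_bracket]
  change _ = (2 : ℂ) • sl2e.1
  ext i j
  fin_cases i <;> fin_cases j <;> simp [sl2e, sl2h]
  norm_num

theorem envH_mul_envF : envH * envF = envF * envH + (-2 : ℂ) • envF := by
  rw [envF, ← map_smul]
  apply env_lie
  apply Subtype.ext
  rw [LieAlgebra.SpecialLinear.sl_bracket]
  change _ = (-2 : ℂ) • sl2f.1
  ext i j
  fin_cases i <;> fin_cases j <;> simp [sl2f, sl2h]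
  norm_num

theorem pow_smul_eq_zero_of_le {R : Type u} {W : Type v} [Semiring R] [AddCommMonoid W] [Module R W]
    {a : R} {w : W} {d : ℕ} (hd : a ^ d • w = 0) {j : ℕ} (hj : d ≤ j) : a ^ j • w = 0 := by
  obtain ⟨i, rfl⟩ := Nat.exists_eq_add_of_le' hj
  rw [pow_add, mul_smul, hd, smul_zero]

section

variable {W : Type u} [AddCommGroup W] [Module ℂ W] [Module Usl2 W] [IsScalarTower ℂ Usl2 W]

theorem usl2_smul_comm (a : Usl2) (c : ℂ) (w : W) : a • c • w = c • a • w := by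
  rw [← algebraMap_smul Usl2 c w, ← algebraMap_smul Usl2 c (a • w), smul_smul, smul_smul,
    Algebra.commutes]

variable (W) in
/-- The action of an element of `U(sl₂)` as a complex linear map. -/
def opS (a : Usl2) : W →ₗ[ℂ] W where
  toFun w := a • w
  map_add' := smul_add a
  map_smul' c w := usl2_smul_comm a c w

@[simp]
theorem opS_apply (a : Usl2) (w : W) : opS W a w = a • w := rfl

/-- `w` is a highest weight vector of weight `c`, or zero. -/
structure IsHighest (w : W) (c : ℂ) : Prop where
  e_smul : envE • w = 0
  h_smul : envH • w = c • w

namespace IsHighest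

variable {w : W} {c : ℂ} (hw : IsHighest w c)

include hw

theorem h_pow (j : ℕ) : envH • envF ^ j • w = (c - 2 * j) • envF ^ j • w := by
  induction j with
  | zero => simpa using hw.h_smul
  | succ j ih =>
    rw [pow_succ', mul_smul, smul_smul envH, envH_mul_envF, add_smul, mul_smul, ih, smul_assoc,
      usl2_smul_comm, ← add_smul]
    congr 1
    push_cast
    ring

/-- Moving `e` past the factors `f` collects the weights `c, c - 2, …, c - 2j`, whose sum is `(j +
1)(c - j)`. -/
theorem e_pow (j : ℕ) : envE • envF ^ (j + 1) • w = ((j + 1) * (c - j)) • envF ^ j • w := by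
  induction j with
  | zero =>
    rw [zero_add, pow_one, smul_smul, envE_mul_envF, add_smul, mul_smul, hw.e_smul, hw.h_smul]
    simp
  | succ j ih =>
    rw [pow_succ', mul_smul, smul_smul envE, envE_mul_envF, add_smul, mul_smul, ih, usl2_smul_comm,
      hw.h_pow, smul_smul envF, ← pow_succ', ← add_smul]
    congr 1
    push_cast
    ring

/-- The vectors `f^j w` span a submodule. -/
theorem smul_mem_span (a : Usl2) {v : W}
    (hv : v ∈ Submodule.span ℂ (Set.range fun j : ℕ => envF ^ j • w)) :
    a • v ∈ Submodule.span ℂ (Set.range fun j : ℕ => envF ^ j • w) := by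
  have key : ∀ b : Usl2, (∀ j : ℕ, b • envF ^ j • w ∈
      Submodule.span ℂ (Set.range fun j : ℕ => envF ^ j • w)) →
      ∀ v ∈ Submodule.span ℂ (Set.range fun j : ℕ => envF ^ j • w),
        b • v ∈ Submodule.span ℂ (Set.range fun j : ℕ => envF ^ j • w) := by
    intro b hb v hv
    have := Submodule.map_span_le (opS W b) (Set.range fun j : ℕ => envF ^ j • w)
      (Submodule.span ℂ (Set.range fun j : ℕ => envF ^ j • w))
    refine this.2 ?_ ⟨v, hv, rfl⟩
    rintro _ ⟨j, rfl⟩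
    exact hb j
  have hmem : ∀ j : ℕ, envF ^ j • w ∈ Submodule.span ℂ (Set.range fun j : ℕ => envF ^ j • w) :=
    fun j => Submodule.subset_span ⟨j, rfl⟩
  induction a using usl2_induction generalizing v with
  | hC c =>
    rw [algebraMap_smul]
    exact Submodule.smul_mem _ _ hv
  | he =>
    refine key _ (fun j => ?_) v hv
    rcases j with _ | j
    · rw [pow_zero, one_smul, hw.e_smul]
      exact zero_mem _
    · rw [hw.e_pow]
      exact Submodule.smul_mem _ _ (hmem j)
  | hf =>
    refine key _ (fun j => ?_) v hv
    rw [smul_smul, ← pow_succ']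
    exact hmem _
  | hh =>
    refine key _ (fun j => ?_) v hv
    rw [hw.h_pow]
    exact Submodule.smul_mem _ _ (hmem j)
  | hmul a b ha hb => rw [mul_smul]; exact ha (hb hv)
  | hadd a b ha hb => rw [add_smul]; exact add_mem (ha hv) (hb hv)

end IsHighest

/-- The generator of the Verma module. -/
def vermaVec (c : ℂ) : Verma c := Submodule.Quotient.mk 1

theorem smul_vermaVec (c : ℂ) (a : Usl2) : a • vermaVec c = Submodule.Quotient.mk a := by
  rw [vermaVec, ← Submodule.Quotient.mk_smul, smul_eq_mul, mul_one]

theorem isHighest_vermaVec (c : ℂ) : IsHighest (vermaVec c) c where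
  e_smul := by
    rw [smul_vermaVec, Submodule.Quotient.mk_eq_zero]
    exact Submodule.subset_span (by simp [envE])
  h_smul := by
    rw [← algebraMap_smul Usl2 c, smul_vermaVec, smul_vermaVec, Submodule.Quotient.eq]
    exact Submodule.subset_span (by simp [envH])

theorem span_verma (c : ℂ) :
    Submodule.span ℂ (Set.range fun j : ℕ => envF ^ j • vermaVec c) = ⊤ := by
  rw [Submodule.eq_top_iff']
  intro x
  obtain ⟨a, rfl⟩ := Submodule.Quotient.mk_surjective _ x
  rw [← smul_vermaVec]
  exact (isHighest_vermaVec c).smul_mem_span a (Submodule.subset_span ⟨0, by simp⟩)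

namespace IsHighest

variable {w : W} {c : ℂ} (hw : IsHighest w c)

/-- The homomorphism from the Verma module to a module with a highest weight vector. -/
def vermaHom : Verma c →ₗ[Usl2] W :=
  Submodule.liftQ _ (LinearMap.toSpanSingleton Usl2 W w) (by
    rw [Submodule.span_le]
    rintro a (rfl | rfl)
    · exact hw.e_smul
    · change (envH - algebraMap ℂ Usl2 c) • w = 0
      rw [sub_smul, hw.h_smul, algebraMap_smul, sub_self])

include hw

theorem vermaHom_smul (a : Usl2) : hw.vermaHom (a • vermaVec c) = a • w := by
  rw [smul_vermaVec]
  rfl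

theorem vermaHom_scalar (b : ℂ) (x : Verma c) : hw.vermaHom (b • x) = b • hw.vermaHom x := by
  rw [← algebraMap_smul Usl2 b x, map_smul, algebraMap_smul]

theorem vermaHom_sum (b : ℕ →₀ ℂ) :
    hw.vermaHom (b.sum fun j y => y • envF ^ j • vermaVec c) =
      b.sum fun j y => y • envF ^ j • w := by
  rw [Finsupp.sum, map_sum]
  exact Finset.sum_congr rfl fun j _ => by rw [hw.vermaHom_scalar, hw.vermaHom_smul]

theorem vermaHom_surjective
    (hspan : Submodule.span ℂ (Set.range fun j : ℕ => envF ^ j • w) = ⊤) :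
    Function.Surjective hw.vermaHom := by
  intro v
  have hv : v ∈ Submodule.span ℂ (Set.range fun j : ℕ => envF ^ j • w) :=
    hspan ▸ Submodule.mem_top
  obtain ⟨b, rfl⟩ := Finsupp.mem_span_range_iff_exists_finsupp.1 hv
  exact ⟨_, hw.vermaHom_sum b⟩

/-- A module with a highest weight vector `w` whose descendants `f^j w` form a basis is a Verma
module. -/
theorem nonempty_verma_equiv
    (hspan : Submodule.span ℂ (Set.range fun j : ℕ => envF ^ j • w) = ⊤)
    (hne : ∀ j : ℕ, envF ^ j • w ≠ 0) : Nonempty (Verma c ≃ₗ[Usl2] W) := by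
  have hli : LinearIndependent ℂ fun j : ℕ => envF ^ j • w := by
    refine Module.End.eigenvectors_linearIndependent' (opS W envH) (fun j : ℕ => c - 2 * j)
      (fun i j h => by simpa using h) _ fun j => ?_
    rw [Module.End.hasEigenvector_iff, Module.End.mem_eigenspace_iff, opS_apply]
    exact ⟨hw.h_pow j, hne j⟩
  refine ⟨LinearEquiv.ofBijective hw.vermaHom ⟨?_, hw.vermaHom_surjective hspan⟩⟩
  rw [injective_iff_map_eq_zero]
  intro x hx
  have hx' : x ∈ Submodule.span ℂ (Set.range fun j : ℕ => envF ^ j • vermaVec c) :=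
    span_verma c ▸ Submodule.mem_top
  obtain ⟨b, rfl⟩ := Finsupp.mem_span_range_iff_exists_finsupp.1 hx'
  rw [hw.vermaHom_sum] at hx
  have hb : b = 0 := linearIndependent_iff.1 hli b hx
  rw [hb, Finsupp.sum_zero_index]

theorem linearIndependent_fin {d : ℕ} (hne : ∀ j < d, envF ^ j • w ≠ 0) :
    LinearIndependent ℂ fun j : Fin d => envF ^ (j : ℕ) • w := by
  refine Module.End.eigenvectors_linearIndependent' (opS W envH) (fun j : Fin d => c - 2 * (j : ℕ))
    (fun i j h => Fin.ext (by simpa using h)) _ fun j => ?_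
  rw [Module.End.hasEigenvector_iff, Module.End.mem_eigenspace_iff, opS_apply]
  exact ⟨hw.h_pow j, hne j j.2⟩

/-- The nonzero vectors `f^j w` have distinct weights and are independent, so the kernel is spanned
by the `f^j` with `j ≥ d`. It depends only on `d`, which makes two such quotients of a Verma module
isomorphic. -/
theorem vermaHom_eq_zero_iff {d : ℕ} (hd : envF ^ d • w = 0) (hne : ∀ j < d, envF ^ j • w ≠ 0)
    (b : ℕ →₀ ℂ) :
    hw.vermaHom (b.sum fun j y => y • envF ^ j • vermaVec c) = 0 ↔ ∀ j < d, b j = 0 := by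
  have hli := hw.linearIndependent_fin hne
  have h1 : (b.sum fun j y => y • envF ^ j • w) = ∑ j : Fin d, b j • envF ^ (j : ℕ) • w := by
    rw [Fin.sum_univ_eq_sum_range (fun j => b j • envF ^ j • w)]
    rw [Finsupp.sum_of_support_subset b (Finset.subset_union_left (s₂ := Finset.range d))
      (fun j y => y • envF ^ j • w) (fun j _ => zero_smul ℂ _)]
    refine (Finset.sum_subset Finset.subset_union_right fun j _ hj => ?_).symm
    rw [pow_smul_eq_zero_of_le hd (by simpa using hj), smul_zero]
  rw [hw.vermaHom_sum, h1]
  constructor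
  · intro h j hj
    exact Fintype.linearIndependent_iff.1 hli (fun j => b j) h ⟨j, hj⟩
  · intro h
    exact Finset.sum_eq_zero fun j _ => by rw [h j j.2, zero_smul]

end IsHighest

end

/-! ### Finite-dimensional simple `sl₂`-modules -/

theorem exists_pow_smul_ne_zero {R : Type u} {W : Type v} [Semiring R] [AddCommMonoid W] [Module R W]
    {a : R} {w : W} (h0 : w ≠ 0) (h : ∃ n : ℕ, a ^ n • w = 0) :
    ∃ n : ℕ, a ^ n • w ≠ 0 ∧ a ^ (n + 1) • w = 0 :=
  Nat.exists_not_and_succ_of_not_zero_of_exists (by rwa [pow_zero, one_smul]) h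

section

variable {W : Type u} [AddCommGroup W] [Module ℂ W] [Module Usl2 W] [IsScalarTower ℂ Usl2 W]

/-- Otherwise the vectors `a ^ j • w` would be infinitely many eigenvectors of `h` with distinct
eigenvalues. It is applied to both `e` and `f`. -/
theorem exists_pow_smul_eq_zero [FiniteDimensional ℂ W] {a : Usl2} {w : W} {μ : ℕ → ℂ}
    (hμ : Function.Injective μ) (h : ∀ j, envH • a ^ j • w = μ j • a ^ j • w) :
    ∃ n : ℕ, a ^ n • w = 0 := by
  by_contra! hne
  have hli : LinearIndependent ℂ fun j : ℕ => a ^ j • w := by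
    refine Module.End.eigenvectors_linearIndependent' (opS W envH) μ hμ _ fun j => ?_
    rw [Module.End.hasEigenvector_iff, Module.End.mem_eigenspace_iff, opS_apply]
    exact ⟨h j, hne j⟩
  have := hli.finite
  exact not_finite ℕ

variable (W) in
-- Start from an eigenvector of `h` and apply `e` as long as the result is nonzero; each application
-- raises the eigenvalue by `2`, so this stops.
theorem exists_isHighest [FiniteDimensional ℂ W] [Nontrivial W] :
    ∃ (w : W) (c : ℂ), w ≠ 0 ∧ IsHighest w c := by
  obtain ⟨μ, hμ⟩ := Module.End.exists_eigenvalue (opS W envH)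
  obtain ⟨w, hw⟩ := hμ.exists_hasEigenvector
  rw [Module.End.hasEigenvector_iff, Module.End.mem_eigenspace_iff, opS_apply] at hw
  have hpow : ∀ j : ℕ, envH • envE ^ j • w = (μ + 2 * j) • envE ^ j • w := by
    intro j
    induction j with
    | zero => simpa using hw.1
    | succ j ih =>
      rw [pow_succ', mul_smul, smul_smul envH, envH_mul_envE, add_smul, mul_smul, ih, smul_assoc,
        usl2_smul_comm, ← add_smul]
      congr 1
      push_cast
      ring
  obtain ⟨n, hn, hn'⟩ := exists_pow_smul_ne_zero hw.2
    (exists_pow_smul_eq_zero (fun i j h => by simpa using h) hpow)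
  refine ⟨envE ^ n • w, _, hn, ?_, hpow n⟩
  rw [smul_smul, ← pow_succ', hn']

namespace IsHighest

variable {w : W} {c : ℂ} (hw : IsHighest w c)

include hw

/-- The complex span of the `f^j w` is stable under `U(sl₂)`, hence a nonzero submodule of a simple
module. -/
theorem span_eq_top [IsSimpleModule Usl2 W] (h0 : w ≠ 0) :
    Submodule.span ℂ (Set.range fun j : ℕ => envF ^ j • w) = ⊤ := by
  let N : Submodule Usl2 W :=
    { Submodule.span ℂ (Set.range fun j : ℕ => envF ^ j • w) with
      smul_mem' := fun a _ hv => hw.smul_mem_span a hv }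
  have hwN : w ∈ N := Submodule.subset_span ⟨0, by simp⟩
  have hN : N = ⊤ := (eq_bot_or_eq_top N).resolve_left fun h => h0 (by simpa [h] using hwN)
  rw [Submodule.eq_top_iff']
  intro v
  have hv : v ∈ N := hN ▸ Submodule.mem_top
  exact hv

theorem finrank_eq (hspan : Submodule.span ℂ (Set.range fun j : ℕ => envF ^ j • w) = ⊤) {d : ℕ}
    (hd : envF ^ d • w = 0) (hne : ∀ j < d, envF ^ j • w ≠ 0) : Module.finrank ℂ W = d := by
  have hspan' : ⊤ ≤ Submodule.span ℂ (Set.range fun j : Fin d => envF ^ (j : ℕ) • w) := by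
    rw [← hspan, Submodule.span_le]
    rintro _ ⟨j, rfl⟩
    by_cases hj : j < d
    · exact Submodule.subset_span ⟨⟨j, hj⟩, rfl⟩
    · change envF ^ j • w ∈ _
      rw [pow_smul_eq_zero_of_le hd (not_lt.1 hj)]
      exact zero_mem _
  rw [Module.finrank_eq_card_basis (Module.Basis.mk (hw.linearIndependent_fin hne) hspan'),
    Fintype.card_fin]

/-- Two cyclic highest weight modules with the same weight and the same dimension are
isomorphic. -/
theorem nonempty_equiv {W' : Type v} [AddCommGroup W'] [Module ℂ W'] [Module Usl2 W']
    [IsScalarTower ℂ Usl2 W'] {w' : W'} (hw' : IsHighest w' c)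
    (hspan : Submodule.span ℂ (Set.range fun j : ℕ => envF ^ j • w) = ⊤)
    (hspan' : Submodule.span ℂ (Set.range fun j : ℕ => envF ^ j • w') = ⊤) {d : ℕ}
    (hd : envF ^ d • w = 0) (hne : ∀ j < d, envF ^ j • w ≠ 0)
    (hd' : envF ^ d • w' = 0) (hne' : ∀ j < d, envF ^ j • w' ≠ 0) :
    Nonempty (W ≃ₗ[Usl2] W') := by
  have hker : LinearMap.ker hw.vermaHom = LinearMap.ker hw'.vermaHom := by
    ext x
    have hx : x ∈ Submodule.span ℂ (Set.range fun j : ℕ => envF ^ j • vermaVec c) :=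
      span_verma c ▸ Submodule.mem_top
    obtain ⟨b, rfl⟩ := Finsupp.mem_span_range_iff_exists_finsupp.1 hx
    rw [LinearMap.mem_ker, LinearMap.mem_ker, hw.vermaHom_eq_zero_iff hd hne,
      hw'.vermaHom_eq_zero_iff hd' hne']
  exact ⟨(hw.vermaHom.quotKerEquivOfSurjective (hw.vermaHom_surjective hspan)).symm.trans
    ((Submodule.quotEquivOfEq _ _ hker).trans
      (hw'.vermaHom.quotKerEquivOfSurjective (hw'.vermaHom_surjective hspan')))⟩

end IsHighest

variable (W) in
theorem exists_isHighest_of_simple [FiniteDimensional ℂ W] [IsSimpleModule Usl2 W] :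
    ∃ w : W, IsHighest w (Module.finrank ℂ W - 1) ∧
      Submodule.span ℂ (Set.range fun j : ℕ => envF ^ j • w) = ⊤ ∧
      envF ^ Module.finrank ℂ W • w = 0 ∧ ∀ j < Module.finrank ℂ W, envF ^ j • w ≠ 0 := by
  have := IsSimpleModule.nontrivial Usl2 W
  obtain ⟨w, c, h0, hw⟩ := exists_isHighest W
  obtain ⟨n, hn, hn'⟩ := exists_pow_smul_ne_zero h0
    (exists_pow_smul_eq_zero (fun i j h => by simpa using h) hw.h_pow)
  have hne : ∀ j < n + 1, envF ^ j • w ≠ 0 := fun j hj h =>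
    hn (pow_smul_eq_zero_of_le h (Nat.lt_succ_iff.1 hj))
  have hspan := hw.span_eq_top h0
  have hfin := hw.finrank_eq hspan hn' hne
  -- Applying `e` to `f^(n+1) w = 0` gives `(n + 1)(c - n) f^n w = 0`, and `f^n w` is nonzero.
  have hc : c = n := by
    have h1 := hw.e_pow n
    rw [hn', smul_zero] at h1
    rcases mul_eq_zero.1 ((smul_eq_zero.1 h1.symm).resolve_right hn) with h2 | h2
    · exact absurd h2 (Nat.cast_add_one_ne_zero n)
    · exact sub_eq_zero.1 h2
  rw [hfin]
  refine ⟨w, ?_, hspan, hn', hne⟩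
  rw [Nat.cast_succ, add_sub_cancel_right, ← hc]
  exact hw

end

/-! ### Thin modules as `sl₂`-modules -/

section

variable {k l : ℂ} (T : ModuleCat.{u} (GWA (quad k l)))

instance scalarSl2 : Module ℂ (toSl2 T) := Module.compHom (toSl2 T) (algebraMap ℂ Usl2)

instance : IsScalarTower ℂ Usl2 (toSl2 T) := by
  refine ⟨fun c a w => ?_⟩
  rw [Algebra.smul_def, mul_smul]
  rfl

/-- The identity map from a module over `A((z-k)(z-l))` to the corresponding `sl₂`-module. -/
def sl2Equiv : T ≃+ toSl2 T := AddEquiv.refl T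

theorem smul_sl2Equiv (a : Usl2) (w : T) : a • sl2Equiv T w = sl2Equiv T (envToGWA k l a • w) :=
  rfl

theorem scalar_sl2Equiv (c : ℂ) (w : T) : c • sl2Equiv T w = sl2Equiv T (c • w) := by
  rw [← algebraMap_smul Usl2 c (sl2Equiv T w), smul_sl2Equiv, AlgHom.commutes, algebraMap_smul]

theorem envE_smul (w : T) :
    envE • sl2Equiv T w = sl2Equiv T (Complex.I • GWA.xp (quad k l) • w) := by
  rw [smul_sl2Equiv, envToGWA, envE, UniversalEnvelopingAlgebra.lift_ι_apply, ← smul_assoc]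
  simp [sl2ToGWA, sl2e]

theorem envF_smul (w : T) :
    envF • sl2Equiv T w = sl2Equiv T (Complex.I • GWA.xm (quad k l) • w) := by
  rw [smul_sl2Equiv, envToGWA, envF, UniversalEnvelopingAlgebra.lift_ι_apply, ← smul_assoc]
  simp [sl2ToGWA, sl2f]

theorem envH_smul (w : T) :
    envH • sl2Equiv T w = sl2Equiv T ((C 2 * X - C (k + l) : ℂ[X]) • w) := by
  rw [smul_sl2Equiv, envToGWA, envH, UniversalEnvelopingAlgebra.lift_ι_apply, poly_smul_def]
  simp [sl2ToGWA, sl2h, hImage]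

variable {T} {I U D : Set ℤ} {x : ℤ → T} {φ : ℤ → T →+ ℂ}

namespace IsThinBasis

theorem isHighest (h : IsThinBasis T I U D x φ) {K : ℤ} (hle : ∀ n ∈ I, n ≤ K) : IsHighest (sl2Equiv T (x K)) (2 * K - (k + l)) where
  e_smul := by
    have h0 : x (K + 1) = 0 := h.eq_zero _ fun hK => by have := hle _ hK; omega
    rw [envE_smul, h.xp_smul, h0, smul_zero, smul_zero, map_zero]
  h_smul := by
    rw [envH_smul, poly_smul_of_mem (h.mem K), scalar_sl2Equiv]
    simp

variable (h : IsThinBasis T I U D x φ) {K : ℤ} (hD : ∀ n ∈ I, n < K → n ∈ D)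

include h hD

/-- Every application of `f` moves one weight down. The scalar stays nonzero while weights remain:
if `n < K` is a weight then `n ∈ D`, so `n + 1` is a weight as well and the previous scalar was
nonzero. -/
theorem envF_pow (j : ℕ) :
    ∃ a : ℂ, envF ^ j • sl2Equiv T (x K) = a • sl2Equiv T (x (K - j)) ∧ (K - j ∈ I → a ≠ 0) := by
  induction j with
  | zero => exact ⟨1, by simp, fun _ => one_ne_zero⟩
  | succ j ih =>
    obtain ⟨a, ha, ha'⟩ := ih
    obtain ⟨n, hn⟩ : ∃ n : ℤ, K - j = n + 1 := ⟨K - j - 1, by ring⟩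
    have hn' : K - (j + 1 : ℕ) = n := by push_cast; omega
    rw [hn] at ha ha'
    rw [hn']
    have h1 := h.xm_smul n
    have h2 := h.down n
    generalize φ n (GWA.xm (quad k l) • x (n + 1)) = b at h1
    refine ⟨a * Complex.I * b, ?_, fun hI => ?_⟩
    · rw [pow_succ', mul_smul, ha, usl2_smul_comm, envF_smul, h1, ← scalar_sl2Equiv,
        ← scalar_sl2Equiv, smul_smul, smul_smul]
    · have hnD : n ∈ D := hD n hI (by omega)
      refine mul_ne_zero (mul_ne_zero (ha' (h.mem_of_mem_down hnD)) Complex.I_ne_zero) fun h0 => ?_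
      refine h2.1 hnD ?_
      rw [h1, h0, zero_smul]

theorem envF_pow_ne_zero_iff (j : ℕ) : envF ^ j • sl2Equiv T (x K) ≠ 0 ↔ K - j ∈ I := by
  obtain ⟨a, ha, ha'⟩ := h.envF_pow hD j
  rw [ha, smul_ne_zero_iff, (sl2Equiv T).map_ne_zero_iff]
  constructor
  · rintro ⟨-, hx⟩
    by_contra hI
    exact hx (h.eq_zero _ hI)
  · exact fun hI => ⟨ha' hI, h.ne_zero hI⟩

theorem span_envF_pow (hle : ∀ n ∈ I, n ≤ K) :
    Submodule.span ℂ (Set.range fun j : ℕ => envF ^ j • sl2Equiv T (x K)) = ⊤ := by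
  rw [Submodule.eq_top_iff']
  intro w
  obtain ⟨w, rfl⟩ := (sl2Equiv T).surjective w
  have hw : w ∈ Submodule.span ℂ (Set.range x) := h.span_scalar ▸ Submodule.mem_top
  induction hw using Submodule.span_induction with
  | mem w hw =>
    obtain ⟨n, rfl⟩ := hw
    by_cases hn : n ∈ I
    · obtain ⟨j, hj⟩ := Int.eq_ofNat_of_zero_le (sub_nonneg.2 (hle n hn))
      obtain rfl : n = K - j := by omega
      obtain ⟨a, ha, ha'⟩ := h.envF_pow hD j
      rw [← inv_smul_smul₀ (ha' hn) (sl2Equiv T (x (K - j))), ← ha]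
      exact Submodule.smul_mem _ _ (Submodule.subset_span ⟨j, rfl⟩)
    · rw [h.eq_zero n hn, map_zero]
      exact zero_mem _
  | zero => rw [map_zero]; exact zero_mem _
  | add v w _ _ hv hw => rw [map_add]; exact add_mem hv hw
  | smul c w _ hw => rw [← scalar_sl2Equiv]; exact Submodule.smul_mem _ _ hw

end IsThinBasis

/-- A thin module with weights `K, K - 1, …` on which `X⁻` is injective is a Verma module. -/
theorem Thin.nonempty_verma_equiv (h : Thin T I U D) {K : ℤ} (hI : ∀ n, n ∈ I ↔ n ≤ K)
    (hD : ∀ n < K, n ∈ D) {c : ℂ} (hc : c = 2 * K - (k + l)) :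
    Nonempty (Verma c ≃ₗ[Usl2] toSl2 T) := by
  obtain ⟨x, φ, h⟩ := h
  subst hc
  have hle : ∀ n ∈ I, n ≤ K := fun n => (hI n).1
  have hD' : ∀ n ∈ I, n < K → n ∈ D := fun n _ => hD n
  exact (h.isHighest hle).nonempty_verma_equiv (h.span_envF_pow hD' hle) fun j =>
    (h.envF_pow_ne_zero_iff hD' j).2 ((hI _).2 (by omega))

/-- A thin module with weights `K, K - 1, …, K - d + 1` on which `X⁻` is injective except at the
lowest weight is the simple module of dimension `d`, if its highest weight is `d - 1`. -/
theorem Thin.nonempty_simple_equiv (h : Thin T I U D) {W : Type v} [AddCommGroup W] [Module ℂ W]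
    [Module Usl2 W] [IsScalarTower ℂ Usl2 W] [FiniteDimensional ℂ W] [IsSimpleModule Usl2 W]
    {K : ℤ} (hI : ∀ n, n ∈ I ↔ n ≤ K ∧ K < n + Module.finrank ℂ W) (hD : ∀ n ∈ I, n < K → n ∈ D)
    (hc : (Module.finrank ℂ W - 1 : ℂ) = 2 * K - (k + l)) : Nonempty (W ≃ₗ[Usl2] toSl2 T) := by
  obtain ⟨x, φ, h⟩ := h
  obtain ⟨w, hw, hspan, hd, hne⟩ := exists_isHighest_of_simple W
  have hle : ∀ n ∈ I, n ≤ K := fun n hn => ((hI n).1 hn).1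
  refine hw.nonempty_equiv (hc ▸ h.isHighest hle) hspan (h.span_envF_pow hD hle) hd hne ?_ ?_
  · by_contra h0
    have := (hI _).1 ((h.envF_pow_ne_zero_iff hD _).1 h0)
    omega
  · intro j hj
    exact (h.envF_pow_ne_zero_iff hD _).2 ((hI _).2 (by omega))

end

/-! ### `sl₂`-modules as tensor products -/

theorem ofSet_ne_right (A : Set ℝ) (x : ℝ) : DirectedSubset.ofSet A x ≠ Membership.right :=
  fun h => not_isDirectedAt_ofSet A x (Or.inl h)

theorem mem_weights_Iio {e n : ℤ} :
    n ∈ weights (DirectedSubset.ofSet (Set.Iio ((e : ℝ) + 1 / 2))) ↔ n ≤ e := by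
  rw [weights, Set.mem_ofPred_eq, underlying_ofSet, Set.mem_Iio, lt_half_iff]

theorem mem_weights_Ioi {e n : ℤ} :
    n ∈ weights (DirectedSubset.ofSet (Set.Ioi ((e : ℝ) + 1 / 2))) ↔ e < n := by
  rw [weights, Set.mem_ofPred_eq, underlying_ofSet, Set.mem_Ioi, half_lt_iff]

theorem mem_downs_Iio {e n : ℤ} :
    n ∈ downs (DirectedSubset.ofSet (Set.Iio ((e : ℝ) + 1 / 2))) ↔ n < e := by
  rw [downs, Set.mem_ofPred_eq, mem_weights_Iio, mem_weights_Iio]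
  exact ⟨fun h => by omega, fun h => ⟨by omega, by omega, ofSet_ne_right _ _⟩⟩

theorem mem_downs_Ioi {e n : ℤ} :
    n ∈ downs (DirectedSubset.ofSet (Set.Ioi ((e : ℝ) + 1 / 2))) ↔ e < n := by
  rw [downs, Set.mem_ofPred_eq, mem_weights_Ioi, mem_weights_Ioi]
  exact ⟨fun h => by omega, fun h => ⟨by omega, by omega, ofSet_ne_right _ _⟩⟩

theorem mem_weights_lineMinus {k : ℝ} (n : ℤ) : n ∈ weights (DirectedSubset.lineMinus k) := by
  rw [weights, Set.mem_ofPred_eq, underlying_lineMinus]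
  trivial

theorem mem_downs_lineMinus {k : ℝ} (n : ℤ) : n ∈ downs (DirectedSubset.lineMinus k) := by
  refine ⟨mem_weights_lineMinus _, mem_weights_lineMinus _, ?_⟩
  unfold DirectedSubset.lineMinus
  split_ifs <;> simp

section

variable {k l : ℝ} (hk : IsHalfInt k) (hl : IsHalfInt l)

/-- The weights are the `k - l` integers strictly between `l` and `k`. The top one is `k - 1/2`,
where `h` acts by `k - l - 1`, one less than the dimension. -/
theorem nonempty_simple_equiv_tensor {W : Type u} [AddCommGroup W] [Module ℂ W]
    [Module Usl2 W] [IsScalarTower ℂ Usl2 W] [FiniteDimensional ℂ W] [IsSimpleModule Usl2 W]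
    (h : k - l = Module.finrank ℂ W) :
    Nonempty (W ≃ₗ[Usl2] toSl2 (k := k) (l := l) (tensor (modIio hk) (modIoi hl))) := by
  have hT := thin_tensor (thin_moduleOf (admissible_Iio hk)) (thin_moduleOf (admissible_Ioi hl))
  obtain ⟨e, rfl⟩ := id hk
  obtain ⟨g, rfl⟩ := id hl
  have h1 : e - g = Module.finrank ℂ W := by
    have : ((e - g : ℤ) : ℝ) = (Module.finrank ℂ W : ℤ) := by push_cast; linarith
    exact_mod_cast this
  refine hT.nonempty_simple_equiv (K := e) (fun n => ?_) (fun n hn hne => ?_) ?_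
  · rw [Set.mem_inter_iff, mem_weights_Iio, mem_weights_Ioi]
    omega
  · rw [Set.mem_inter_iff, mem_weights_Iio, mem_weights_Ioi] at hn
    exact ⟨mem_downs_Iio.2 hne, mem_downs_Ioi.2 hn.2⟩
  · have h2 : (e - g : ℂ) = Module.finrank ℂ W := by exact_mod_cast congrArg (Int.cast (R := ℂ)) h1
    rw [← h2]
    push_cast
    ring

theorem nonempty_verma_equiv_tensor_modMinus (h : l < k) {c : ℂ} (hc : c = k - l - 1) :
    Nonempty (Verma c ≃ₗ[Usl2] toSl2 (k := k) (l := l) (tensor (modIio hk) (modMinus hl))) := by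
  have hT := thin_tensor (thin_moduleOf (admissible_Iio hk))
    (thin_moduleOf (admissible_lineMinus hl))
  obtain ⟨e, rfl⟩ := id hk
  refine hT.nonempty_verma_equiv (K := e) (fun n => ?_) (fun n hn => ?_) ?_
  · rw [Set.mem_inter_iff, mem_weights_Iio]
    exact ⟨fun h => h.1, fun h => ⟨h, mem_weights_lineMinus n⟩⟩
  · exact ⟨mem_downs_Iio.2 hn, mem_downs_lineMinus n⟩
  · rw [hc]
    push_cast
    ring

/-- For `k ≤ l` the ray ending at `k` is contained in the one ending at `l`, so the product has the
weights below `k`, and `X⁻` is nonzero on all of them. -/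
theorem nonempty_verma_equiv_tensor_modIio (h : k ≤ l) {c : ℂ} (hc : c = k - l - 1) :
    Nonempty (Verma c ≃ₗ[Usl2] toSl2 (k := k) (l := l) (tensor (modIio hk) (modIio hl))) := by
  have hT := thin_tensor (thin_moduleOf (admissible_Iio hk)) (thin_moduleOf (admissible_Iio hl))
  obtain ⟨e, rfl⟩ := id hk
  obtain ⟨g, rfl⟩ := id hl
  have h1 : e ≤ g := by exact_mod_cast (by linarith : (e : ℝ) ≤ g)
  refine hT.nonempty_verma_equiv (K := e) (fun n => ?_) (fun n hn => ?_) ?_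
  · rw [Set.mem_inter_iff, mem_weights_Iio, mem_weights_Iio]
    omega
  · exact ⟨mem_downs_Iio.2 hn, mem_downs_Iio.2 (by omega)⟩
  · rw [hc]
    push_cast
    ring

end

/-- The set `ℝ` without directed elements. -/
abbrev fullLine : DirectedSubset := DirectedSubset.ofSet Set.univ

theorem mem_fullLine (n : ℤ) : (n : ℝ) ∈ fullLine.underlying := by
  rw [underlying_ofSet]
  trivial

theorem raise_fullLine (n : ℤ) : raise fullLine (vec fullLine n) = vec fullLine (n + 1) := by
  rw [raise_vec (mem_fullLine n)]
  simp [upCoeff, DirectedSubset.ofSet]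

theorem lower_fullLine (t : ℂ[X]) (n : ℤ) :
    lower t fullLine (vec fullLine n) = t.eval ((n : ℂ) - 1 / 2) • vec fullLine (n - 1) := by
  rw [lower_vec (mem_fullLine n)]
  congr 1
  simp only [downCoeff, DirectedSubset.ofSet, Set.mem_univ, if_true]
  congr 1
  push_cast
  ring

/-- The operators `X⁺ v_n = v_{n+1}` and `X⁻ v_{n+1} = t(n + 1/2) v_n` on the space with basis
`v_n`, `n ∈ ℤ`, for arbitrary `t`. -/
def fullAction (t : ℂ[X]) : GWAAction t (WeightSum fullLine) where
  xp := (raise fullLine).toAddMonoidHom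
  xm := (lower t fullLine).toAddMonoidHom
  xp_smul p w := by
    have : raise fullLine ∘ₗ polyEnd fullLine p =
        polyEnd fullLine (shift 1 p) ∘ₗ raise fullLine := by
      apply hom_ext_vec
      intro n hn
      rw [LinearMap.comp_apply, LinearMap.comp_apply, polyEnd_vec, map_smul, raise_fullLine,
        polyEnd_vec, eval_shift]
      push_cast
      rw [add_sub_cancel_right]
    exact LinearMap.congr_fun this w
  xm_smul p w := by
    have : lower t fullLine ∘ₗ polyEnd fullLine p =
        polyEnd fullLine (shift (-1) p) ∘ₗ lower t fullLine := by
      apply hom_ext_vec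
      intro n hn
      rw [LinearMap.comp_apply, LinearMap.comp_apply, polyEnd_vec, map_smul, lower_fullLine,
        map_smul, polyEnd_vec, eval_shift, smul_comm]
      push_cast
      rw [sub_neg_eq_add, sub_add_cancel]
    exact LinearMap.congr_fun this w
  xp_xm w := by
    have : raise fullLine ∘ₗ lower t fullLine = polyEnd fullLine (shift (1 / 2) t) := by
      apply hom_ext_vec
      intro n hn
      rw [LinearMap.comp_apply, polyEnd_vec, lower_fullLine, map_smul, eval_shift, raise_fullLine,
        sub_add_cancel]
    exact LinearMap.congr_fun this w
  xm_xp w := by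
    have : lower t fullLine ∘ₗ raise fullLine = polyEnd fullLine (shift (-1 / 2) t) := by
      apply hom_ext_vec
      intro n hn
      rw [LinearMap.comp_apply, polyEnd_vec, raise_fullLine, lower_fullLine, eval_shift,
        add_sub_cancel_right]
      congr 2
      push_cast
      ring
    exact LinearMap.congr_fun this w

/-- Used for `t = z - l` with `l` outside `ℤ + 1/2`, where there is no admissible set: the
coefficients of `X⁻` are values of `t` at half-integers and so do not vanish. -/
theorem thin_fullAction {t : ℂ[X]} (ht : ∀ n : ℤ, t.eval ((n : ℂ) + 1 / 2) ≠ 0) :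
    Thin (fullAction t).toModuleCat Set.univ Set.univ Set.univ := by
  have h := isThinBasis_toModuleCat (fullAction t)
  have hne : ∀ n : ℤ, vec fullLine n ≠ 0 := fun n => vec_ne_zero_iff.2 (mem_fullLine n)
  refine Thin.of_iff ⟨_, _, h⟩ (fun n => ?_) (fun n => ?_) fun n => ?_
  · exact iff_of_true (mem_fullLine n) trivial
  · refine iff_of_true ?_ trivial
    change raise fullLine (vec fullLine n) ≠ 0
    rw [raise_fullLine]
    exact hne _
  · refine iff_of_true ?_ trivial
    change lower t fullLine (vec fullLine (n + 1)) ≠ 0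
    rw [lower_fullLine]
    refine smul_ne_zero ?_ (hne _)
    convert ht n using 2
    push_cast
    ring

/-- Every Verma module is a tensor product of two weight modules over Weyl algebras. -/
theorem exists_verma_equiv_tensor (c : ℂ) : ∃ k l : ℂ, k - l = c + 1 ∧
    ∃ (M : ModuleCat.{0} (GWA (X - C k))) (N : ModuleCat.{0} (GWA (X - C l))),
      IsWeightModule M ∧ CategoryTheory.Indecomposable M ∧
      IsWeightModule N ∧ CategoryTheory.Indecomposable N ∧
      Nonempty (Verma c ≃ₗ[Usl2] toSl2 (k := k) (l := l) (tensor M N)) := by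
  -- The first root is fixed as `k = 1/2`, which makes `0` the top weight and forces `l = -1/2 - c`.
  have hk : IsHalfInt (((0 : ℤ) : ℝ) + 1 / 2) := ⟨0, rfl⟩
  have hM := (admissible_Iio hk).isWeightModule
  have hM' := (admissible_Iio hk).indecomposable connected_Iio
  by_cases hc : ∃ n : ℤ, c = n
  · obtain ⟨n, rfl⟩ := hc
    have hl : IsHalfInt (((-(n + 1) : ℤ) : ℝ) + 1 / 2) := ⟨_, rfl⟩
    refine ⟨_, (((-(n + 1) : ℤ) : ℝ) + 1 / 2 : ℝ), ?_, modIio hk, ?_⟩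
    · push_cast
      ring
    · by_cases h : (((-(n + 1) : ℤ) : ℝ) + 1 / 2) < ((0 : ℤ) : ℝ) + 1 / 2
      · refine ⟨modMinus hl, hM, hM', (admissible_lineMinus hl).isWeightModule,
          (admissible_lineMinus hl).indecomposable connected_lineMinus,
          nonempty_verma_equiv_tensor_modMinus hk hl h ?_⟩
        push_cast
        ring
      · refine ⟨modIio hl, hM, hM', (admissible_Iio hl).isWeightModule,
          (admissible_Iio hl).indecomposable connected_Iio,
          nonempty_verma_equiv_tensor_modIio hk hl (not_lt.1 h) ?_⟩
        push_cast
        ring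
  -- For nonintegral `c` the root `l` is not in `ℤ + 1/2`, so the second factor has all integers as
  -- weights and no vanishing arrow; the product keeps the weights and lowering arrows of the first
  -- factor.
  · have ht : ∀ n : ℤ, (X - C (-1 / 2 - c) : ℂ[X]).eval ((n : ℂ) + 1 / 2) ≠ 0 := by
      intro n hn
      rw [eval_sub, eval_X, eval_C] at hn
      refine hc ⟨-(n + 1), ?_⟩
      push_cast
      linear_combination hn
    have hN := thin_fullAction ht
    have hT := thin_tensor (thin_moduleOf (admissible_Iio hk)) hN
    obtain ⟨x, φ, hx⟩ := hN
    refine ⟨_, _, ?_, modIio hk, (fullAction (X - C (-1 / 2 - c))).toModuleCat, hM, hM',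
      hx.isWeightModule, hx.indecomposable ⟨0, trivial⟩ (fun _ _ _ _ _ _ _ => Or.inl trivial),
      hT.nonempty_verma_equiv (K := 0) (fun n => ?_) (fun n hn => ?_) ?_⟩
    · push_cast
      ring
    · rw [Set.inter_univ, mem_weights_Iio]
    · exact ⟨mem_downs_Iio.2 hn, trivial⟩
    · push_cast
      ring

theorem isRoot_prod {r : ℕ} {k : Fin r → ℝ} {m : Fin r → ℕ} (hm : ∀ a, 0 < m a) (a : Fin r) :
    (∏ a, (X - C (k a : ℂ)) ^ m a).IsRoot (k a : ℂ) := by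
  rw [IsRoot.def, eval_prod]
  refine Finset.prod_eq_zero (Finset.mem_univ a) ?_
  rw [eval_pow, eval_sub, eval_X, eval_C, sub_self, zero_pow (hm a).ne']

end RankOne

end

open RankOne in
theorem mainTheorem5 :
    -- the modules `M_S^t` and the tensor decomposition
    (∀ (r : ℕ) (k : Fin r → ℝ) (m : Fin r → ℕ) (hk : ∀ a, IsHalfInt (k a)),
      StrictMono k → (∀ a, 0 < m a) →
      ∀ t : ℂ[X], t = ∏ a, (X - C (k a : ℂ)) ^ m a →
      -- `M_S^t` is an indecomposable object of `A(t)-wmod_𝒪` with the prescribed properties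
      (∀ (S : DirectedSubset) (hS : IsAdmissible t S), S.Connected →
        IsWeightModule (moduleOf hS) ∧ CategoryTheory.Indecomposable (moduleOf hS) ∧
        support (moduleOf hS) = {c : ℂ | ∃ n : ℤ, c = n ∧ (n : ℝ) ∈ S.underlying} ∧
        (∀ (a : Fin r) (w : moduleOf hS), w ≠ 0 → w ∈ weightSpace (moduleOf hS) (k a - 1 / 2) →
          (GWA.xp t • w ≠ 0 ↔ S (k a) = Membership.right)) ∧
        (∀ (a : Fin r) (w : moduleOf hS), w ≠ 0 → w ∈ weightSpace (moduleOf hS) (k a + 1 / 2) →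
          (GWA.xm t • w ≠ 0 ↔ S (k a) = Membership.left))) ∧
      ∀ M : ModuleCat.{u} (GWA t), IsWeightModule M → CategoryTheory.Indecomposable M →
        -- `M` is isomorphic to `M_S^t` for a unique connected `t`-admissible `S`
        (∃! S : DirectedSubset, ∃ hS : IsAdmissible t S,
          S.Connected ∧ Nonempty (M ≃ₗ[GWA t] moduleOf hS)) ∧
        ∀ (S : DirectedSubset) (hS : IsAdmissible t S), S.Connected →
          Nonempty (M ≃ₗ[GWA t] moduleOf hS) →
          ∃ i j : ℕ, i < j ∧ j ≤ r + 1 ∧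
            S.underlying = {x : ℝ | extRoot k i < (x : EReal) ∧ (x : EReal) < extRoot k j} ∧
            -- the factors are indecomposable weight modules over the Weyl algebras
            (∀ a, IsWeightModule (factor hk S i j a) ∧
              CategoryTheory.Indecomposable (factor hk S i j a)) ∧
            -- the decomposition
            IsoTo M (tensorPowers (factor hk S i j) m) ∧
            -- uniqueness of the factors `M_a` for `i ≤ a ≤ j`
            (∀ N : (a : Fin r) → ModuleCat.{v} (GWA (X - C (k a : ℂ))),
              (∀ a, IsWeightModule (N a) ∧ CategoryTheory.Indecomposable (N a)) →
              IsoTo M (tensorPowers N m) →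
              ∀ a : Fin r, i ≤ (a : ℕ) + 1 → (a : ℕ) + 1 ≤ j →
                Nonempty (N a ≃ₗ[GWA (X - C (k a : ℂ))] factor hk S i j a)) ∧
            -- the factors `M_a` for `a < i` and for `j < a` may be replaced
            (∀ N : (a : Fin r) → ModuleCat.{0} (GWA (X - C (k a : ℂ))),
              (∀ a : Fin r, N a = factor hk S i j a ∨
                (((a : ℕ) + 1 < i ∨ j < (a : ℕ) + 1) ∧
                  (N a = modPlus (hk a) ∨ N a = modMinus (hk a)))) →
              IsoTo M (tensorPowers N m))) ∧
    -- `A(z - k)` is the Weyl algebra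
    (∀ k : ℂ, ∃ e : GWA (X - C k) ≃ₐ[ℂ] WeylAlgebra,
      e (GWA.xp _) = weylX ∧ e (GWA.xm _) = weylD ∧
      e (GWA.z _) = (1 / 2 : ℂ) • (weylX * weylD + weylD * weylX) + algebraMap ℂ WeylAlgebra k) ∧
    -- finite-dimensional simple `sl₂`-modules
    (∀ (V : Type u) [AddCommGroup V] [Module ℂ V] [Module Usl2 V] [IsScalarTower ℂ Usl2 V]
      [FiniteDimensional ℂ V] [IsSimpleModule Usl2 V] (k l : ℝ) (hk : IsHalfInt k)
      (hl : IsHalfInt l), k - l = Module.finrank ℂ V →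
      Nonempty (V ≃ₗ[Usl2] toSl2 (k := k) (l := l) (tensor (modIio hk) (modIoi hl)))) ∧
    -- Verma modules of integral highest weight
    (∀ (k l : ℝ) (hk : IsHalfInt k) (hl : IsHalfInt l),
      (l < k → Nonempty (Verma (k - l - 1) ≃ₗ[Usl2]
        toSl2 (k := k) (l := l) (tensor (modIio hk) (modMinus hl)))) ∧
      (k ≤ l → Nonempty (Verma (k - l - 1) ≃ₗ[Usl2]
        toSl2 (k := k) (l := l) (tensor (modIio hk) (modIio hl))))) ∧
    -- Verma modules of arbitrary highest weight
    (∀ c : ℂ, ∃ k l : ℂ, k - l = c + 1 ∧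
      ∃ (M : ModuleCat.{0} (GWA (X - C k))) (N : ModuleCat.{0} (GWA (X - C l))),
        IsWeightModule M ∧ CategoryTheory.Indecomposable M ∧
        IsWeightModule N ∧ CategoryTheory.Indecomposable N ∧
        Nonempty (Verma c ≃ₗ[Usl2] toSl2 (k := k) (l := l) (tensor M N))) := by
  refine ⟨fun r k m hk hmono hm t ht => ⟨fun S hS hc => ?_, fun M hM hind => ?_⟩, fun k => ?_,
    fun V _ _ _ _ _ _ k l hk hl h => ?_, fun k l hk hl => ⟨fun h => ?_, fun h => ?_⟩, fun c => ?_⟩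
  · have hroot : ∀ a, t.IsRoot (k a : ℂ) := fun a => ht ▸ isRoot_prod hm a
    exact ⟨hS.isWeightModule, hS.indecomposable hc, hS.support_eq,
      fun a w h0 hw => hS.xp_ne_zero_iff (hroot a) h0 hw,
      fun a w h0 hw => hS.xm_ne_zero_iff (hroot a) h0 hw⟩
  · exact classification hk hmono hm ht M hM hind
  · exact ⟨gwaEquivWeyl k, gwaToWeyl_xp k, gwaToWeyl_xm k, gwaToWeyl_z k⟩
  · exact nonempty_simple_equiv_tensor hk hl h
  · exact nonempty_verma_equiv_tensor_modMinus hk hl h rfl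
  · exact nonempty_verma_equiv_tensor_modIio hk hl h rfl
  · exact exists_verma_equiv_tensor c
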